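/- Let $\mathbb{C}\mathrm{a}=\{a+b\mathrm e : a,b\in\mathbb H\}\cong\mathbb R^8$ be the algebra of Cayley numbers, with the Euclidean inner product of $\mathbb H^2$, product $(a+b\mathrm e)(c+d\mathrm e)=(ac-\overline d b)+(b\overline c+da)\mathrm e$, conjugation $\overline{a+b\mathrm e}=\overline a-b\mathrm e$ and three-fold cross product $x\times y\times z=\tfrac12\bigl(x(\overline y z)-z(\overline y x)\bigr)$. A 4-dimensional subspace $\zeta\subset\mathbb R^8$ is a Cayley 4-plane if it is closed under this cross product; it is oriented by its bases of the form $(x\times y\times z,x,y,z)$. A Cayley 4-frame is an oriented orthonormal basis of a Cayley 4-plane, and $V\subset(\mathbb R^8)^4$ is the set (Stiefel manifold) of all Cayley 4-frames. Let $\mathrm{Spin}(7)$ be the spin group of $\mathrm{Im}\,\mathbb{C}\mathrm{a}\cong\mathbb R^7$, in the Clifford algebra with $u^2=-|u|^2$ for $u\in\mathrm{Im}\,\mathbb{C}\mathrm{a}$. It acts on $\mathbb R^8\cong\mathbb{C}\mathrm{a}$ by the spin representation, in which $u\in\mathrm{Im}\,\mathbb{C}\mathrm{a}$ acts by right multiplication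 $x\mapsto xu$, and it acts componentwise on $(\mathbb R^8)^4$. **Proposition.** The Stiefel manifold of Cayley 4-frames is the homogeneous space $V=\mathrm{Spin}(7)/\mathrm{Sp}(1)$. Precisely: $V$ is non-empty; $\mathrm{Spin}(7)$, with its topology as a subspace of the Clifford algebra, is a Lie group of dimension $21$ that acts smoothly on $\mathbb R^8$; $V$ is a smooth embedded submanifold of $(\mathbb R^8)^4$ of dimension $18$; and for every $f\in V$, 1. the $\mathrm{Spin}(7)$-orbit of $f$ is $V$; 2. the isotropy group $\mathrm{Spin}(7)_f$ is the image of a smoothly embedded group homomorphism $\mathrm{Sp}(1)\to\mathrm{Spin}(7)$, where $\mathrm{Sp}(1)$ is the group of unit quaternions; 3. the quotient $\mathrm{Spin}(7)/\mathrm{Spin}(7)_f$, with the quotient topology, has a smooth structure for which the projection from $\mathrm{Spin}(7)$ is a submersion, and for which $g\,\mathrm{Spin}(7)_f\mapsto g\cdot f$ is a diffeomorphism onto $V$. -/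

import Mathlib

open scoped Quaternion Manifold ContDiff

noncomputable section

/-! ### Cayley numbers -/

/-- The Cayley numbers `a + b e`, i.e. pairs `(a, b)` of quaternions, with the Euclidean norm of
`ℝ⁸ = ℍ²`. -/
abbrev Cayley : Type := WithLp 2 (ℍ[ℝ] × ℍ[ℝ])

namespace Cayley

/-- `a + b e`. -/
def mk (a b : ℍ[ℝ]) : Cayley := WithLp.toLp 2 (a, b)

/-- `(a + b e)(c + d e) = (a c - d̄ b) + (b c̄ + d a) e`. -/
instance instMul : Mul Cayley where
  mul x y := mk (x.fst * y.fst - star y.snd * x.snd) (x.snd * star y.fst + y.snd * x.fst)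

theorem ext_pair {x y : Cayley} (h₁ : x.fst = y.fst) (h₂ : x.snd = y.snd) : x = y :=
  WithLp.ofLp_injective 2 (Prod.ext h₁ h₂)

theorem mk_fst (a b : ℍ[ℝ]) : (mk a b).fst = a := rfl

theorem mk_snd (a b : ℍ[ℝ]) : (mk a b).snd = b := rfl

theorem mul_fst (x y : Cayley) : (x * y).fst = x.fst * y.fst - star y.snd * x.snd := rfl

theorem mul_snd (x y : Cayley) : (x * y).snd = x.snd * star y.fst + y.snd * x.fst := rfl

/-- The conjugate of `a + b e` is `ā - b e`. -/
def conj (x : Cayley) : Cayley := mk (star x.fst) (-x.snd)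

/-- The three-fold cross product `x × y × z = ½ (x (ȳ z) - z (ȳ x))`. -/
def cross (x y z : Cayley) : Cayley :=
  (2⁻¹ : ℝ) • (x * (conj y * z) - z * (conj y * x))

/-- The imaginary Cayley numbers `Im Ca ≅ ℝ⁷`: those with real part zero. -/
def imaginary : Submodule ℝ Cayley where
  carrier := {x | x.fst.re = 0}
  add_mem' := by
    intro x y hx hy
    simp only [Set.mem_ofPred_eq] at hx hy ⊢
    simp [hx, hy]
  zero_mem' := by simp
  smul_mem' := by
    intro c x hx
    simp only [Set.mem_ofPred_eq] at hx ⊢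
    simp [hx]

/-- Right multiplication `x ↦ x u`, linearly in both arguments. -/
def rightMul : Cayley →ₗ[ℝ] Module.End ℝ Cayley :=
  LinearMap.mk₂ ℝ (fun u x : Cayley => x * u)
    (by
      intro u v x
      change mk _ _ = mk _ _ + mk _ _
      refine ext_pair ?_ ?_ <;> ext <;> simp [mk] <;> ring)
    (by
      intro c u x
      change mk _ _ = c • mk _ _
      refine ext_pair ?_ ?_ <;> ext <;> simp [mk] <;> ring)
    (by
      intro u x y
      change mk _ _ = mk _ _ + mk _ _
      refine ext_pair ?_ ?_ <;> ext <;> simp [mk] <;> ring)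
    (by
      intro c u x
      change mk _ _ = c • mk _ _
      refine ext_pair ?_ ?_ <;> ext <;> simp [mk] <;> ring)

theorem rightMul_apply (u x : Cayley) : rightMul u x = x * u := rfl

end Cayley

/-! ### The group `Spin(7)` and its spin representation on `ℝ⁸` -/

/-- The negative definite quadratic form `u ↦ -|u|²` on `Im Ca ≅ ℝ⁷`. -/
def imForm : QuadraticForm ℝ Cayley.imaginary :=
  -LinearMap.BilinMap.toQuadraticMap (innerₗ Cayley.imaginary)

theorem imForm_apply (u : Cayley.imaginary) : imForm u = -‖(u : Cayley)‖ ^ 2 := by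
  simp [imForm]

/-- `Spin(7)`, as a subset of the Clifford algebra of `Im Ca ≅ ℝ⁷`. -/
abbrev Spin7 : Type := spinGroup imForm

/-- The standard topology of a finite-dimensional real vector space on the Clifford algebra;
`Spin7` gets the subspace topology. -/
instance : TopologicalSpace (CliffordAlgebra imForm) := moduleTopology ℝ _

open Cayley in
theorem Cayley.mul_self_right (u : Cayley.imaginary) (x : Cayley) :
    x * (u : Cayley) * (u : Cayley) = imForm u • x := by
  obtain ⟨u, hu⟩ := u
  have h0 : u.fst.re = 0 := hu
  rw [imForm_apply, WithLp.prod_norm_sq_eq_of_L2, ← real_inner_self_eq_norm_sq,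
    ← real_inner_self_eq_norm_sq, Quaternion.inner_self, Quaternion.inner_self,
    Quaternion.normSq_def', Quaternion.normSq_def']
  change mk (_ * _ - _ * _) (_ * _ + _ * _) = _ • x
  refine ext_pair ?_ ?_ <;> ext <;> simp [mk_fst, mk_snd, mul_fst, mul_snd, h0] <;> ring

/-- The action of the Clifford algebra on `Ca ≅ ℝ⁸` in which an imaginary Cayley number `u` acts
by the right multiplication `x ↦ x u`. -/
def cliffordRep : CliffordAlgebra imForm →ₐ[ℝ] Module.End ℝ Cayley :=
  CliffordAlgebra.lift imForm
    ⟨Cayley.rightMul ∘ₗ Cayley.imaginary.subtype, by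
      intro u
      ext1 x
      simpa [Algebra.algebraMap_eq_smul_one, Cayley.rightMul_apply] using
        Cayley.mul_self_right u x⟩

/-- The spin representation: `Spin(7)` acts on `Ca ≅ ℝ⁸` through the Clifford algebra, and so
(componentwise) on frames in `ℝ⁸`. -/
instance : MulAction Spin7 Cayley where
  smul g x := cliffordRep (g : CliffordAlgebra imForm) x
  one_smul x := by
    change cliffordRep 1 x = x
    simp
  mul_smul g h x := by
    change cliffordRep ((g : CliffordAlgebra imForm) * h) x = cliffordRep g (cliffordRep h x)
    simp

theorem Spin7.smul_def (g : Spin7) (x : Cayley) :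
    g • x = cliffordRep (g : CliffordAlgebra imForm) x := rfl

/-! ### The group `Sp(1)` -/

/-- `Sp(1)`: the group of unit quaternions, with the manifold structure of the unit sphere. -/
abbrev Sp1 : Type := Metric.sphere (0 : ℍ[ℝ]) 1

instance : Fact (Module.finrank ℝ ℍ[ℝ] = 3 + 1) := ⟨Quaternion.finrank_eq_four⟩

/-! ### Cayley 4-planes and Cayley 4-frames -/

/-- A Cayley 4-plane: a 4-dimensional subspace of `ℝ⁸` closed under the three-fold cross
product. -/
def IsCayleyPlane (ζ : Submodule ℝ Cayley) : Prop :=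
  Module.finrank ℝ ζ = 4 ∧ ∀ x ∈ ζ, ∀ y ∈ ζ, ∀ z ∈ ζ, Cayley.cross x y z ∈ ζ

/-- Two bases of the same 4-plane define the same orientation: the change of basis has positive
determinant. -/
def SameOrientation (f g : Fin 4 → Cayley) : Prop :=
  ∃ A : Matrix (Fin 4) (Fin 4) ℝ, 0 < A.det ∧ ∀ i, g i = ∑ j, A i j • f j

/-- A Cayley 4-frame: an oriented orthonormal basis of a Cayley 4-plane `ζ`, where `ζ` is
oriented by its bases of the form `(x × y × z, x, y, z)`. -/
def IsCayleyFrame (f : Fin 4 → Cayley) : Prop :=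
  Orthonormal ℝ f ∧ ∃ ζ : Submodule ℝ Cayley, IsCayleyPlane ζ ∧
    Submodule.span ℝ (Set.range f) = ζ ∧
    ∃ x ∈ ζ, ∃ y ∈ ζ, ∃ z ∈ ζ,
      LinearIndependent ℝ ![Cayley.cross x y z, x, y, z] ∧
      SameOrientation ![Cayley.cross x y z, x, y, z] f

/-- The Stiefel manifold of Cayley 4-frames, with the subspace topology of `(ℝ⁸)⁴`. -/
abbrev CayleyStiefel : Type := {f : Fin 4 → Cayley // IsCayleyFrame f}

end

/-!
# Cayley frames as a homogeneous space of `Spin(7)`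

*Representation.* The spin representation `T : Spin(7) → End ℝ⁸` is a topological embedding
(`Spin7.isEmbedding_toCLM`): the Clifford algebra embeds into two copies of `End ℝ⁸` by the
representation and its twist by the grading involution (`eq_zero_of_cliffordRep_eq_zero`), and the
two agree on even elements.  By the Moufang identities, `Spin(7)` preserves the triple product
`x (ȳ z)` and hence the three-fold cross product (`Spin7.triple_smul`, `Spin7.cross_smul`); it also
preserves the inner product.

*Orbits.* A Cayley frame is an orthonormal `f` with `f₀ = f₁ × f₂ × f₃`, and all of these are
images of the standard frame `(1, i, j, k)` (`isCayleyFrame_iff`): products of right multiplications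
move `f₀` to `1`, and involutions that fix a quaternion subalgebra and are `-1` on its complement
generate the rest.  An element fixing the standard frame is an algebra automorphism that fixes `ℍ`,
so it is `a + b e ↦ a + (q b) e` with a unit quaternion `q` (`range_spOneHom`).

*Charts.* All the smooth structures come from charts that are restrictions of linear maps on an
ambient space (`LinearAtlas`): a smooth parametrisation `σ` and a linear map `R` that is injective
on the space near `σ 0`, with `R ∘ σ` submersive at `0`, give such a chart by the inverse function
theorem (`exists_chart_of_parametrization`).  Here `σ` is a product of rotations
`cos θ + sin θ R_v R_u`, for imaginary units `u ⟂ v`, and `R` consists of the matrix entries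
`spinCoord` on `Spin(7) ⊆ End ℝ⁸`, and of `frameCoord` on `V ⊆ (ℝ⁸)⁴`.  Injectivity near the base
point is the elementary fact that a vector orthogonal to eight vectors near an orthonormal basis
vanishes (`frame_eq_of_frameCoord_eq`, `spin_eq_of_spinCoord_eq`); submersivity is a linear algebra
computation with bivectors (`span_spinCoord_unitBivectors`).  Translating these charts by `Spin(7)`
gives atlases.

*The orbit map.* Since `frameCoord` is a part of `spinCoord`, the orbit map is a linear projection
in these charts (`frameAtlas_chart_stdOrbit`), and the inclusion of the stabiliser is the inclusion
of the other coordinates (`isSmoothEmbedding_spOneConj`).  So the orbit map is open, which makes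
`Spin(7) / Spin(7)_f → V` a homeomorphism, along which the smooth structure of `V` is transported.
-/

noncomputable section

open Set Topology

/-! ### Submanifolds presented by linear charts -/

/-- A presentation of a topological space `X` as an embedded submanifold of the normed space `E`,
modelled on `F`, by an inducing map `j`.  Every chart is the restriction of a continuous *linear*
map `coord i : E → F`, and its inverse is smooth as a map to `E`; so `X` is locally the graph of a
smooth map over a subspace of `E`. -/
structure LinearAtlas {X E F : Type*} [TopologicalSpace X] [NormedAddCommGroup E]
    [NormedSpace ℝ E] [NormedAddCommGroup F] [NormedSpace ℝ F] (j : X → E) (ι : Type*) where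
  /-- the charts -/
  chart : ι → OpenPartialHomeomorph X F
  /-- the linear maps which restrict to the charts -/
  coord : ι → E →L[ℝ] F
  /-- a chart around a given point -/
  pick : X → ι
  mem_pick : ∀ x, x ∈ (chart (pick x)).source
  chart_eq : ∀ i, ∀ x ∈ (chart i).source, chart i x = coord i (j x)
  contDiffOn_symm : ∀ i, ContDiffOn ℝ ∞ (fun y => j ((chart i).symm y)) (chart i).target
  coord_surjective : ∀ i, Function.Surjective (coord i)
  isEmbedding : IsEmbedding j

namespace LinearAtlas

variable {X E F ι : Type*} [TopologicalSpace X] [NormedAddCommGroup E]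
    [NormedSpace ℝ E] [NormedAddCommGroup F] [NormedSpace ℝ F] {j : X → E}
    (A : LinearAtlas (F := F) j ι)

/-- The charted space whose atlas consists of the given charts. -/
abbrev chartedSpace : ChartedSpace F X where
  atlas := range A.chart
  chartAt x := A.chart (A.pick x)
  mem_chart_source := A.mem_pick
  chart_mem_atlas _ := mem_range_self _

theorem isManifold : letI := A.chartedSpace; IsManifold 𝓘(ℝ, F) ∞ X := by
  let := A.chartedSpace
  apply isManifold_of_contDiffOn
  rintro _ _ ⟨i, rfl⟩ ⟨i', rfl⟩
  have h : ContDiffOn ℝ ∞ (fun y => A.coord i' (j ((A.chart i).symm y))) (A.chart i).target :=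
    (A.coord i').contDiff.comp_contDiffOn (A.contDiffOn_symm i)
  refine (h.mono ?_).congr ?_
  · intro y hy
    simp at hy
    exact hy.1
  · intro y hy
    simp at hy
    simpa using A.chart_eq i' _ hy.2

theorem chart_mem_maximalAtlas (i : ι) :
    letI := A.chartedSpace; A.chart i ∈ IsManifold.maximalAtlas 𝓘(ℝ, F) ∞ X := by
  let := A.chartedSpace
  have := A.isManifold
  exact IsManifold.subset_maximalAtlas (mem_range_self i)

/-- The inclusion is smooth. -/
theorem contMDiff_incl : letI := A.chartedSpace; ContMDiff 𝓘(ℝ, F) 𝓘(ℝ, E) ∞ j := by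
  let := A.chartedSpace
  have := A.isManifold
  intro x
  set i := A.pick x
  have h1 : ContMDiffAt 𝓘(ℝ, F) 𝓘(ℝ, F) ∞ (A.chart i) x :=
    contMDiffAt_of_mem_maximalAtlas (A.chart_mem_maximalAtlas i) (A.mem_pick x)
  have h2 : ContMDiffAt 𝓘(ℝ, F) 𝓘(ℝ, E) ∞ (fun y => j ((A.chart i).symm y)) (A.chart i x) :=
    ((A.contDiffOn_symm i).contDiffAt ((A.chart i).open_target.mem_nhds
      ((A.chart i).map_source (A.mem_pick x)))).contMDiffAt
  refine (h2.comp x h1).congr_of_eventuallyEq ?_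
  filter_upwards [(A.chart i).open_source.mem_nhds (A.mem_pick x)] with z hz
  simp [(A.chart i).left_inv hz]

/-- A map into the submanifold is smooth if it is smooth as a map to the ambient space. -/
theorem contMDiff_of_incl {E' H' M : Type*} [NormedAddCommGroup E'] [NormedSpace ℝ E']
    [TopologicalSpace H'] {I : ModelWithCorners ℝ E' H'} [TopologicalSpace M] [ChartedSpace H' M]
    {f : M → X} (hf : ContMDiff I 𝓘(ℝ, E) ∞ (fun m => j (f m))) :
    letI := A.chartedSpace; ContMDiff I 𝓘(ℝ, F) ∞ f := by
  let := A.chartedSpace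
  have := A.isManifold
  have hc : Continuous f := A.isEmbedding.continuous_iff.2 hf.continuous
  intro m
  rw [contMDiffAt_iff_target]
  refine ⟨hc.continuousAt, ?_⟩
  have h : ContMDiffAt I 𝓘(ℝ, F) ∞ (fun m' => A.coord (A.pick (f m)) (j (f m'))) m :=
    (A.coord (A.pick (f m))).contMDiff.contMDiffAt.comp m hf.contMDiffAt
  refine h.congr_of_eventuallyEq ?_
  filter_upwards [hc.continuousAt.preimage_mem_nhds
    ((A.chart (A.pick (f m))).open_source.mem_nhds (A.mem_pick (f m)))] with z hz
  exact A.chart_eq _ _ hz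

/-- The inclusion is an immersion: in the chart `y ↦ y - j (c⁻¹ (coord y)) + s (coord y)` of `E`,
where `s` is a linear section of `coord`, it becomes the linear map `s`. -/
theorem isSmoothEmbedding [FiniteDimensional ℝ E] [FiniteDimensional ℝ F] :
    letI := A.chartedSpace; Manifold.IsSmoothEmbedding 𝓘(ℝ, F) 𝓘(ℝ, E) ∞ j := by
  let := A.chartedSpace
  have := A.isManifold
  refine ⟨?_, A.isEmbedding⟩
  apply Manifold.IsImmersionOfComplement.isImmersion
    (F := EuclideanSpace ℝ (Fin (Module.finrank ℝ E - Module.finrank ℝ F)))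
  intro x
  set i := A.pick x
  obtain ⟨s₀, hs₀⟩ := (A.coord i).toLinearMap.exists_rightInverse_of_surjective
    (LinearMap.range_eq_top.2 (A.coord_surjective i))
  let s : F →L[ℝ] E := s₀.toContinuousLinearMap
  have hs : Function.RightInverse s (A.coord i) := fun y => LinearMap.congr_fun hs₀ y
  have hker : Module.finrank ℝ (EuclideanSpace ℝ (Fin (Module.finrank ℝ E - Module.finrank ℝ F)))
      = Module.finrank ℝ (A.coord i).ker := by
    have h := (A.coord i).toLinearMap.finrank_range_add_finrank_ker
    rw [LinearMap.range_eq_top.2 (A.coord_surjective i), finrank_top] at h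
    rw [finrank_euclideanSpace_fin, ← h, Nat.add_sub_cancel_left]
  let k := ContinuousLinearEquiv.ofFinrankEq hker
  let e := ((ContinuousLinearEquiv.refl ℝ F).prodCongr k).trans
    (ContinuousLinearEquiv.equivOfRightInverse (A.coord i) s hs).symm
  have he : ∀ y, e (y, 0) = s y := by intro y; simp [e]
  have hci : ContDiffOn ℝ ∞ (fun y => j ((A.chart i).symm (A.coord i y)))
      (A.coord i ⁻¹' (A.chart i).target) :=
    (A.contDiffOn_symm i).comp (A.coord i).contDiff.contDiffOn (fun _ h => h)
  have hsec : ∀ y ∈ (A.chart i).target, A.coord i (j ((A.chart i).symm y)) = y := by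
    intro y hy
    rw [← A.chart_eq i _ ((A.chart i).map_target hy), (A.chart i).right_inv hy]
  have hd1 : ContDiffOn ℝ ∞ (fun y => y - j ((A.chart i).symm (A.coord i y)) + s (A.coord i y))
      (A.coord i ⁻¹' (A.chart i).target) :=
    (contDiffOn_id.sub hci).add (s.contDiff.comp (A.coord i).contDiff).contDiffOn
  have hd2 : ContDiffOn ℝ ∞ (fun y => y - s (A.coord i y) + j ((A.chart i).symm (A.coord i y)))
      (A.coord i ⁻¹' (A.chart i).target) :=
    (contDiffOn_id.sub (s.contDiff.comp (A.coord i).contDiff).contDiffOn).add hci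
  let Ψ : OpenPartialHomeomorph E E :=
    { toFun := fun y => y - j ((A.chart i).symm (A.coord i y)) + s (A.coord i y)
      invFun := fun y => y - s (A.coord i y) + j ((A.chart i).symm (A.coord i y))
      source := A.coord i ⁻¹' (A.chart i).target
      target := A.coord i ⁻¹' (A.chart i).target
      map_source' := by
        intro y hy
        simpa [hsec _ hy, hs (A.coord i y)] using hy
      map_target' := by
        intro y hy
        simpa [hsec _ hy, hs (A.coord i y)] using hy
      left_inv' := by
        intro y hy
        simp [hsec _ hy, hs (A.coord i y)]
      right_inv' := by
        intro y hy
        simp [hsec _ hy, hs (A.coord i y)]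
      open_source := (A.chart i).open_target.preimage (A.coord i).continuous
      open_target := (A.chart i).open_target.preimage (A.coord i).continuous
      continuousOn_toFun := hd1.continuousOn
      continuousOn_invFun := hd2.continuousOn }
  refine Manifold.IsImmersionAtOfComplement.mk_of_charts e (A.chart i) Ψ (A.mem_pick x) ?_
    (A.chart_mem_maximalAtlas i) ?_ ?_ ?_
  · change A.coord i (j x) ∈ (A.chart i).target
    rw [← A.chart_eq i x (A.mem_pick x)]
    exact (A.chart i).map_source (A.mem_pick x)
  · exact Ψ.mem_maximalAtlas_of_contMDiffOn hd1.contMDiffOn hd2.contMDiffOn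
  · intro z hz
    change A.coord i (j z) ∈ (A.chart i).target
    rw [← A.chart_eq i z hz]
    exact (A.chart i).map_source hz
  · intro y hy
    have hy' : y ∈ (A.chart i).target := by simpa using hy
    change j ((A.chart i).symm y) - j ((A.chart i).symm (A.coord i (j ((A.chart i).symm y)))) +
      s (A.coord i (j ((A.chart i).symm y))) = e (y, 0)
    rw [hsec y hy', he, sub_self, zero_add]

end LinearAtlas

/-- A parametrised piece of a subspace gives a chart.  If `σ` is a map to `X`, smooth as a map to
`E`, such that the linear map `R` restricted to `X` is injective near `σ 0` and `R ∘ j ∘ σ` is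
submersive at `0`, then `R` restricts to a chart of `X` at `σ 0`. -/
theorem exists_chart_of_parametrization {X E F P : Type*} [TopologicalSpace X]
    [NormedAddCommGroup E] [NormedSpace ℝ E] [NormedAddCommGroup F] [NormedSpace ℝ F]
    [NormedAddCommGroup P] [NormedSpace ℝ P] [FiniteDimensional ℝ F]
    {j : X → E} (hj : IsInducing j) {σ : P → X} (hσ : ContDiff ℝ ∞ (fun p => j (σ p)))
    (R : E →L[ℝ] F) {D : P →L[ℝ] E} (hD : HasFDerivAt (fun p => j (σ p)) D 0)
    (hR : Function.Surjective (fun p => R (D p)))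
    {N : Set X} (hN : N ∈ 𝓝 (σ 0)) (hinj : InjOn (fun x => R (j x)) N) :
    ∃ c : OpenPartialHomeomorph X F, σ 0 ∈ c.source ∧ (∀ x ∈ c.source, c x = R (j x)) ∧
      ContDiffOn ℝ ∞ (fun y => j (c.symm y)) c.target := by
  have : CompleteSpace F := FiniteDimensional.complete ℝ F
  -- restrict the parameters to a subspace on which the derivative is invertible
  obtain ⟨L₀, hL₀⟩ := (R ∘L D).toLinearMap.exists_rightInverse_of_surjective
    (LinearMap.range_eq_top.2 hR)
  let L : F →L[ℝ] P := L₀.toContinuousLinearMap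
  have hL : ∀ y, R (D (L y)) = y := fun y => LinearMap.congr_fun hL₀ y
  let g : F → F := fun y => R (j (σ (L y)))
  have hjL : ContDiff ℝ ∞ (fun y => j (σ (L y))) := hσ.comp L.contDiff
  have hg : ContDiff ℝ ∞ g := R.contDiff.comp hjL
  have hg' : HasFDerivAt g ((ContinuousLinearEquiv.refl ℝ F : F ≃L[ℝ] F) : F →L[ℝ] F) 0 := by
    have h1 : HasFDerivAt (fun p => j (σ p)) D (L 0) := by rwa [map_zero]
    have h2 := (R.hasFDerivAt.comp (L 0) h1).comp (0 : F) L.hasFDerivAt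
    convert! h2 using 1
    ext y
    simp [hL]
  have hσc : Continuous (fun y => σ (L y)) := hj.continuous_iff.2 hjL.continuous
  let e₀ := (hg.contDiffAt (x := 0)).toOpenPartialHomeomorph g hg' (by simp)
  -- shrink the domain so that the derivative stays invertible and the values stay in `N`
  let W : Set F := {y | fderiv ℝ g y ∈ range ((↑) : (F ≃L[ℝ] F) → F →L[ℝ] F)} ∩
    (fun y => σ (L y)) ⁻¹' interior N
  have hW : IsOpen W := ((ContinuousLinearEquiv.isOpen (𝕜 := ℝ) (E := F) (F := F)).preimage
    (hg.continuous_fderiv (by simp))).inter (isOpen_interior.preimage hσc)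
  have h0W : (0 : F) ∈ W := by
    refine ⟨?_, ?_⟩
    · exact ⟨_, hg'.fderiv.symm⟩
    · simpa [mem_interior_iff_mem_nhds] using hN
  let e := e₀.restrOpen W hW
  have he : ∀ y, e y = g y := fun y => rfl
  have hes : e.source ⊆ W := fun y hy => hy.2
  have h0e : (0 : F) ∈ e.source :=
    ⟨(hg.contDiffAt (x := 0)).mem_toOpenPartialHomeomorph_source hg' (by simp), h0W⟩
  have hsymm : ∀ y ∈ e.target, ContDiffAt ℝ ∞ e.symm y := by
    intro y hy
    obtain ⟨f', hf'⟩ := (hes (e.map_target hy)).1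
    refine e.contDiffAt_symm (f₀' := f') hy ?_ hg.contDiffAt
    rw [hf']
    exact (hg.differentiable (by simp)).differentiableAt.hasFDerivAt
  have hge : ∀ y ∈ e.target, R (j (σ (L (e.symm y)))) = y := fun y hy => e.right_inv hy
  have hjc : ContDiffOn ℝ ∞ (fun y => j (σ (L (e.symm y)))) e.target := fun y hy =>
    (hjL.contDiffAt.comp y (hsymm y hy)).contDiffWithinAt
  refine ⟨{ toFun := fun x => R (j x)
            invFun := fun y => σ (L (e.symm y))
            source := interior N ∩ (fun x => R (j x)) ⁻¹' e.target
            target := e.target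
            map_source' := fun x hx => hx.2
            map_target' := ?_
            left_inv' := ?_
            right_inv' := hge
            open_source := isOpen_interior.inter
              (e.open_target.preimage (R.continuous.comp hj.continuous))
            open_target := e.open_target
            continuousOn_toFun := (R.continuous.comp hj.continuous).continuousOn
            continuousOn_invFun := hj.continuousOn_iff.2 hjc.continuousOn }, ?_, ?_, hjc⟩
  · intro y hy
    refine ⟨(hes (e.map_target hy)).2, ?_⟩
    change R (j (σ (L (e.symm y)))) ∈ e.target
    rwa [hge y hy]
  · intro x hx
    exact hinj (interior_subset (hes (e.map_target hx.2)).2) (interior_subset hx.1)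
      (hge _ hx.2)
  · refine ⟨mem_interior_iff_mem_nhds.2 hN, ?_⟩
    have := e.map_source h0e
    rw [he] at this
    simpa [g] using this
  · intro x _
    rfl

/-! ### The algebra of Cayley numbers -/

namespace Cayley

instance : NonUnitalNonAssocRing Cayley where
  __ := (inferInstance : AddCommGroup Cayley)
  __ := instMul
  left_distrib x y z := by
    refine ext_pair ?_ ?_ <;> ext <;> simp [mul_fst, mul_snd] <;> ring
  right_distrib x y z := by
    refine ext_pair ?_ ?_ <;> ext <;> simp [mul_fst, mul_snd] <;> ring
  zero_mul x := by
    refine ext_pair ?_ ?_ <;> ext <;> simp [mul_fst, mul_snd]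
  mul_zero x := by
    refine ext_pair ?_ ?_ <;> ext <;> simp [mul_fst, mul_snd]

instance : IsScalarTower ℝ Cayley Cayley where
  smul_assoc c x y := by
    refine ext_pair ?_ ?_ <;> ext <;> simp [mul_fst, mul_snd] <;> ring

instance : SMulCommClass ℝ Cayley Cayley where
  smul_comm c x y := by
    refine ext_pair ?_ ?_ <;> ext <;> simp [mul_fst, mul_snd] <;> ring

theorem conj_fst (x : Cayley) : (conj x).fst = star x.fst := rfl

theorem conj_snd (x : Cayley) : (conj x).snd = -x.snd := rfl

theorem conj_add (x y : Cayley) : conj (x + y) = conj x + conj y := by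
  refine ext_pair ?_ ?_ <;> ext <;> simp [conj_fst, conj_snd, add_comm]

theorem conj_conj (x : Cayley) : conj (conj x) = x := by
  refine ext_pair ?_ ?_ <;> ext <;> simp [conj_fst, conj_snd]

theorem conj_mul (x y : Cayley) : conj (x * y) = conj y * conj x := by
  refine ext_pair ?_ ?_ <;> ext <;> simp [conj_fst, conj_snd, mul_fst, mul_snd]

/-- The unit of the Cayley numbers. -/
def e₁ : Cayley := mk 1 0

theorem e₁_mul (x : Cayley) : e₁ * x = x := by
  refine ext_pair ?_ ?_ <;> simp [e₁, mk_fst, mk_snd, mul_fst, mul_snd]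

theorem mul_e₁ (x : Cayley) : x * e₁ = x := by
  refine ext_pair ?_ ?_ <;> simp [e₁, mk_fst, mk_snd, mul_fst, mul_snd]

theorem conj_e₁ : conj e₁ = e₁ := by
  refine ext_pair ?_ ?_ <;> simp [e₁, mk_fst, mk_snd, conj_fst, conj_snd]

theorem inner_eq (x y : Cayley) : inner ℝ x y =
    x.fst.re * y.fst.re + x.fst.imI * y.fst.imI + x.fst.imJ * y.fst.imJ + x.fst.imK * y.fst.imK +
    (x.snd.re * y.snd.re + x.snd.imI * y.snd.imI + x.snd.imJ * y.snd.imJ +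
      x.snd.imK * y.snd.imK) := by
  rw [WithLp.prod_inner_apply]
  simp [Quaternion.inner_def]

theorem norm_sq_eq (x : Cayley) : ‖x‖ ^ 2 =
    x.fst.re ^ 2 + x.fst.imI ^ 2 + x.fst.imJ ^ 2 + x.fst.imK ^ 2 +
    (x.snd.re ^ 2 + x.snd.imI ^ 2 + x.snd.imJ ^ 2 + x.snd.imK ^ 2) := by
  rw [← real_inner_self_eq_norm_sq, inner_eq]
  ring

theorem norm_e₁ : ‖e₁‖ = 1 := by
  rw [← sq_eq_sq₀ (norm_nonneg _) zero_le_one, norm_sq_eq]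
  simp [e₁, mk_fst, mk_snd]

theorem inner_e₁ (x : Cayley) : inner ℝ e₁ x = x.fst.re := by
  rw [inner_eq]
  simp [e₁, mk_fst, mk_snd]

theorem mem_imaginary_iff {x : Cayley} : x ∈ imaginary ↔ inner ℝ e₁ x = 0 := by
  rw [inner_e₁]
  rfl

theorem conj_of_imaginary {u : Cayley} (hu : u ∈ imaginary) : conj u = -u := by
  have h0 : u.fst.re = 0 := hu
  refine ext_pair ?_ ?_ <;> ext <;> simp [conj_fst, conj_snd, h0]

set_option maxHeartbeats 1000000 in
/-- The right Moufang identity. -/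
theorem moufang_right (x u w : Cayley) : x * u * w * u = x * (u * w * u) := by
  refine ext_pair ?_ ?_ <;> ext <;> simp only [mul_fst, mul_snd,
    Quaternion.re_mul, Quaternion.imI_mul, Quaternion.imJ_mul, Quaternion.imK_mul,
    Quaternion.re_add, Quaternion.imI_add, Quaternion.imJ_add, Quaternion.imK_add,
    Quaternion.re_sub, Quaternion.imI_sub, Quaternion.imJ_sub, Quaternion.imK_sub,
    Quaternion.re_star, Quaternion.imI_star, Quaternion.imJ_star, Quaternion.imK_star] <;> ring

set_option maxHeartbeats 1000000 in
/-- The middle Moufang identity. -/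
theorem moufang_middle (u a b : Cayley) : u * a * (b * u) = u * (a * b) * u := by
  refine ext_pair ?_ ?_ <;> ext <;> simp only [mul_fst, mul_snd,
    Quaternion.re_mul, Quaternion.imI_mul, Quaternion.imJ_mul, Quaternion.imK_mul,
    Quaternion.re_add, Quaternion.imI_add, Quaternion.imJ_add, Quaternion.imK_add,
    Quaternion.re_sub, Quaternion.imI_sub, Quaternion.imJ_sub, Quaternion.imK_sub,
    Quaternion.re_star, Quaternion.imI_star, Quaternion.imJ_star, Quaternion.imK_star] <;> ring

theorem mul_conj_self (x : Cayley) : x * conj x = ‖x‖ ^ 2 • e₁ := by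
  rw [norm_sq_eq]
  refine ext_pair ?_ ?_ <;> ext <;>
    simp [e₁, mk_fst, mk_snd, conj_fst, conj_snd, mul_fst, mul_snd] <;> ring

theorem conj_mul_cancel (x y : Cayley) : x * (conj x * y) = ‖x‖ ^ 2 • y := by
  rw [norm_sq_eq]
  refine ext_pair ?_ ?_ <;> ext <;> simp only [mul_fst, mul_snd, conj_fst, conj_snd,
    WithLp.smul_fst, WithLp.smul_snd,
    Quaternion.re_mul, Quaternion.imI_mul, Quaternion.imJ_mul, Quaternion.imK_mul,
    Quaternion.re_add, Quaternion.imI_add, Quaternion.imJ_add, Quaternion.imK_add,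
    Quaternion.re_sub, Quaternion.imI_sub, Quaternion.imJ_sub, Quaternion.imK_sub,
    Quaternion.re_neg, Quaternion.imI_neg, Quaternion.imJ_neg, Quaternion.imK_neg,
    Quaternion.re_smul, Quaternion.imI_smul, Quaternion.imJ_smul, Quaternion.imK_smul,
    Quaternion.re_star, Quaternion.imI_star, Quaternion.imJ_star, Quaternion.imK_star,
    smul_eq_mul] <;> ring

theorem conj_mul_cancel' (x y : Cayley) : conj x * (x * y) = ‖x‖ ^ 2 • y := by
  rw [norm_sq_eq]
  refine ext_pair ?_ ?_ <;> ext <;> simp only [mul_fst, mul_snd, conj_fst, conj_snd,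
    WithLp.smul_fst, WithLp.smul_snd,
    Quaternion.re_mul, Quaternion.imI_mul, Quaternion.imJ_mul, Quaternion.imK_mul,
    Quaternion.re_add, Quaternion.imI_add, Quaternion.imJ_add, Quaternion.imK_add,
    Quaternion.re_sub, Quaternion.imI_sub, Quaternion.imJ_sub, Quaternion.imK_sub,
    Quaternion.re_neg, Quaternion.imI_neg, Quaternion.imJ_neg, Quaternion.imK_neg,
    Quaternion.re_smul, Quaternion.imI_smul, Quaternion.imJ_smul, Quaternion.imK_smul,
    Quaternion.re_star, Quaternion.imI_star, Quaternion.imJ_star, Quaternion.imK_star,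
    smul_eq_mul] <;> ring

theorem mul_conj_cancel (x y : Cayley) : x * y * conj y = ‖y‖ ^ 2 • x := by
  rw [norm_sq_eq]
  refine ext_pair ?_ ?_ <;> ext <;> simp only [mul_fst, mul_snd, conj_fst, conj_snd,
    WithLp.smul_fst, WithLp.smul_snd,
    Quaternion.re_mul, Quaternion.imI_mul, Quaternion.imJ_mul, Quaternion.imK_mul,
    Quaternion.re_add, Quaternion.imI_add, Quaternion.imJ_add, Quaternion.imK_add,
    Quaternion.re_sub, Quaternion.imI_sub, Quaternion.imJ_sub, Quaternion.imK_sub,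
    Quaternion.re_neg, Quaternion.imI_neg, Quaternion.imJ_neg, Quaternion.imK_neg,
    Quaternion.re_smul, Quaternion.imI_smul, Quaternion.imJ_smul, Quaternion.imK_smul,
    Quaternion.re_star, Quaternion.imI_star, Quaternion.imJ_star, Quaternion.imK_star,
    smul_eq_mul] <;> ring

theorem inner_mul_left_conj (x u y : Cayley) : inner ℝ (u * x) y = inner ℝ x (conj u * y) := by
  rw [inner_eq, inner_eq]
  simp only [mul_fst, mul_snd, conj_fst, conj_snd,
    Quaternion.re_mul, Quaternion.imI_mul, Quaternion.imJ_mul, Quaternion.imK_mul,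
    Quaternion.re_add, Quaternion.imI_add, Quaternion.imJ_add, Quaternion.imK_add,
    Quaternion.re_sub, Quaternion.imI_sub, Quaternion.imJ_sub, Quaternion.imK_sub,
    Quaternion.re_neg, Quaternion.imI_neg, Quaternion.imJ_neg, Quaternion.imK_neg,
    Quaternion.re_star, Quaternion.imI_star, Quaternion.imJ_star, Quaternion.imK_star]
  ring

theorem inner_mul_right_conj (x u y : Cayley) : inner ℝ (x * u) y = inner ℝ x (y * conj u) := by
  rw [inner_eq, inner_eq]
  simp only [mul_fst, mul_snd, conj_fst, conj_snd,
    Quaternion.re_mul, Quaternion.imI_mul, Quaternion.imJ_mul, Quaternion.imK_mul,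
    Quaternion.re_add, Quaternion.imI_add, Quaternion.imJ_add, Quaternion.imK_add,
    Quaternion.re_sub, Quaternion.imI_sub, Quaternion.imJ_sub, Quaternion.imK_sub,
    Quaternion.re_neg, Quaternion.imI_neg, Quaternion.imJ_neg, Quaternion.imK_neg,
    Quaternion.re_star, Quaternion.imI_star, Quaternion.imJ_star, Quaternion.imK_star]
  ring

theorem inner_mul_mul_right (x y u : Cayley) :
    inner ℝ (x * u) (y * u) = ‖u‖ ^ 2 * inner ℝ x y := by
  rw [inner_mul_right_conj, mul_conj_cancel, inner_smul_right]

theorem norm_mul (x y : Cayley) : ‖x * y‖ = ‖x‖ * ‖y‖ := by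
  rw [← sq_eq_sq₀ (norm_nonneg _) (by positivity), ← real_inner_self_eq_norm_sq,
    inner_mul_mul_right, real_inner_self_eq_norm_sq]
  ring

theorem norm_conj (x : Cayley) : ‖conj x‖ = ‖x‖ := by
  rw [← sq_eq_sq₀ (norm_nonneg _) (norm_nonneg _), norm_sq_eq, norm_sq_eq]
  simp [conj_fst, conj_snd]

/-- The triple product `x (ȳ z)`; the three-fold cross product is its alternating part. -/
def triple (x y z : Cayley) : Cayley := x * (conj y * z)

/-- Right multiplication by an imaginary Cayley number is a similarity for the triple product. -/
theorem triple_mul_right {u : Cayley} (hu : u ∈ imaginary) (x y z : Cayley) :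
    triple (x * u) (y * u) (z * u) = ‖u‖ ^ 2 • (triple x y z * u) := by
  have h : x * u * u = -(‖u‖ ^ 2 • x) := by
    have := mul_self_right ⟨u, hu⟩ x
    rw [imForm_apply] at this
    simpa using this
  rw [triple, conj_mul, conj_of_imaginary hu, neg_mul, neg_mul, mul_neg, moufang_middle,
    ← moufang_right, h, triple]
  simp [smul_mul_assoc]

theorem triple_add_triple_swap (x y z : Cayley) :
    triple x y z + triple z y x =
      (2 * inner ℝ x y) • z + (2 * inner ℝ y z) • x - (2 * inner ℝ x z) • y := by
  simp only [inner_eq]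
  refine ext_pair ?_ ?_ <;> ext <;>
    rw [triple, triple] <;> simp only [mul_fst, mul_snd, conj_fst, conj_snd,
    WithLp.add_fst, WithLp.add_snd, WithLp.sub_fst, WithLp.sub_snd, WithLp.smul_fst, WithLp.smul_snd,
    Quaternion.re_mul, Quaternion.imI_mul, Quaternion.imJ_mul, Quaternion.imK_mul,
    Quaternion.re_add, Quaternion.imI_add, Quaternion.imJ_add, Quaternion.imK_add,
    Quaternion.re_sub, Quaternion.imI_sub, Quaternion.imJ_sub, Quaternion.imK_sub,
    Quaternion.re_neg, Quaternion.imI_neg, Quaternion.imJ_neg, Quaternion.imK_neg,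
    Quaternion.re_smul, Quaternion.imI_smul, Quaternion.imJ_smul, Quaternion.imK_smul,
    Quaternion.re_star, Quaternion.imI_star, Quaternion.imJ_star, Quaternion.imK_star,
    smul_eq_mul] <;> ring

theorem triple_self_left (x z : Cayley) : triple x x z = ‖x‖ ^ 2 • z := conj_mul_cancel x z

theorem cross_eq_triple (x y z : Cayley) :
    cross x y z = (2⁻¹ : ℝ) • (triple x y z - triple z y x) := rfl

theorem cross_eq (x y z : Cayley) :
    cross x y z = triple x y z - inner ℝ x y • z - inner ℝ y z • x + inner ℝ x z • y := by
  have h := triple_add_triple_swap x y z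
  rw [cross_eq_triple, eq_sub_of_add_eq' h]
  module

theorem cross_of_orthogonal {x y z : Cayley} (hxy : inner ℝ x y = 0) (hyz : inner ℝ y z = 0)
    (hxz : inner ℝ x z = 0) : cross x y z = triple x y z := by
  simp [cross_eq, hxy, hyz, hxz]

theorem anticomm {a b : Cayley} (ha : a ∈ imaginary) (hb : b ∈ imaginary)
    (hab : inner ℝ a b = 0) : a * b = -(b * a) := by
  have h := triple_add_triple_swap a e₁ b
  rw [triple, triple, conj_e₁, e₁_mul, e₁_mul, real_inner_comm, mem_imaginary_iff.1 ha,
    mem_imaginary_iff.1 hb, hab] at h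
  simpa [eq_neg_iff_add_eq_zero] using h

theorem mul_mem_imaginary {u v : Cayley} (hv : v ∈ imaginary)
    (huv : inner ℝ u v = 0) : u * v ∈ imaginary := by
  rw [mem_imaginary_iff, real_inner_comm, inner_mul_right_conj, e₁_mul, conj_of_imaginary hv,
    inner_neg_right, huv, neg_zero]

/-- For mutually orthogonal imaginary `n`, `u`, `v` with `n` orthogonal to `u v` the product is
antiassociative. -/
theorem mul_mul_of_orthogonal {n u v : Cayley} (hn : n ∈ imaginary) (hu : u ∈ imaginary)
    (hv : v ∈ imaginary) (hnu : inner ℝ n u = 0) (hnv : inner ℝ n v = 0)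
    (huv : inner ℝ u v = 0) (hn' : inner ℝ n (u * v) = 0) : n * u * v = -(n * (u * v)) := by
  have huvi := mul_mem_imaginary hv huv
  have h1 : conj (n * u * v) = triple v u n := by
    rw [conj_mul, conj_mul, conj_of_imaginary hn, conj_of_imaginary hv, conj_of_imaginary hu,
      triple, conj_of_imaginary hu]
    simp
  have h2 : triple v u n = n * (u * v) := by
    have h := triple_add_triple_swap v u n
    rw [real_inner_comm, huv, real_inner_comm, hnu, real_inner_comm, hnv] at h
    have h' : triple v u n + triple n u v = 0 := by simpa using h
    rw [eq_neg_of_add_eq_zero_left h', triple, conj_of_imaginary hu]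
    simp
  rw [← conj_conj (n * u * v), h1, h2, conj_mul, conj_of_imaginary hn, conj_of_imaginary huvi,
    anticomm hn huvi hn']
  simp

end Cayley

/-! ### The spin representation -/

open Cayley CliffordAlgebra

theorem cliffordRep_ι (u : imaginary) (x : Cayley) : cliffordRep (ι imForm u) x = x * u := by
  simp [cliffordRep, rightMul_apply]

theorem inner_cliffordRep (a : CliffordAlgebra imForm) (x y : Cayley) :
    inner ℝ (cliffordRep a x) y = inner ℝ x (cliffordRep (star a) y) := by
  induction a using CliffordAlgebra.induction generalizing x y with
  | algebraMap r => simp [inner_smul_left, inner_smul_right]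
  | ι u =>
    rw [star_ι, map_neg, LinearMap.neg_apply, cliffordRep_ι, cliffordRep_ι, inner_mul_right_conj,
      conj_of_imaginary u.2, mul_neg]
  | mul a b ha hb => simp [ha, hb]
  | add a b ha hb => simp [inner_add_left, inner_add_right, ha, hb]

section Adjoin

variable {e : CliffordAlgebra imForm}

/-- If all the generators are odd and anticommute with `e`, then moving `e` past a product of them
applies the grading involution. -/
theorem involute_mem_adjoin_and_mul_eq {s : Set (CliffordAlgebra imForm)}
    (hs : ∀ x ∈ s, involute x = -x ∧ x * e = -(e * x))
    {x : CliffordAlgebra imForm} (hx : x ∈ Algebra.adjoin ℝ s) :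
    involute x ∈ Algebra.adjoin ℝ s ∧ x * e = e * involute x := by
  induction hx using Algebra.adjoin_induction with
  | mem x hx =>
    rw [(hs x hx).1, (hs x hx).2, mul_neg]
    exact ⟨neg_mem (Algebra.subset_adjoin hx), rfl⟩
  | algebraMap r =>
    rw [AlgHom.commutes]
    exact ⟨Subalgebra.algebraMap_mem _ _, Algebra.commutes r e⟩
  | add x y _ _ hx hy =>
    rw [map_add, add_mul, mul_add, hx.2, hy.2]
    exact ⟨add_mem hx.1 hy.1, rfl⟩
  | mul x y _ _ hx hy =>
    rw [map_mul, mul_assoc, hy.2, ← mul_assoc, hx.2, mul_assoc]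
    exact ⟨mul_mem hx.1 hy.1, rfl⟩

/-- Adjoining one more generator `e`, which anticommutes with the previous ones, adds only the
left multiples of `e`. -/
theorem exists_add_mul_of_mem_adjoin_insert {s : Set (CliffordAlgebra imForm)}
    (he : e * e = -1)
    (hs : ∀ x ∈ s, involute x = -x ∧ x * e = -(e * x))
    {x : CliffordAlgebra imForm} (hx : x ∈ Algebra.adjoin ℝ (insert e s)) :
    ∃ a ∈ Algebra.adjoin ℝ s, ∃ b ∈ Algebra.adjoin ℝ s, x = a + e * b := by
  have hS := fun x => involute_mem_adjoin_and_mul_eq hs (x := x)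
  induction hx using Algebra.adjoin_induction with
  | mem x hx =>
    rcases hx with rfl | hx
    · exact ⟨0, zero_mem _, 1, one_mem _, by simp⟩
    · exact ⟨x, Algebra.subset_adjoin hx, 0, zero_mem _, by simp⟩
  | algebraMap r => exact ⟨_, Subalgebra.algebraMap_mem _ r, 0, zero_mem _, by simp⟩
  | add x y _ _ hx hy =>
    obtain ⟨a, ha, b, hb, rfl⟩ := hx
    obtain ⟨c, hc, d, hd, rfl⟩ := hy
    exact ⟨a + c, add_mem ha hc, b + d, add_mem hb hd, by rw [mul_add]; abel⟩
  | mul x y _ _ hx hy =>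
    obtain ⟨a, ha, b, hb, rfl⟩ := hx
    obtain ⟨c, hc, d, hd, rfl⟩ := hy
    refine ⟨a * c - involute b * d, sub_mem (mul_mem ha hc) (mul_mem (hS b hb).1 hd),
      involute a * d + b * c, add_mem (mul_mem (hS a ha).1 hd) (mul_mem hb hc), ?_⟩
    have h1 : a * (e * d) = e * (involute a * d) := by
      rw [← mul_assoc, (hS a ha).2, mul_assoc]
    have h2 : e * b * (e * d) = -(involute b * d) := by
      rw [mul_assoc, ← mul_assoc b, (hS b hb).2, mul_assoc, ← mul_assoc e e, he, neg_one_mul]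
    rw [add_mul, mul_add, mul_add, h1, h2, mul_add, mul_assoc e b c]
    abel

end Adjoin

/-- Polarisation of the Clifford relation. -/
theorem ι_mul_ι_of_inner_eq_zero {u v : imaginary} (h : inner ℝ u v = 0) :
    ι imForm u * ι imForm v = -(ι imForm v * ι imForm u) := by
  rw [eq_neg_iff_add_eq_zero, ι_mul_ι_add_swap]
  have : QuadraticMap.polar imForm u v = 0 := by
    simp only [QuadraticMap.polar, imForm_apply]
    have := norm_add_sq_real (u : Cayley) v
    rw [Submodule.coe_inner] at h
    rw [Submodule.coe_add, this, h]
    ring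
  simp [this]

theorem ι_mul_self_of_norm_eq_one {u : imaginary} (h : ‖(u : Cayley)‖ = 1) :
    ι imForm u * ι imForm u = -1 := by
  rw [ι_sq_scalar, imForm_apply, h]
  simp

/-- An element of the Clifford algebra is determined by the actions of the element and of its
image under the grading involution.  By induction on the number of generators: if `x = a + e b`,
then conjugation by `e` and the involution separate `a` from `e b`. -/
theorem eq_zero_of_cliffordRep_eq_zero {x : CliffordAlgebra imForm} (hx : cliffordRep x = 0)
    (hx' : cliffordRep (involute x) = 0) : x = 0 := by
  have eq_zero_of_eq_neg : ∀ {f : Module.End ℝ Cayley}, f = -f → f = 0 := by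
    intro f hf
    have h2 : (2 : ℝ) • f = 0 := by rw [two_smul, ← eq_neg_iff_add_eq_zero, ← hf]
    exact (smul_eq_zero.1 h2).resolve_left two_ne_zero
  let b := stdOrthonormalBasis ℝ imaginary
  have key : ∀ s : Finset (Fin (Module.finrank ℝ imaginary)),
      ∀ x ∈ Algebra.adjoin ℝ ((fun i => ι imForm (b i)) '' (s : Set _)),
      cliffordRep x = 0 → cliffordRep (involute x) = 0 → x = 0 := by
    intro s
    induction s using Finset.induction_on with
    | empty =>
      intro x hx h _
      rw [Finset.coe_empty, image_empty, Algebra.adjoin_empty] at hx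
      obtain ⟨r, rfl⟩ := Algebra.mem_bot.1 hx
      have h1 := LinearMap.congr_fun h e₁
      have h2 : e₁ ≠ 0 := by
        intro h
        simpa [h] using norm_e₁
      rw [AlgHom.commutes] at h1
      have h3 : r = 0 := by simpa [h2] using h1
      simp [h3]
    | insert i s hi ih =>
      intro x hx h h'
      have hnorm : ∀ k, ‖((b k : imaginary) : Cayley)‖ = 1 := fun k => b.orthonormal.1 k
      have hee := ι_mul_self_of_norm_eq_one (hnorm i)
      rw [Finset.coe_insert, image_insert_eq] at hx
      have hanti : ∀ k ∈ s, ι imForm (b k) * ι imForm (b i) = -(ι imForm (b i) * ι imForm (b k)) :=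
        fun k hk => ι_mul_ι_of_inner_eq_zero
          (b.orthonormal.2 (fun hki => hi (hki ▸ hk)))
      set e := ι imForm (b i) with he
      have hinv : involute e = -e := involute_ι _
      have hs : ∀ y ∈ (fun i => ι imForm (b i)) '' (s : Set (Fin (Module.finrank ℝ imaginary))),
          involute y = -y ∧ y * e = -(e * y) := by
        rintro _ ⟨k, hk, rfl⟩
        exact ⟨involute_ι _, hanti k hk⟩
      obtain ⟨a, ha, c, hc, rfl⟩ := exists_add_mul_of_mem_adjoin_insert hee hs hx
      obtain ⟨ha', hae⟩ := involute_mem_adjoin_and_mul_eq hs ha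
      obtain ⟨hc', hce⟩ := involute_mem_adjoin_and_mul_eq hs hc
      have haa : e * involute a * e = -a := by
        rw [mul_assoc, (involute_mem_adjoin_and_mul_eq hs ha').2, involute_involute, ← mul_assoc,
          hee, neg_one_mul]
      have hcc : e * involute c * e = -c := by
        rw [mul_assoc, (involute_mem_adjoin_and_mul_eq hs hc').2, involute_involute, ← mul_assoc,
          hee, neg_one_mul]
      have haa' : e * a * e = -involute a := by rw [mul_assoc, hae, ← mul_assoc, hee, neg_one_mul]
      have hcc' : e * c * e = -involute c := by rw [mul_assoc, hce, ← mul_assoc, hee, neg_one_mul]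
      have hi' : involute (a + e * c) = involute a - e * involute c := by
        rw [map_add, map_mul, hinv, neg_mul, sub_eq_add_neg]
      have hconj : ∀ y, cliffordRep y = 0 → cliffordRep (e * y * e) = 0 := by
        intro y hy
        simp [hy]
      have hleft : ∀ y, cliffordRep (e * y) = 0 → cliffordRep y = 0 := by
        intro y hy
        have : e * (e * y) = -y := by rw [← mul_assoc, hee, neg_one_mul]
        have h0 : cliffordRep (e * (e * y)) = 0 := by rw [map_mul, hy, mul_zero]
        rwa [this, map_neg, neg_eq_zero] at h0
      have h1 := hconj _ h
      have h2 := hconj _ h'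
      rw [hi'] at h' h2
      rw [mul_add, add_mul, haa', mul_assoc e (e * c) e, hcc'] at h1
      rw [mul_sub, sub_mul, haa, mul_assoc e (e * involute c) e, hcc] at h2
      simp only [map_add, map_sub, map_neg, mul_neg] at h h' h1 h2
      have ha0 : cliffordRep a = 0 := by
        have e1 : cliffordRep a = cliffordRep (e * c) := by
          rwa [sub_neg_eq_add, neg_add_eq_zero] at h2
        have e2 := eq_neg_of_add_eq_zero_left h
        rw [← e1] at e2
        exact eq_zero_of_eq_neg e2
      have hc0 : cliffordRep c = 0 := by
        rw [ha0, zero_add] at h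
        exact hleft c h
      have ha1 : cliffordRep (involute a) = 0 := by
        have e1 := eq_neg_of_add_eq_zero_left h1
        rw [neg_neg, ← sub_eq_zero.1 h'] at e1
        exact eq_zero_of_eq_neg e1.symm
      have hc1 : cliffordRep (involute c) = 0 := by
        rw [ha1, zero_sub, neg_eq_zero] at h'
        exact hleft _ h'
      rw [ih a ha ha0 ha1, ih c hc hc0 hc1, mul_zero, add_zero]
  refine key Finset.univ x ?_ hx hx'
  have htop : Algebra.adjoin ℝ ((fun i => ι imForm (b i)) ''
      (Finset.univ : Finset (Fin (Module.finrank ℝ imaginary)))) = ⊤ := by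
    rw [eq_top_iff, ← adjoin_range_ι]
    refine Algebra.adjoin_le ?_
    rintro _ ⟨u, rfl⟩
    rw [← b.sum_repr u, map_sum]
    refine sum_mem fun i _ => ?_
    rw [map_smul]
    exact Subalgebra.smul_mem _ (Algebra.subset_adjoin
      (mem_image_of_mem (fun i => ι imForm (b i)) (Finset.mem_coe.2 (Finset.mem_univ i)))) _
  rw [htop]
  exact Algebra.mem_top

/-- The spin representation, as a homomorphism to the continuous linear endomorphisms of `ℝ⁸`. -/
def Spin7.toCLM : Spin7 →* (Cayley →L[ℝ] Cayley) where
  toFun g := LinearMap.toContinuousLinearMap (cliffordRep (g : CliffordAlgebra imForm))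
  map_one' := by ext1 x; simp
  map_mul' g h := by ext1 x; simp

namespace Spin7

theorem toCLM_apply (g : Spin7) (x : Cayley) : toCLM g x = g • x := rfl

theorem toCLM_injective : Function.Injective toCLM := by
  intro g h hgh
  refine Subtype.ext (sub_eq_zero.1 (eq_zero_of_cliffordRep_eq_zero ?_ ?_))
  · rw [map_sub, sub_eq_zero]
    exact LinearMap.toContinuousLinearMap.injective hgh
  · rw [map_sub, spinGroup.involute_eq g.2, spinGroup.involute_eq h.2, map_sub, sub_eq_zero]
    exact LinearMap.toContinuousLinearMap.injective hgh

instance : IsModuleTopology ℝ (CliffordAlgebra imForm) := ⟨rfl⟩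

set_option synthInstance.maxHeartbeats 200000 in
/-- `Spin(7)` has the topology of a group of linear maps: the Clifford algebra embeds into two
copies of `End ℝ⁸`, and on even elements both components are the spin representation. -/
theorem isEmbedding_toCLM : IsEmbedding toCLM := by
  let J : CliffordAlgebra imForm →ₗ[ℝ] (Cayley →L[ℝ] Cayley) × (Cayley →L[ℝ] Cayley) :=
    (LinearMap.toContinuousLinearMap.toLinearMap ∘ₗ cliffordRep.toLinearMap).prod
      (LinearMap.toContinuousLinearMap.toLinearMap ∘ₗ cliffordRep.toLinearMap ∘ₗ
        (involute (Q := imForm)).toLinearMap)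
  have hJ : Function.Injective J := by
    rw [injective_iff_map_eq_zero]
    intro x hx
    have h := Prod.ext_iff.1 hx
    exact eq_zero_of_cliffordRep_eq_zero
      ((LinearEquiv.map_eq_zero_iff LinearMap.toContinuousLinearMap).1 h.1)
      ((LinearEquiv.map_eq_zero_iff LinearMap.toContinuousLinearMap).1 h.2)
  have hJc : Continuous J := IsModuleTopology.continuous_of_linearMap J
  have : FiniteDimensional ℝ (CliffordAlgebra imForm) := FiniteDimensional.of_injective J hJ
  have : T2Space (CliffordAlgebra imForm) := T2Space.of_injective_continuous hJ hJc
  have : IsTopologicalAddGroup (CliffordAlgebra imForm) := IsModuleTopology.topologicalAddGroup ℝ _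
  have hJe : IsEmbedding J :=
    (LinearMap.isClosedEmbedding_of_injective (LinearMap.ker_eq_bot.2 hJ)).isEmbedding
  have h : IsEmbedding ((fun T => (T, T)) ∘ toCLM) := by
    convert! hJe.comp IsEmbedding.subtypeVal using 1
    ext1 g
    change (_, _) = (LinearMap.toContinuousLinearMap (cliffordRep (g : CliffordAlgebra imForm)),
      LinearMap.toContinuousLinearMap (cliffordRep (involute (g : CliffordAlgebra imForm))))
    rw [spinGroup.involute_eq g.2]
    rfl
  refine ⟨IsInducing.of_comp ?_ (by fun_prop) h.isInducing, toCLM_injective⟩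
  exact (continuous_fst.comp (hJc.comp continuous_subtype_val))

theorem smul_add' (g : Spin7) (x y : Cayley) : g • (x + y) = g • x + g • y :=
  map_add (toCLM g) x y

theorem smul_sub' (g : Spin7) (x y : Cayley) : g • (x - y) = g • x - g • y :=
  map_sub (toCLM g) x y

theorem smul_smul' (g : Spin7) (c : ℝ) (x : Cayley) : g • (c • x) = c • (g • x) :=
  map_smul (toCLM g) c x

theorem inner_smul_left_eq (g : Spin7) (x y : Cayley) :
    inner ℝ (g • x) y = inner ℝ x (g⁻¹ • y) :=
  inner_cliffordRep _ _ _

theorem inner_smul_smul (g : Spin7) (x y : Cayley) : inner ℝ (g • x) (g • y) = inner ℝ x y := by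
  rw [inner_smul_left_eq, inv_smul_smul]

theorem norm_smul' (g : Spin7) (x : Cayley) : ‖g • x‖ = ‖x‖ := by
  rw [← sq_eq_sq₀ (norm_nonneg _) (norm_nonneg _), ← real_inner_self_eq_norm_sq, inner_smul_smul,
    real_inner_self_eq_norm_sq]

/-- The Lipschitz group is generated by vectors, which act by right multiplications, so its elements
act by similarities of the triple product. -/
theorem exists_triple_cliffordRep {w : (CliffordAlgebra imForm)ˣ} (hw : w ∈ lipschitzGroup imForm) :
    ∃ c : ℝ, c ≠ 0 ∧ ∀ x y z : Cayley,
      triple (cliffordRep w x) (cliffordRep w y) (cliffordRep w z) =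
        c • cliffordRep w (triple x y z) := by
  replace hw : w ∈ Subgroup.closure ((↑) ⁻¹' range (ι imForm)) := hw
  induction hw using Subgroup.closure_induction with
  | mem w h =>
    obtain ⟨u, hu⟩ := h
    refine ⟨‖(u : Cayley)‖ ^ 2, ?_, fun x y z => ?_⟩
    · intro h0
      have : (u : imaginary) = 0 := by simpa using h0
      rw [this, map_zero] at hu
      exact w.ne_zero hu.symm
    · rw [← hu]
      simp only [cliffordRep_ι]
      exact triple_mul_right u.2 x y z
  | one => exact ⟨1, one_ne_zero, fun x y z => by simp⟩
  | mul v w _ _ hv hw =>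
    obtain ⟨c, hc0, hc⟩ := hv
    obtain ⟨d, hd0, hd⟩ := hw
    refine ⟨d * c, mul_ne_zero hd0 hc0, fun x y z => ?_⟩
    simp [hc, hd, smul_smul, mul_comm]
  | inv w _ hw =>
    obtain ⟨c, hc0, hc⟩ := hw
    have h1 : ∀ x, cliffordRep (w : CliffordAlgebra imForm)
        (cliffordRep ((w⁻¹ : (CliffordAlgebra imForm)ˣ) : CliffordAlgebra imForm) x) = x := by
      intro x
      rw [← Module.End.mul_apply, ← map_mul, Units.mul_inv, map_one, Module.End.one_apply]
    have h2 : ∀ x, cliffordRep ((w⁻¹ : (CliffordAlgebra imForm)ˣ) : CliffordAlgebra imForm)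
        (cliffordRep (w : CliffordAlgebra imForm) x) = x := by
      intro x
      rw [← Module.End.mul_apply, ← map_mul, Units.inv_mul, map_one, Module.End.one_apply]
    refine ⟨c⁻¹, inv_ne_zero hc0, fun x y z => ?_⟩
    rw [eq_inv_smul_iff₀ hc0, ← h2 (c • _), map_smul, ← hc, h1, h1, h1]

/-- `Spin(7)` preserves the triple product: the generators of the Lipschitz group preserve it up
to a factor, and `triple x x x = |x|² x` shows that the factor of an isometry is `1`. -/
theorem triple_smul (g : Spin7) (x y z : Cayley) :
    triple (g • x) (g • y) (g • z) = g • triple x y z := by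
  obtain ⟨c, hc⟩ : ∃ c : ℝ, ∀ x y z : Cayley,
      triple (g • x) (g • y) (g • z) = c • (g • triple x y z) := by
    obtain ⟨w, hw, hwg⟩ := Submonoid.mem_map.1 (pinGroup.mem_lipschitzGroup (spinGroup.mem_pin g.2))
    obtain ⟨c, -, hc⟩ := exists_triple_cliffordRep hw
    have hwg' : (w : CliffordAlgebra imForm) = g := hwg
    rw [hwg'] at hc
    exact ⟨c, hc⟩
  have h := hc e₁ e₁ e₁
  rw [triple_self_left, triple_self_left, norm_smul', norm_e₁, one_pow, one_smul, one_smul] at h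
  have hne : g • e₁ ≠ 0 := by
    rw [← norm_ne_zero_iff, norm_smul', norm_e₁]
    exact one_ne_zero
  have hc1 : c = 1 := smul_left_injective ℝ hne (h.symm.trans (one_smul ℝ _).symm)
  rw [hc, hc1, one_smul]

theorem cross_smul (g : Spin7) (x y z : Cayley) :
    cross (g • x) (g • y) (g • z) = g • cross x y z := by
  rw [cross_eq_triple, cross_eq_triple, triple_smul, triple_smul, smul_smul', smul_sub']

/-- The product of two unit vectors of `Im Ca`, as an element of `Spin(7)`; it acts on `ℝ⁸` by
`x ↦ (x u) v`. -/
def pair {u v : Cayley} (hu : u ∈ imaginary) (hv : v ∈ imaginary) (hu1 : ‖u‖ = 1)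
    (hv1 : ‖v‖ = 1) : Spin7 :=
  ⟨ι imForm ⟨v, hv⟩ * ι imForm ⟨u, hu⟩, by
    have hlip : ∀ {w : imaginary}, ‖(w : Cayley)‖ = 1 → ι imForm w ∈ pinGroup imForm := by
      intro w hw
      have hsq := ι_mul_self_of_norm_eq_one hw
      refine ⟨⟨⟨ι imForm w, -ι imForm w, by rw [mul_neg, hsq, neg_neg],
        by rw [neg_mul, hsq, neg_neg]⟩, Subgroup.subset_closure ⟨w, rfl⟩, rfl⟩, ?_⟩
      change ι imForm w ∈ unitary _
      rw [Unitary.mem_iff, star_ι, neg_mul, mul_neg, hsq, neg_neg]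
      exact ⟨rfl, rfl⟩
    exact ⟨mul_mem (hlip hv1) (hlip hu1), ι_mul_ι_mem_evenOdd_zero imForm _ _⟩⟩

theorem pair_smul {u v : Cayley} (hu : u ∈ imaginary) (hv : v ∈ imaginary) (hu1 : ‖u‖ = 1)
    (hv1 : ‖v‖ = 1) (x : Cayley) : pair hu hv hu1 hv1 • x = x * u * v := by
  rw [Spin7.smul_def, pair]
  simp [cliffordRep_ι]

end Spin7

/-! ### Transitivity on frames -/

namespace Cayley

theorem mk_mul_mk_zero (a b c : ℍ[ℝ]) : mk a b * mk c 0 = mk (a * c) (b * star c) := by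
  refine ext_pair ?_ ?_ <;> simp [mul_fst, mul_snd, mk_fst, mk_snd]

theorem mk_mul_zero_mk (a b d : ℍ[ℝ]) : mk a b * mk 0 d = mk (-(star d * b)) (d * a) := by
  refine ext_pair ?_ ?_ <;> simp [mul_fst, mul_snd, mk_fst, mk_snd]

theorem mk_zero_mem_imaginary {c : ℍ[ℝ]} (hc : c.re = 0) : mk c 0 ∈ imaginary := hc

theorem zero_mk_mem_imaginary (d : ℍ[ℝ]) : mk 0 d ∈ imaginary :=
  (rfl : (0 : ℍ[ℝ]).re = 0)

theorem norm_mk_sq (a b : ℍ[ℝ]) : ‖mk a b‖ ^ 2 = ‖a‖ ^ 2 + ‖b‖ ^ 2 := by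
  rw [WithLp.prod_norm_sq_eq_of_L2]
  rfl

theorem norm_mk_zero (a : ℍ[ℝ]) : ‖mk a 0‖ = ‖a‖ := by
  rw [← sq_eq_sq₀ (norm_nonneg _) (norm_nonneg _), norm_mk_sq]
  simp

theorem norm_zero_mk (a : ℍ[ℝ]) : ‖mk 0 a‖ = ‖a‖ := by
  rw [← sq_eq_sq₀ (norm_nonneg _) (norm_nonneg _), norm_mk_sq]
  simp

theorem finrank_cayley : Module.finrank ℝ Cayley = 8 := by
  rw [(WithLp.linearEquiv 2 ℝ (ℍ[ℝ] × ℍ[ℝ])).finrank_eq, Module.finrank_prod,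
    Quaternion.finrank_eq_four]

theorem exists_unit_orthogonal (l : List Cayley) (hl : l.length < 8) :
    ∃ w : Cayley, ‖w‖ = 1 ∧ ∀ v ∈ l, inner ℝ v w = 0 := by
  let s := Submodule.span ℝ {v | v ∈ l}
  have hs : Module.finrank ℝ s < 8 := by
    refine lt_of_le_of_lt ?_ hl
    classical
    have h1 : ({v | v ∈ l} : Set Cayley) = (l.toFinset : Set Cayley) := by ext; simp
    change Module.finrank ℝ (Submodule.span ℝ _) ≤ _
    rw [h1]
    exact (finrank_span_finset_le_card _).trans l.toFinset_card_le
  have hne : sᗮ ≠ ⊥ := by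
    intro h
    have := s.finrank_add_finrank_orthogonal
    rw [h, finrank_bot, finrank_cayley] at this
    omega
  obtain ⟨x, hx, hx0⟩ := Submodule.exists_mem_ne_zero_of_ne_bot hne
  refine ⟨‖x‖⁻¹ • x, ?_, fun v hv => ?_⟩
  · rw [norm_smul, norm_inv, norm_norm, inv_mul_cancel₀ (norm_ne_zero_iff.2 hx0)]
  · rw [inner_smul_right, (Submodule.mem_orthogonal _ _).1 hx v (Submodule.subset_span hv),
      mul_zero]

/-- The quaternion `i`. -/
def quatI : ℍ[ℝ] := ⟨0, 1, 0, 0⟩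

@[simp]
theorem quatI_re : quatI.re = 0 := rfl

@[simp]
theorem quatI_imI : quatI.imI = 1 := rfl

@[simp]
theorem quatI_imJ : quatI.imJ = 0 := rfl

@[simp]
theorem quatI_imK : quatI.imK = 0 := rfl

/-- The quaternion `j`. -/
def quatJ : ℍ[ℝ] := ⟨0, 0, 1, 0⟩

@[simp]
theorem quatJ_re : quatJ.re = 0 := rfl

@[simp]
theorem quatJ_imI : quatJ.imI = 0 := rfl

@[simp]
theorem quatJ_imJ : quatJ.imJ = 1 := rfl

@[simp]
theorem quatJ_imK : quatJ.imK = 0 := rfl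

/-- The quaternion `k`. -/
def quatK : ℍ[ℝ] := ⟨0, 0, 0, 1⟩

@[simp]
theorem quatK_re : quatK.re = 0 := rfl

@[simp]
theorem quatK_imI : quatK.imI = 0 := rfl

@[simp]
theorem quatK_imJ : quatK.imJ = 0 := rfl

@[simp]
theorem quatK_imK : quatK.imK = 1 := rfl

theorem norm_quaternion_sq (q : ℍ[ℝ]) :
    ‖q‖ ^ 2 = q.re ^ 2 + q.imI ^ 2 + q.imJ ^ 2 + q.imK ^ 2 := by
  rw [← real_inner_self_eq_norm_sq, Quaternion.inner_self, Quaternion.normSq_def']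

theorem norm_quatI : ‖quatI‖ = 1 := by
  rw [← sq_eq_sq₀ (norm_nonneg _) zero_le_one, norm_quaternion_sq]
  simp

theorem norm_quatJ : ‖quatJ‖ = 1 := by
  rw [← sq_eq_sq₀ (norm_nonneg _) zero_le_one, norm_quaternion_sq]
  simp

theorem norm_quatK : ‖quatK‖ = 1 := by
  rw [← sq_eq_sq₀ (norm_nonneg _) zero_le_one, norm_quaternion_sq]
  simp

/-- The imaginary unit `i`. -/
def e₂ : Cayley := mk quatI 0

theorem e₂_mem_imaginary : e₂ ∈ imaginary := mk_zero_mem_imaginary quatI_re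

theorem norm_e₂ : ‖e₂‖ = 1 := (norm_mk_zero _).trans norm_quatI

/-- The imaginary unit `j`. -/
def e₃ : Cayley := mk quatJ 0

theorem e₃_mem_imaginary : e₃ ∈ imaginary := mk_zero_mem_imaginary quatJ_re

theorem norm_e₃ : ‖e₃‖ = 1 := (norm_mk_zero _).trans norm_quatJ

/-- The imaginary unit `k`. -/
def e₄ : Cayley := mk quatK 0

theorem norm_e₄ : ‖e₄‖ = 1 := (norm_mk_zero _).trans norm_quatK

end Cayley

namespace Spin7

/-- The volume element of the Clifford algebra is central and acts by `-1`; hence right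
multiplication by a single imaginary unit also comes from the spin group. -/
theorem exists_smul_eq_mul {u : Cayley} (hu : u ∈ imaginary) (hu1 : ‖u‖ = 1) :
    ∃ g : Spin7, ∀ x : Cayley, g • x = x * u := by
  let g₁ := pair (neg_mem hu) (mk_zero_mem_imaginary quatI_re) (by rwa [norm_neg])
    (by rw [norm_mk_zero, norm_quatI])
  let g₂ := pair (mk_zero_mem_imaginary quatJ_re) (mk_zero_mem_imaginary quatK_re)
    (by rw [norm_mk_zero, norm_quatJ]) (by rw [norm_mk_zero, norm_quatK])
  let g₃ := pair (zero_mk_mem_imaginary 1) (zero_mk_mem_imaginary quatI)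
    (by rw [norm_zero_mk, norm_one]) (by rw [norm_zero_mk, norm_quatI])
  let g₄ := pair (zero_mk_mem_imaginary quatJ) (zero_mk_mem_imaginary quatK)
    (by rw [norm_zero_mk, norm_quatJ]) (by rw [norm_zero_mk, norm_quatK])
  have key : ∀ x : Cayley, x * mk quatI 0 * mk quatJ 0 * mk quatK 0 * mk 0 1 * mk 0 quatI *
      mk 0 quatJ * mk 0 quatK = -x := by
    intro x
    change mk x.fst x.snd * _ * _ * _ * _ * _ * _ * _ = _
    simp only [mk_mul_mk_zero, mk_mul_zero_mk]
    refine ext_pair ?_ ?_ <;> ext <;> simp [mk_fst, mk_snd]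
  refine ⟨g₄ * g₃ * g₂ * g₁, fun x => ?_⟩
  simp only [mul_smul, g₁, g₂, g₃, g₄, pair_smul]
  rw [key, mul_neg, neg_neg]

/-- The involution of `Spin(7)` fixing the quaternion subalgebra generated by two orthogonal
imaginary units and reversing its orthogonal complement. -/
theorem exists_involution {u v : Cayley} (hu : u ∈ imaginary) (hv : v ∈ imaginary)
    (hu1 : ‖u‖ = 1) (hv1 : ‖v‖ = 1) (huv : inner ℝ u v = 0) :
    ∃ g : Spin7, g • e₁ = e₁ ∧ g • u = u ∧ g • v = v ∧
      ∀ n, inner ℝ e₁ n = 0 → inner ℝ u n = 0 → inner ℝ v n = 0 → inner ℝ (u * v) n = 0 →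
        g • n = -n := by
  have hw := mul_mem_imaginary hv huv
  have hw1 : ‖u * v‖ = 1 := by rw [norm_mul, hu1, hv1, one_mul]
  obtain ⟨g, hg⟩ := exists_smul_eq_mul (neg_mem hw) (by rwa [norm_neg])
  have hact : ∀ x, (g * pair hu hv hu1 hv1) • x = x * u * v * (-(u * v)) := fun x => by
    rw [mul_smul, pair_smul, hg]
  have huv' := anticomm hu hv huv
  have c1 := conj_of_imaginary hu
  have c2 := conj_of_imaginary hv
  have c3 := conj_of_imaginary hw
  refine ⟨g * pair hu hv hu1 hv1, ?_, ?_, ?_, ?_⟩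
  · rw [hact, e₁_mul, ← c3, mul_conj_self, hw1, one_pow, one_smul]
  · have h := mul_conj_self u
    rw [c1, hu1, one_pow, one_smul, mul_neg, neg_eq_iff_eq_neg] at h
    have h' := conj_mul_cancel' v u
    rw [c2, hv1, one_pow, one_smul] at h'
    rw [hact, h, neg_mul, e₁_mul, huv', neg_neg, h']
  · have h := mul_conj_cancel u v
    rw [c2, hv1, one_pow, one_smul, mul_neg] at h
    have h' := conj_mul_cancel' u v
    rw [c1, hu1, one_pow, one_smul] at h'
    rw [hact, anticomm hv hu (by rwa [real_inner_comm]), neg_mul, h, mul_neg, ← neg_mul, h']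
  · intro n hn hnu hnv hnw
    rw [real_inner_comm] at hnu hnv hnw
    have h := mul_conj_cancel n (u * v)
    rw [c3, hw1, one_pow, one_smul, mul_neg] at h
    rw [hact, mul_mul_of_orthogonal (mem_imaginary_iff.2 hn) hu hv hnu hnv huv hnw, neg_mul,
      mul_neg, h]

theorem exists_smul_eq_e₁ {a : Cayley} (ha : ‖a‖ = 1) : ∃ g : Spin7, g • a = e₁ := by
  obtain ⟨w, hw1, hw⟩ := exists_unit_orthogonal [e₁, a] (by simp)
  have hwe : w ∈ imaginary := mem_imaginary_iff.2 (hw e₁ (by simp))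
  have hu : conj a * w ∈ imaginary := by
    rw [mem_imaginary_iff, real_inner_comm, inner_mul_left_conj, conj_conj, mul_e₁,
      real_inner_comm]
    exact hw a (by simp)
  obtain ⟨g, hg⟩ := exists_smul_eq_mul hu (by rw [norm_mul, norm_conj, ha, hw1, one_mul])
  obtain ⟨h, hh⟩ := exists_smul_eq_mul (neg_mem hwe) (by rwa [norm_neg])
  refine ⟨h * g, ?_⟩
  rw [mul_smul, hg, hh, conj_mul_cancel, ha, one_pow, one_smul, ← conj_of_imaginary hwe,
    mul_conj_self, hw1, one_pow, one_smul]

/-- If `g` fixes `a + b` and reverses `a - b`, then it maps `a` to `b`. -/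
theorem smul_eq_of_add_of_sub {g : Spin7} {a b : Cayley} (h1 : g • (a + b) = a + b)
    (h2 : g • (a - b) = -(a - b)) : g • a = b := by
  have h : (2 : ℝ) • (g • a) = (2 : ℝ) • b := by
    rw [← smul_smul', two_smul, show a + a = (a + b) + (a - b) by abel, smul_add', h1, h2,
      two_smul]
    abel
  exact smul_right_injective _ (two_ne_zero' ℝ) h

theorem norm_normalized_add {a b : Cayley} (ha : ‖a‖ = 1) (hb : ‖b‖ = 1) (hab : inner ℝ a b = 0) :
    ‖(√2)⁻¹ • (a + b)‖ = 1 := by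
  have h : ‖a + b‖ ^ 2 = 2 := by
    rw [norm_add_sq_real, ha, hb, hab]
    norm_num
  rw [norm_smul, norm_inv, Real.norm_of_nonneg (Real.sqrt_nonneg 2), ← h,
    Real.sqrt_sq (norm_nonneg _)]
  refine inv_mul_cancel₀ fun h0 => ?_
  rw [h0] at h
  norm_num at h

theorem smul_add_of_smul_normalized {g : Spin7} {a : Cayley}
    (h : g • ((√2)⁻¹ • a) = (√2)⁻¹ • a) : g • a = a := by
  rw [smul_smul'] at h
  exact smul_right_injective _ (inv_ne_zero (Real.sqrt_ne_zero'.2 zero_lt_two)) h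

/-- The case of orthogonal `a`, `b` of transitivity on imaginary units. -/
theorem exists_smul_eq_of_orthogonal {a b : Cayley} (ha : a ∈ imaginary) (hb : b ∈ imaginary)
    (ha1 : ‖a‖ = 1) (hb1 : ‖b‖ = 1) (hab : inner ℝ a b = 0) :
    ∃ g : Spin7, g • e₁ = e₁ ∧ g • a = b := by
  set u := (√2)⁻¹ • (a + b) with hu
  have hui : u ∈ imaginary := imaginary.smul_mem _ (add_mem ha hb)
  have hu1 : ‖u‖ = 1 := norm_normalized_add ha1 hb1 hab
  obtain ⟨v, hv1, hv⟩ := exists_unit_orthogonal [e₁, u, a - b, u * (a - b)] (by simp)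
  have hvi : v ∈ imaginary := mem_imaginary_iff.2 (hv e₁ (by simp))
  obtain ⟨g, hg1, hgu, -, hgn⟩ := exists_involution hui hvi hu1 hv1 (hv u (by simp))
  refine ⟨g, hg1, smul_eq_of_add_of_sub (smul_add_of_smul_normalized hgu) (hgn _ ?_ ?_ ?_ ?_)⟩
  · exact mem_imaginary_iff.1 (sub_mem ha hb)
  · rw [hu, inner_smul_left, inner_add_left, inner_sub_right, inner_sub_right,
      real_inner_self_eq_norm_sq, real_inner_self_eq_norm_sq, ha1, hb1, real_inner_comm b a]
    simp
  · rw [real_inner_comm]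
    exact hv _ (by simp)
  · rw [inner_mul_left_conj, conj_of_imaginary hui, neg_mul, inner_neg_right, real_inner_comm,
      hv _ (by simp), neg_zero]

theorem exists_smul_eq_of_imaginary {a b : Cayley} (ha : a ∈ imaginary) (hb : b ∈ imaginary)
    (ha1 : ‖a‖ = 1) (hb1 : ‖b‖ = 1) : ∃ g : Spin7, g • e₁ = e₁ ∧ g • a = b := by
  obtain ⟨w, hw1, hw⟩ := exists_unit_orthogonal [e₁, a, b] (by simp)
  have hwi : w ∈ imaginary := mem_imaginary_iff.2 (hw e₁ (by simp))
  obtain ⟨g, hg1, hg⟩ := exists_smul_eq_of_orthogonal ha hwi ha1 hw1 (hw a (by simp))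
  obtain ⟨h, hh1, hh⟩ := exists_smul_eq_of_orthogonal hwi hb hw1 hb1
    (by rw [real_inner_comm]; exact hw b (by simp))
  exact ⟨h * g, by rw [mul_smul, hg1, hh1], by rw [mul_smul, hg, hh]⟩

theorem exists_smul_eq_of_orthogonal_of_mul {a b c : Cayley} (ha : a ∈ imaginary)
    (hb : b ∈ imaginary) (hc : c ∈ imaginary) (ha1 : ‖a‖ = 1) (hb1 : ‖b‖ = 1) (hc1 : ‖c‖ = 1)
    (hab : inner ℝ a b = 0) (hca : inner ℝ c a = 0) (hcb : inner ℝ c b = 0)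
    (hcab : inner ℝ (c * a) b = 0) : ∃ g : Spin7, g • e₁ = e₁ ∧ g • c = c ∧ g • a = b := by
  set v := (√2)⁻¹ • (a + b) with hv
  have hvi : v ∈ imaginary := imaginary.smul_mem _ (add_mem ha hb)
  have hv1 : ‖v‖ = 1 := norm_normalized_add ha1 hb1 hab
  have hcv : inner ℝ c v = 0 := by
    rw [hv, inner_smul_right, inner_add_right, hca, hcb, add_zero, mul_zero]
  have hself : ∀ x, inner ℝ (c * x) x = 0 := by
    intro x
    have h := inner_mul_left_conj x c x
    rw [conj_of_imaginary hc, neg_mul, inner_neg_right] at h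
    rw [real_inner_comm] at h ⊢
    linarith
  obtain ⟨g, hg1, hgc, hgv, hgn⟩ := exists_involution hc hvi hc1 hv1 hcv
  refine ⟨g, hg1, hgc,
    smul_eq_of_add_of_sub (smul_add_of_smul_normalized hgv) (hgn _ ?_ ?_ ?_ ?_)⟩
  · exact mem_imaginary_iff.1 (sub_mem ha hb)
  · rw [inner_sub_right, hca, hcb, sub_zero]
  · rw [hv, inner_smul_left, inner_add_left, inner_sub_right, inner_sub_right,
      real_inner_self_eq_norm_sq, real_inner_self_eq_norm_sq, ha1, hb1, real_inner_comm b a]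
    simp
  · have hba : inner ℝ (c * b) a = 0 := by
      rw [inner_mul_left_conj, conj_of_imaginary hc, neg_mul, inner_neg_right, real_inner_comm,
        hcab, neg_zero]
    rw [hv, mul_smul_comm, inner_smul_left, mul_add, inner_add_left, inner_sub_right,
      inner_sub_right, hself, hself, hba, hcab]
    simp

theorem exists_smul_eq_of_imaginary_of_orthogonal {a b c : Cayley} (ha : a ∈ imaginary)
    (hb : b ∈ imaginary) (hc : c ∈ imaginary) (ha1 : ‖a‖ = 1) (hb1 : ‖b‖ = 1) (hc1 : ‖c‖ = 1)
    (hca : inner ℝ c a = 0) (hcb : inner ℝ c b = 0) :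
    ∃ g : Spin7, g • e₁ = e₁ ∧ g • c = c ∧ g • a = b := by
  obtain ⟨w, hw1, hw⟩ := exists_unit_orthogonal [e₁, c, a, b, c * a, c * b] (by simp)
  have hwi : w ∈ imaginary := mem_imaginary_iff.2 (hw e₁ (by simp))
  obtain ⟨g, hg1, hgc, hg⟩ := exists_smul_eq_of_orthogonal_of_mul ha hwi hc ha1 hw1 hc1
    (hw a (by simp)) hca (hw c (by simp)) (hw _ (by simp))
  obtain ⟨h, hh1, hhc, hh⟩ := exists_smul_eq_of_orthogonal_of_mul hwi hb hc hw1 hb1 hc1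
    (by rw [real_inner_comm]; exact hw b (by simp)) (hw c (by simp)) hcb
    (by
      rw [inner_mul_left_conj, conj_of_imaginary hc, neg_mul, inner_neg_right, real_inner_comm,
        hw (c * b) (by simp), neg_zero])
  exact ⟨h * g, by rw [mul_smul, hg1, hh1], by rw [mul_smul, hgc, hhc], by rw [mul_smul, hg, hh]⟩

end Spin7

/-- The frame `(1, i, j, k)` of the quaternions. -/
def stdFrame : Fin 4 → Cayley := ![e₁, e₂, e₃, e₄]

theorem orthonormal_stdFrame : Orthonormal ℝ stdFrame := by
  rw [orthonormal_iff_ite]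
  intro i j
  fin_cases i <;> fin_cases j <;>
    simp [stdFrame, -inner_self_eq_norm_sq_to_K,
      Quaternion.inner_def, e₁, e₂, e₃, e₄, mk_fst, mk_snd]

theorem cross_stdFrame : cross e₂ e₃ e₄ = e₁ := by
  rw [cross_eq]
  refine ext_pair ?_ ?_ <;> ext <;>
    simp [triple, Quaternion.inner_def, e₁, e₂, e₃, e₄, mk_fst, mk_snd, mul_fst, mul_snd,
      conj_fst, conj_snd]

/-- Every orthonormal frame with `f₀ = f₁ × f₂ × f₃` is the image of the standard one. -/
theorem Spin7.exists_smul_stdFrame_eq {f : Fin 4 → Cayley} (hf : Orthonormal ℝ f)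
    (hcr : f 0 = cross (f 1) (f 2) (f 3)) : ∃ g : Spin7, g • stdFrame = f := by
  have ho : ∀ g : Spin7, ∀ i j, inner ℝ (g • f i) (g • f j) = if i = j then 1 else 0 := by
    intro g i j
    rw [Spin7.inner_smul_smul]
    exact orthonormal_iff_ite.1 hf i j
  have hn : ∀ g : Spin7, ∀ i, ‖g • f i‖ = 1 := fun g i => by rw [Spin7.norm_smul', hf.1]
  obtain ⟨g₁, h₁⟩ := Spin7.exists_smul_eq_e₁ (hf.1 0)
  have hi₁ : ∀ i, i ≠ 0 → g₁ • f i ∈ imaginary := by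
    intro i hi
    rw [mem_imaginary_iff, ← h₁, ho, if_neg hi.symm]
  obtain ⟨g₂, h₂, h₂'⟩ := Spin7.exists_smul_eq_of_imaginary (hi₁ 1 (by decide))
    e₂_mem_imaginary (hn g₁ 1) norm_e₂
  have h₁' : (g₂ * g₁) • f 0 = e₁ := by rw [mul_smul, h₁, h₂]
  rw [← mul_smul] at h₂'
  obtain ⟨g₃, h₃, h₃', h₃''⟩ := Spin7.exists_smul_eq_of_imaginary_of_orthogonal
    (a := (g₂ * g₁) • f 2) (b := e₃) (c := e₂)
    (by rw [mem_imaginary_iff, ← h₁', ho]; rfl) e₃_mem_imaginary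
    e₂_mem_imaginary (hn _ _) norm_e₃ norm_e₂ (by rw [← h₂', ho]; rfl)
    (by have := orthonormal_stdFrame.2 (i := 1) (j := 2) (by decide); exact this)
  set g := g₃ * g₂ * g₁ with hg
  have h0 : g • f 0 = e₁ := by rw [hg, mul_assoc, mul_smul, h₁', h₃]
  have h1 : g • f 1 = e₂ := by rw [hg, mul_assoc, mul_smul, h₂', h₃']
  have h2 : g • f 2 = e₃ := by rw [hg, mul_assoc, mul_smul, h₃'']
  have h3 : g • f 3 = e₄ := by
    have o1 : inner ℝ e₂ (g • f 3) = 0 := by rw [← h1, ho]; rfl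
    have o2 : inner ℝ e₃ (g • f 3) = 0 := by rw [← h2, ho]; rfl
    have hc : cross e₂ e₃ (g • f 3) = e₁ := by rw [← h1, ← h2, Spin7.cross_smul, ← hcr, h0]
    rw [cross_of_orthogonal (by rw [← h1, ← h2, ho]; rfl) o2 o1, triple] at hc
    -- solve `i (j̄ z) = 1` for `z`
    have e1 := conj_mul_cancel' e₂ (conj e₃ * (g • f 3))
    rw [hc, norm_e₂, one_pow, one_smul, mul_e₁] at e1
    have e2 := conj_mul_cancel e₃ (g • f 3)
    rw [← e1, norm_e₃, one_pow, one_smul] at e2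
    rw [← e2]
    refine ext_pair ?_ ?_ <;> ext <;>
      simp [e₂, e₃, e₄, mk_fst, mk_snd, mul_fst, mul_snd, conj_fst, conj_snd]
  refine ⟨g⁻¹, ?_⟩
  rw [inv_smul_eq_iff]
  ext1 i
  fin_cases i
  exacts [h0.symm, h1.symm, h2.symm, h3.symm]

/-! ### Cayley frames -/

namespace Cayley

theorem triple_add_triple_swap_left (x y z : Cayley) :
    triple x y z + triple y x z = (2 * inner ℝ x y) • z := by
  have h := conj_mul_cancel (x + y) z
  rw [norm_add_sq_real, conj_add, add_mul, add_mul, mul_add, mul_add, conj_mul_cancel,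
    conj_mul_cancel, add_smul, add_smul] at h
  simp only [triple]
  calc x * (conj y * z) + y * (conj x * z)
      = (‖x‖ ^ 2 • z + x * (conj y * z) + (y * (conj x * z) + ‖y‖ ^ 2 • z))
          - ‖x‖ ^ 2 • z - ‖y‖ ^ 2 • z := by abel
    _ = _ := by rw [h]; abel

theorem conj_mul_self (x : Cayley) : conj x * x = ‖x‖ ^ 2 • e₁ := by
  have h := conj_mul_cancel' x e₁
  rwa [mul_e₁] at h

theorem inner_left_triple (x y z : Cayley) :
    inner ℝ x (triple x y z) = ‖x‖ ^ 2 * inner ℝ y z := by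
  rw [triple, real_inner_comm, inner_mul_left_conj, conj_mul_self, inner_smul_right,
    inner_mul_left_conj, conj_conj, mul_e₁, real_inner_comm]

theorem norm_triple (x y z : Cayley) : ‖triple x y z‖ = ‖x‖ * ‖y‖ * ‖z‖ := by
  rw [triple, norm_mul, norm_mul, norm_conj, mul_assoc]

/-- The quaternions `ℍ ⊆ Ca`. -/
def quaternions : Submodule ℝ Cayley where
  carrier := {x | x.snd = 0}
  add_mem' := by
    intro x y hx hy
    simp only [Set.mem_ofPred_eq] at hx hy ⊢
    simp [hx, hy]
  zero_mem' := by simp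
  smul_mem' := by
    intro c x hx
    simp only [Set.mem_ofPred_eq] at hx ⊢
    simp [hx]

theorem mem_quaternions {x : Cayley} : x ∈ quaternions ↔ x.snd = 0 := Iff.rfl

theorem eq_sum_of_mem_quaternions {x : Cayley} (hx : x ∈ quaternions) :
    x = x.fst.re • e₁ + x.fst.imI • e₂ + x.fst.imJ • e₃ + x.fst.imK • e₄ := by
  have hx' : x.snd = 0 := hx
  refine ext_pair ?_ ?_ <;> ext <;> simp [hx', e₁, e₂, e₃, e₄, mk_fst, mk_snd]

theorem cross_mem_quaternions {x y z : Cayley} (hx : x ∈ quaternions) (hy : y ∈ quaternions)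
    (hz : z ∈ quaternions) : cross x y z ∈ quaternions := by
  rw [mem_quaternions] at *
  simp [cross, mul_snd, mul_fst, conj_snd, conj_fst, hx, hy, hz]

end Cayley

theorem stdFrame_mem_quaternions (i : Fin 4) : stdFrame i ∈ quaternions := by
  fin_cases i <;> rfl

/-- The plane spanned by an image of the standard frame. -/
theorem mem_span_smul_stdFrame {g : Spin7} {x : Cayley} :
    x ∈ Submodule.span ℝ (range (g • stdFrame)) ↔ g⁻¹ • x ∈ quaternions := by
  constructor
  · intro hx
    have h : Submodule.span ℝ (range (g • stdFrame)) ≤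
        quaternions.comap (Spin7.toCLM g⁻¹ : Cayley →L[ℝ] Cayley).toLinearMap := by
      rw [Submodule.span_le]
      rintro _ ⟨i, rfl⟩
      change g⁻¹ • g • stdFrame i ∈ quaternions
      rw [inv_smul_smul]
      exact stdFrame_mem_quaternions i
    exact h hx
  · intro hx
    have h := congrArg (g • ·) (eq_sum_of_mem_quaternions hx)
    simp only [smul_inv_smul, Spin7.smul_add', Spin7.smul_smul'] at h
    have hm : ∀ i, g • stdFrame i ∈ Submodule.span ℝ (range (g • stdFrame)) :=
      fun i => Submodule.subset_span ⟨i, rfl⟩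
    rw [h]
    exact add_mem (add_mem (add_mem (Submodule.smul_mem _ _ (hm 0)) (Submodule.smul_mem _ _ (hm 1)))
      (Submodule.smul_mem _ _ (hm 2))) (Submodule.smul_mem _ _ (hm 3))

theorem orthonormal_smul_stdFrame (g : Spin7) : Orthonormal ℝ (g • stdFrame) := by
  rw [orthonormal_iff_ite]
  intro i j
  rw [Pi.smul_apply, Pi.smul_apply, Spin7.inner_smul_smul]
  exact orthonormal_iff_ite.1 orthonormal_stdFrame i j

theorem isCayleyFrame_smul_stdFrame (g : Spin7) : IsCayleyFrame (g • stdFrame) := by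
  set f := g • stdFrame with hf
  have ho : Orthonormal ℝ f := orthonormal_smul_stdFrame g
  have hcr : cross (f 1) (f 2) (f 3) = f 0 := by
    change cross (g • e₂) (g • e₃) (g • e₄) = g • e₁
    rw [Spin7.cross_smul, cross_stdFrame]
  have hB : ![cross (f 1) (f 2) (f 3), f 1, f 2, f 3] = f := by
    ext1 i
    fin_cases i
    exacts [hcr, rfl, rfl, rfl]
  have hm : ∀ i, f i ∈ Submodule.span ℝ (range f) := fun i => Submodule.subset_span ⟨i, rfl⟩
  refine ⟨ho, _, ⟨?_, ?_⟩, rfl, f 1, hm 1, f 2, hm 2, f 3, hm 3, ?_, ?_⟩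
  · rw [finrank_span_eq_card ho.linearIndependent, Fintype.card_fin]
  · intro x hx y hy z hz
    rw [mem_span_smul_stdFrame] at hx hy hz ⊢
    rw [← Spin7.cross_smul]
    exact cross_mem_quaternions hx hy hz
  · rw [hB]
    exact ho.linearIndependent
  · rw [hB]
    exact ⟨1, by simp, fun i => by simp [Matrix.one_apply]⟩

/-- For quaternions `x`, `y`, `z`, the determinant of `(x × y × z, x, y, z)` is `|x × y × z|²`. -/
theorem det_cross_nonneg {x y z : Cayley} (hx : x ∈ quaternions) (hy : y ∈ quaternions)
    (hz : z ∈ quaternions) :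
    0 ≤ (Matrix.of fun i : Fin 4 => fun j : Fin 4 =>
      inner ℝ (stdFrame j) (![cross x y z, x, y, z] i)).det := by
  have h : (Matrix.of fun i : Fin 4 => fun j : Fin 4 =>
      inner ℝ (stdFrame j) (![cross x y z, x, y, z] i)) =
      !![(cross x y z).fst.re, (cross x y z).fst.imI, (cross x y z).fst.imJ, (cross x y z).fst.imK;
        x.fst.re, x.fst.imI, x.fst.imJ, x.fst.imK;
        y.fst.re, y.fst.imI, y.fst.imJ, y.fst.imK;
        z.fst.re, z.fst.imI, z.fst.imJ, z.fst.imK] := by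
    ext i j
    fin_cases i <;> fin_cases j <;> simp [stdFrame, Quaternion.inner_def, e₁, e₂, e₃, e₄, mk_fst, mk_snd]
  rw [h]
  have hx' : x.snd = 0 := hx
  have hy' : y.snd = 0 := hy
  have hz' : z.snd = 0 := hz
  have key : Matrix.det !![(cross x y z).fst.re, (cross x y z).fst.imI, (cross x y z).fst.imJ,
        (cross x y z).fst.imK;
        x.fst.re, x.fst.imI, x.fst.imJ, x.fst.imK;
        y.fst.re, y.fst.imI, y.fst.imJ, y.fst.imK;
        z.fst.re, z.fst.imI, z.fst.imJ, z.fst.imK] = (cross x y z).fst.re ^ 2 +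
        (cross x y z).fst.imI ^ 2 + (cross x y z).fst.imJ ^ 2 + (cross x y z).fst.imK ^ 2 := by
    have h0 : (cross x y z).fst.re = Matrix.det !![x.fst.imI, x.fst.imJ, x.fst.imK;
        y.fst.imI, y.fst.imJ, y.fst.imK; z.fst.imI, z.fst.imJ, z.fst.imK] := by
      rw [Matrix.det_fin_three]
      simp [cross, mul_snd, mul_fst, conj_snd, conj_fst, hx', hy', hz']
      ring
    have h1 : (cross x y z).fst.imI = -Matrix.det !![x.fst.re, x.fst.imJ, x.fst.imK;
        y.fst.re, y.fst.imJ, y.fst.imK; z.fst.re, z.fst.imJ, z.fst.imK] := by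
      rw [Matrix.det_fin_three]
      simp [cross, mul_snd, mul_fst, conj_snd, conj_fst, hx', hy', hz']
      ring
    have h2 : (cross x y z).fst.imJ = Matrix.det !![x.fst.re, x.fst.imI, x.fst.imK;
        y.fst.re, y.fst.imI, y.fst.imK; z.fst.re, z.fst.imI, z.fst.imK] := by
      rw [Matrix.det_fin_three]
      simp [cross, mul_snd, mul_fst, conj_snd, conj_fst, hx', hy', hz']
      ring
    have h3 : (cross x y z).fst.imK = -Matrix.det !![x.fst.re, x.fst.imI, x.fst.imJ;
        y.fst.re, y.fst.imI, y.fst.imJ; z.fst.re, z.fst.imI, z.fst.imJ] := by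
      rw [Matrix.det_fin_three]
      simp [cross, mul_snd, mul_fst, conj_snd, conj_fst, hx', hy', hz']
      ring
    rw [Matrix.det_fin_three] at h0 h1 h2 h3
    generalize (cross x y z).fst = c at *
    rw [Matrix.det_succ_row_zero]
    simp [Fin.sum_univ_succ, Matrix.det_fin_three, Fin.succAbove] at h0 h1 h2 h3 ⊢
    linear_combination (-c.re) * h0 + (-c.imI) * h1 + (-c.imJ) * h2 + (-c.imK) * h3
  rw [key]
  positivity

theorem inner_cross_of_orthonormal {f : Fin 4 → Cayley} (hf : Orthonormal ℝ f) (i : Fin 4)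
    (hi : i ≠ 0) : inner ℝ (f i) (cross (f 1) (f 2) (f 3)) = 0 := by
  have h := orthonormal_iff_ite.1 hf
  have h12 : inner ℝ (f 1) (f 2) = 0 := h 1 2
  have h13 : inner ℝ (f 1) (f 3) = 0 := h 1 3
  have h23 : inner ℝ (f 2) (f 3) = 0 := h 2 3
  have h21 : inner ℝ (f 2) (f 1) = 0 := h 2 1
  rw [cross_of_orthogonal h12 h23 h13]
  obtain rfl | rfl | rfl : i = 1 ∨ i = 2 ∨ i = 3 := by fin_cases i <;> simp at hi ⊢
  · rw [inner_left_triple, h23, mul_zero]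
  · have e := triple_add_triple_swap_left (f 1) (f 2) (f 3)
    rw [h12, mul_zero, zero_smul] at e
    rw [eq_neg_of_add_eq_zero_left e, inner_neg_right, inner_left_triple, h13, mul_zero, neg_zero]
  · have e := triple_add_triple_swap (f 1) (f 2) (f 3)
    rw [h12, h13, h23, mul_zero, zero_smul, zero_smul, zero_smul, add_zero, sub_zero] at e
    rw [eq_neg_of_add_eq_zero_left e, inner_neg_right, inner_left_triple, h21, mul_zero, neg_zero]

/-- Cayley frames are the images of the standard frame.  The cross product of `f₁`, `f₂`, `f₃` is
`± f₀`; the sign `-` would give a basis of the wrong orientation, as one sees after moving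
`(-f₀, f₁, f₂, f₃)` to the standard frame. -/
theorem isCayleyFrame_iff {f : Fin 4 → Cayley} :
    IsCayleyFrame f ↔ ∃ g : Spin7, g • stdFrame = f := by
  constructor
  swap
  · rintro ⟨g, rfl⟩
    exact isCayleyFrame_smul_stdFrame g
  rintro ⟨hf, ζ, ⟨-, hζ⟩, rfl, x, hx, y, hy, z, hz, -, A, hA, hAf⟩
  have hm : ∀ i, f i ∈ Submodule.span ℝ (range f) := fun i => Submodule.subset_span ⟨i, rfl⟩
  set c := cross (f 1) (f 2) (f 3) with hc
  have h := orthonormal_iff_ite.1 hf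
  have hcf : c = (inner ℝ (f 0) c) • f 0 := by
    obtain ⟨a, ha⟩ := (Submodule.mem_span_range_iff_exists_fun ℝ).1
      (hζ _ (hm 1) _ (hm 2) _ (hm 3))
    have ha' : ∀ i, inner ℝ (f i) c = a i := fun i => by
      rw [hc, ← ha, hf.inner_right_fintype]
    have hz : ∀ i, i ≠ 0 → a i = 0 := fun i hi => by
      rw [← ha', inner_cross_of_orthonormal hf i hi]
    rw [ha', hc, ← ha, Fin.sum_univ_four, hz 1 (by decide), hz 2 (by decide), hz 3 (by decide)]
    simp
  have hc1 : ‖c‖ = 1 := by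
    rw [hc, cross_of_orthogonal (h 1 2) (h 2 3) (h 1 3), norm_triple, hf.1, hf.1, hf.1]
    norm_num
  have hs : inner ℝ (f 0) c = 1 ∨ inner ℝ (f 0) c = -1 := by
    rw [hcf, norm_smul, hf.1, mul_one] at hc1
    exact eq_or_eq_neg_of_abs_eq hc1
  rcases hs with hs | hs
  · rw [hs, one_smul] at hcf
    exact Spin7.exists_smul_stdFrame_eq hf hcf.symm
  exfalso
  rw [hs, neg_one_smul] at hcf
  -- `s` is the diagonal of the change of basis from `f` to the frame `(-f₀, f₁, f₂, f₃)`
  let s : Fin 4 → ℝ := ![-1, 1, 1, 1]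
  have hss : ∀ i, s i * s i = 1 := by
    intro i
    fin_cases i <;> simp [s]
  obtain ⟨g, hg⟩ := Spin7.exists_smul_stdFrame_eq (f := fun i => s i • f i)
    (by
      rw [orthonormal_iff_ite]
      intro i j
      rw [inner_smul_left, inner_smul_right, h]
      split_ifs with hij
      · subst hij
        simpa using hss i
      · simp)
    (by simpa [s] using hcf.symm)
  have hgf : ∀ i, g⁻¹ • f i = s i • stdFrame i := by
    intro i
    have h1 := congrFun hg i
    rw [inv_smul_eq_iff, Spin7.smul_smul', ← Pi.smul_apply g stdFrame i, h1, smul_smul, hss, one_smul]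
  have hspan : ∀ w ∈ Submodule.span ℝ (range f), g⁻¹ • w ∈ quaternions := by
    intro w hw
    rw [← mem_span_smul_stdFrame, hg]
    refine Submodule.span_le.2 ?_ hw
    rintro _ ⟨i, rfl⟩
    have h1 : s i • s i • f i ∈ Submodule.span ℝ (range fun i => s i • f i) :=
      Submodule.smul_mem _ _ (Submodule.subset_span ⟨i, rfl⟩)
    rwa [smul_smul, hss, one_smul] at h1
  have hdet := det_cross_nonneg (hspan x hx) (hspan y hy) (hspan z hz)
  set M := Matrix.of fun i : Fin 4 => fun j : Fin 4 => (inner ℝ (stdFrame j)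
    (![cross (g⁻¹ • x) (g⁻¹ • y) (g⁻¹ • z), g⁻¹ • x, g⁻¹ • y, g⁻¹ • z] i) : ℝ) with hM
  have hBi : ∀ i, ![cross (g⁻¹ • x) (g⁻¹ • y) (g⁻¹ • z), g⁻¹ • x, g⁻¹ • y, g⁻¹ • z] i =
      g⁻¹ • (![cross x y z, x, y, z] i) := by
    intro i
    fin_cases i
    exacts [Spin7.cross_smul _ _ _ _, rfl, rfl, rfl]
  have hprod : A * M = Matrix.diagonal s := by
    ext i j
    rw [Matrix.mul_apply, Matrix.diagonal_apply]
    have h1 := hgf i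
    rw [hAf i] at h1
    have h2 : g⁻¹ • ∑ k, A i k • ![cross x y z, x, y, z] k =
        ∑ k, A i k • g⁻¹ • ![cross x y z, x, y, z] k := by
      rw [← Spin7.toCLM_apply, map_sum]
      simp [Spin7.toCLM_apply]
    rw [h2] at h1
    have h3 := congrArg (inner ℝ (stdFrame j)) h1
    rw [inner_sum, inner_smul_right, orthonormal_iff_ite.1 orthonormal_stdFrame] at h3
    simp only [hM, Matrix.of_apply, hBi]
    simp only [inner_smul_right] at h3
    rw [h3]
    by_cases hij : i = j
    · simp [hij]
    · simp [hij, Ne.symm hij]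
  have hdet' := congrArg Matrix.det hprod
  rw [Matrix.det_mul, Matrix.det_diagonal] at hdet'
  simp [Fin.prod_univ_four, s] at hdet'
  have := mul_nonneg hA.le hdet
  rw [hdet'] at this
  norm_num at this

/-! ### The stabiliser of the standard frame -/

/-- `a + b e ↦ a + (q b) e` is a product of four right multiplications if `q` is the square of a
product of two imaginary units. -/
theorem Spin7.exists_smul_eq_of_imaginary_quaternions {u v : ℍ[ℝ]} (hu : ‖u‖ = 1) (hv : ‖v‖ = 1)
    (hu0 : star u = -u) (hv0 : star v = -v) :
    ∃ g : Spin7, ∀ a b, g • mk a b = mk a (v * u * (v * u) * b) := by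
  have huu : u * u = -1 := by
    have h := Quaternion.self_mul_star u
    rw [hu0, Quaternion.normSq_eq_norm_mul_self, hu] at h
    simpa [neg_eq_iff_eq_neg] using h
  have hvv : v * v = -1 := by
    have h := Quaternion.self_mul_star v
    rw [hv0, Quaternion.normSq_eq_norm_mul_self, hv] at h
    simpa [neg_eq_iff_eq_neg] using h
  refine ⟨pair (zero_mk_mem_imaginary u) (zero_mk_mem_imaginary v)
      (by rwa [norm_zero_mk]) (by rwa [norm_zero_mk]) *
    pair (zero_mk_mem_imaginary (-(u * v))) (zero_mk_mem_imaginary 1)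
      (by rw [norm_zero_mk, norm_neg, _root_.norm_mul, hu, hv, one_mul])
      (by rw [norm_zero_mk, norm_one]), fun a b => ?_⟩
  rw [mul_smul, pair_smul, pair_smul]
  simp only [mk_mul_zero_mk, hu0, hv0, star_neg, star_mul, star_one]
  refine congrArg₂ mk ?_ ?_
  · calc _ = v * (u * u) * v * a := by noncomm_ring
      _ = a := by rw [huu, mul_neg_one, neg_mul, hvv, neg_neg, one_mul]
  · noncomm_ring

/-- Every unit quaternion `q` acts on the second component through an element of `Spin(7)`: if
`q ≠ -1` then `q` is the square of `(1 + q) / |1 + q|`, which is a product of two imaginary units. -/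
theorem Spin7.exists_smul_mk_eq {q : ℍ[ℝ]} (hq : ‖q‖ = 1) :
    ∃ g : Spin7, ∀ a b, g • mk a b = mk a (q * b) := by
  have main : ∀ q : ℍ[ℝ], ‖q‖ = 1 → q ≠ -1 → ∃ g : Spin7, ∀ a b, g • mk a b = mk a (q * b) := by
    intro q hq hq1
    have h0 : ‖1 + q‖ ≠ 0 := by
      rw [norm_ne_zero_iff]
      intro h
      exact hq1 (eq_neg_of_add_eq_zero_right h)
    set s : ℍ[ℝ] := ‖1 + q‖⁻¹ • (1 + q) with hs
    have hs1 : ‖s‖ = 1 := by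
      rw [hs, norm_smul, norm_inv, norm_norm, inv_mul_cancel₀ h0]
    have hsq : s * s = q := by
      have h1 : (1 + q) * (1 + q) = (‖1 + q‖ * ‖1 + q‖) • q := by
        have e1 := Quaternion.self_mul_star (1 + q)
        have e2 := Quaternion.star_mul_self q
        rw [Quaternion.normSq_eq_norm_mul_self] at e1 e2
        rw [hq] at e2
        have e3 : (1 + q) * (1 + q) = (1 + q) * star (1 + q) * q := by
          rw [mul_assoc, star_add, add_mul (star 1), e2]
          simp [add_comm]
        rw [e3, e1, ← Quaternion.coe_mul_eq_smul]
      rw [hs, smul_mul_smul_comm, h1, smul_smul]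
      rw [show ‖1 + q‖⁻¹ * ‖1 + q‖⁻¹ * (‖1 + q‖ * ‖1 + q‖) = 1 by field_simp, one_smul]
    obtain ⟨w, hw1, hw⟩ := exists_unit_orthogonal
      [e₁, mk s 0, mk 0 1, mk 0 quatI, mk 0 quatJ, mk 0 quatK] (by simp)
    have w1 := hw e₁ (by simp)
    have w2 := hw (mk s 0) (by simp)
    have w3 := hw (mk 0 1) (by simp)
    have w4 := hw (mk 0 quatI) (by simp)
    have w5 := hw (mk 0 quatJ) (by simp)
    have w6 := hw (mk 0 quatK) (by simp)
    rw [inner_eq] at w1 w2 w3 w4 w5 w6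
    simp [mk_fst, mk_snd, e₁] at w1 w2 w3 w4 w5 w6
    have hws : w.snd = 0 := by ext <;> simp [w3, w4, w5, w6]
    have hu1 : ‖w.fst‖ = 1 := by
      have : w = mk w.fst 0 := ext_pair rfl hws
      rw [this, norm_mk_zero] at hw1
      exact hw1
    have hu0 : star w.fst = -w.fst := by ext <;> simp [w1]
    have huu : w.fst * w.fst = -1 := by
      have h := Quaternion.self_mul_star w.fst
      rw [hu0, Quaternion.normSq_eq_norm_mul_self, hu1] at h
      simpa [neg_eq_iff_eq_neg] using h
    have hv0 : star (-(s * w.fst)) = -(-(s * w.fst)) := by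
      have : (s * w.fst).re = 0 := by
        simp
        rw [w1] at w2 ⊢
        linarith
      ext <;> simp only [Quaternion.re_star, Quaternion.imI_star, Quaternion.imJ_star,
        Quaternion.imK_star, Quaternion.re_neg, Quaternion.imI_neg, Quaternion.imJ_neg,
        Quaternion.imK_neg, this, neg_zero]
    obtain ⟨g, hg⟩ := exists_smul_eq_of_imaginary_quaternions hu1
      (v := -(s * w.fst)) (by rw [norm_neg, _root_.norm_mul, hs1, hu1, one_mul]) hu0 hv0
    refine ⟨g, fun a b => ?_⟩
    rw [hg, neg_mul, mul_assoc s, huu, mul_neg_one, neg_neg, hsq]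
  by_cases hq1 : q = -1
  · obtain ⟨g, hg⟩ := main quatI norm_quatI (by
      intro h
      have := congrArg QuaternionAlgebra.re h
      simp at this)
    refine ⟨g * g, fun a b => ?_⟩
    have h2 : quatI * quatI = -1 := by ext <;> simp
    rw [mul_smul, hg, hg, ← mul_assoc, h2, hq1]
  · exact main q hq hq1

/-- The homomorphism `Sp(1) → Spin(7)` for which `q` acts as `a + b e ↦ a + (q b) e`. -/
def spOneHom : Sp1 →* Spin7 where
  toFun q := Classical.choose (Spin7.exists_smul_mk_eq (mem_sphere_zero_iff_norm.1 q.2))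
  map_one' := by
    apply Spin7.toCLM_injective
    ext1 x
    have h := Classical.choose_spec (Spin7.exists_smul_mk_eq
      (mem_sphere_zero_iff_norm.1 (1 : Sp1).2)) x.fst x.snd
    rw [Spin7.toCLM_apply, Spin7.toCLM_apply, one_smul]
    refine h.trans ?_
    rw [show ((1 : Sp1) : ℍ[ℝ]) = 1 from rfl, one_mul]
    rfl
  map_mul' p q := by
    apply Spin7.toCLM_injective
    ext1 x
    have h := fun r : Sp1 => Classical.choose_spec (Spin7.exists_smul_mk_eq
      (mem_sphere_zero_iff_norm.1 r.2))
    rw [Spin7.toCLM_apply, Spin7.toCLM_apply, mul_smul]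
    refine (h (p * q) x.fst x.snd).trans ?_
    have h2 : _ • x = _ := h q x.fst x.snd
    rw [h2, h p, ← mul_assoc]
    rfl

theorem spOneHom_smul (q : Sp1) (a b : ℍ[ℝ]) :
    spOneHom q • mk a b = mk a ((q : ℍ[ℝ]) * b) :=
  Classical.choose_spec (Spin7.exists_smul_mk_eq (mem_sphere_zero_iff_norm.1 q.2)) a b

theorem spOneHom_smul_stdFrame (q : Sp1) : spOneHom q • stdFrame = stdFrame := by
  ext1 i
  have h : ∀ a, spOneHom q • mk a 0 = mk a 0 := fun a => by rw [spOneHom_smul, mul_zero]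
  fin_cases i
  exacts [h _, h _, h _, h _]

/-- An element of `Spin(7)` fixing `1, i, j, k` is an automorphism of the Cayley numbers fixing
`ℍ`; it is determined by the image `q e` of `e`. -/
theorem range_spOneHom : spOneHom.range = MulAction.stabilizer Spin7 stdFrame := by
  ext g
  rw [MonoidHom.mem_range, MulAction.mem_stabilizer_iff]
  constructor
  · rintro ⟨q, rfl⟩
    exact spOneHom_smul_stdFrame q
  intro hg
  have h1 : g • e₁ = e₁ := congrFun hg 0
  have h2 : g • e₂ = e₂ := congrFun hg 1
  have h3 : g • e₃ = e₃ := congrFun hg 2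
  have h4 : g • e₄ = e₄ := congrFun hg 3
  have hH : ∀ a, g • mk a 0 = mk a 0 := by
    intro a
    rw [eq_sum_of_mem_quaternions (x := mk a 0) rfl]
    simp only [Spin7.smul_add', Spin7.smul_smul', h1, h2, h3, h4]
  have hmul : ∀ x y : Cayley, g • (x * y) = (g • x) * (g • y) := by
    intro x y
    have h := Spin7.triple_smul g x e₁ y
    rw [h1, triple, triple, conj_e₁, e₁_mul, e₁_mul] at h
    exact h.symm
  set n := g • mk 0 1 with hn
  have hn0 : n.fst = 0 := by
    have h : ∀ a, inner ℝ (mk a 0) n = 0 := by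
      intro a
      rw [← hH a, hn, Spin7.inner_smul_smul, WithLp.prod_inner_apply]
      simp [mk]
    have a1 := h 1
    have a2 := h quatI
    have a3 := h quatJ
    have a4 := h quatK
    rw [inner_eq] at a1 a2 a3 a4
    simp [mk_fst, mk_snd] at a1 a2 a3 a4
    ext <;> simp [a1, a2, a3, a4]
  have hn' : n = mk 0 n.snd := ext_pair hn0 rfl
  have hn1 : ‖n.snd‖ = 1 := by
    rw [← norm_zero_mk, ← hn', hn, Spin7.norm_smul', norm_zero_mk, norm_one]
  refine ⟨⟨n.snd, mem_sphere_zero_iff_norm.2 hn1⟩, ?_⟩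
  apply Spin7.toCLM_injective
  ext1 x
  rw [Spin7.toCLM_apply, Spin7.toCLM_apply]
  have hx : x = mk x.fst 0 + mk x.snd 0 * mk 0 1 := by
    rw [mk_mul_zero_mk]
    refine ext_pair ?_ ?_ <;> simp [mk_fst, mk_snd]
  have hx' : x = mk x.fst x.snd := rfl
  conv_lhs => rw [hx', spOneHom_smul]
  conv_rhs => rw [hx, Spin7.smul_add', hmul, hH, hH, ← hn, hn', mk_mul_zero_mk]
  refine ext_pair ?_ ?_ <;> simp [mk_fst, mk_snd]

/-! ### Linear coordinates near the identity and near the standard frame -/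

/-- The space of coordinates for Cayley frames. -/
abbrev FrameCoord : Type := (Fin 6 → ℝ) × (Fin 3 → ℍ[ℝ])

/-- The space of coordinates for `Spin(7)`: those of the image of the standard frame, and three
for the stabiliser. -/
abbrev SpinCoord : Type := FrameCoord × (Fin 3 → ℝ)

/-- The coordinates of `(f₁, f₂, f₃)` that are free to first order near `(i, j, k)`, given
orthonormality: all but the components of `fₐ` along `e_b` with `b ≤ a`. -/
def frameCoord : (Fin 4 → Cayley) →ₗ[ℝ] FrameCoord where
  toFun f := (![(f 1).fst.re, (f 1).fst.imJ, (f 1).fst.imK, (f 2).fst.re, (f 2).fst.imK,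
    (f 3).fst.re], ![(f 1).snd, (f 2).snd, (f 3).snd])
  map_add' f f' := by
    refine Prod.ext ?_ ?_ <;> ext1 i <;> fin_cases i <;> simp
  map_smul' c f := by
    refine Prod.ext ?_ ?_ <;> ext1 i <;> fin_cases i <;> simp

/-- The image of the standard frame under a linear map. -/
def evalStd : (Cayley →L[ℝ] Cayley) →ₗ[ℝ] (Fin 4 → Cayley) where
  toFun T i := T (stdFrame i)
  map_add' _ _ := rfl
  map_smul' _ _ := rfl

/-- The coordinates of an element of `Spin(7)` near the identity: those of the image of the
standard frame, and the imaginary part of `q` if `e` is mapped to `p + q e`. -/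
def spinCoord : (Cayley →L[ℝ] Cayley) →ₗ[ℝ] SpinCoord where
  toFun T := (frameCoord (evalStd T), ![(T (mk 0 1)).snd.imI, (T (mk 0 1)).snd.imJ,
    (T (mk 0 1)).snd.imK])
  map_add' T T' := by
    refine Prod.ext ?_ ?_
    · simp
    · ext1 i
      fin_cases i <;> simp
  map_smul' c T := by
    refine Prod.ext ?_ ?_
    · simp
    · ext1 i
      fin_cases i <;> simp

/-- The basis `1, i, j, k, e, ie, je, ke` of the Cayley numbers. -/
def cayleyBasis : Fin 8 → Cayley :=
  ![e₁, e₂, e₃, e₄, mk 0 1, mk 0 quatI, mk 0 quatJ, mk 0 quatK]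

/-- Eight vectors near an orthonormal basis of `ℝ⁸` have no common nonzero orthogonal vector. -/
theorem eq_zero_of_inner_eq_zero {w : Fin 8 → Cayley} (hw : ∀ i, ‖w i - cayleyBasis i‖ ≤ 1 / 3)
    {d : Cayley} (hd : ∀ i, inner ℝ (w i) d = 0) : d = 0 := by
  have hb : ∀ i, inner ℝ (cayleyBasis i) d ^ 2 ≤ 1 / 9 * ‖d‖ ^ 2 := by
    intro i
    have h1 : inner ℝ (cayleyBasis i) d = -inner ℝ (w i - cayleyBasis i) d := by
      rw [inner_sub_left, hd]
      ring
    have h2 : |inner ℝ (w i - cayleyBasis i) d| ≤ 1 / 3 * ‖d‖ :=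
      (abs_real_inner_le_norm _ _).trans (mul_le_mul_of_nonneg_right (hw i) (norm_nonneg d))
    rw [h1, neg_sq, ← sq_abs]
    calc |inner ℝ (w i - cayleyBasis i) d| ^ 2 ≤ (1 / 3 * ‖d‖) ^ 2 :=
          pow_le_pow_left₀ (abs_nonneg _) h2 2
      _ = _ := by ring
  have hsum : ‖d‖ ^ 2 = ∑ i, inner ℝ (cayleyBasis i) d ^ 2 := by
    rw [norm_sq_eq]
    simp [Fin.sum_univ_eight, cayleyBasis, e₁, e₂, e₃, e₄, Quaternion.inner_def, mk_fst, mk_snd]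
    ring
  have h : ‖d‖ ^ 2 ≤ 8 / 9 * ‖d‖ ^ 2 := by
    calc ‖d‖ ^ 2 = ∑ i, inner ℝ (cayleyBasis i) d ^ 2 := hsum
      _ ≤ ∑ _i : Fin 8, 1 / 9 * ‖d‖ ^ 2 := Finset.sum_le_sum fun i _ => hb i
      _ = _ := by rw [Finset.sum_const, Finset.card_univ, Fintype.card_fin]; simp; ring
  have h0 : ‖d‖ ^ 2 = 0 := le_antisymm (by linarith) (by positivity)
  simpa using h0

theorem norm_midpoint_sub_le {x y z : Cayley} (hx : ‖x - z‖ ≤ 1 / 3) (hy : ‖y - z‖ ≤ 1 / 3) :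
    ‖(2⁻¹ : ℝ) • (x + y) - z‖ ≤ 1 / 3 := by
  have h : (2⁻¹ : ℝ) • (x + y) - z = (2⁻¹ : ℝ) • ((x - z) + (y - z)) := by module
  rw [h, norm_smul]
  have := norm_add_le (x - z) (y - z)
  norm_num
  linarith

theorem inner_midpoint_sub {x y : Cayley} (h : ‖x‖ = ‖y‖) :
    inner ℝ ((2⁻¹ : ℝ) • (x + y)) (x - y) = 0 := by
  rw [inner_smul_left, inner_add_left, inner_sub_right, inner_sub_right,
    real_inner_self_eq_norm_sq, real_inner_self_eq_norm_sq, h, real_inner_comm x y]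
  simp

/-- Near the standard frame, `frameCoord` determines a frame with `f₀ = f₁ × f₂ × f₃`. -/
theorem frame_eq_of_frameCoord_eq {f f' : Fin 4 → Cayley} (hf : Orthonormal ℝ f)
    (hf' : Orthonormal ℝ f') (hcr : f 0 = cross (f 1) (f 2) (f 3))
    (hcr' : f' 0 = cross (f' 1) (f' 2) (f' 3)) (h : frameCoord f = frameCoord f')
    (hn : ∀ i, ‖f i - stdFrame i‖ ≤ 1 / 3) (hn' : ∀ i, ‖f' i - stdFrame i‖ ≤ 1 / 3) :
    f = f' := by
  have o := orthonormal_iff_ite.1 hf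
  have o' := orthonormal_iff_ite.1 hf'
  have hself : ∀ x : Cayley, ‖x - x‖ ≤ 1 / 3 := fun x => by rw [sub_self, norm_zero]; norm_num
  have c1 := congrFun (congrArg Prod.fst h)
  have c2 := congrFun (congrArg Prod.snd h)
  have r1 : (f 1).fst.re = (f' 1).fst.re := c1 0
  have r2 : (f 1).fst.imJ = (f' 1).fst.imJ := c1 1
  have r3 : (f 1).fst.imK = (f' 1).fst.imK := c1 2
  have r4 : (f 2).fst.re = (f' 2).fst.re := c1 3
  have r5 : (f 2).fst.imK = (f' 2).fst.imK := c1 4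
  have r6 : (f 3).fst.re = (f' 3).fst.re := c1 5
  have s1 : (f 1).snd = (f' 1).snd := c2 0
  have s2 : (f 2).snd = (f' 2).snd := c2 1
  have s3 : (f 3).snd = (f' 3).snd := c2 2
  have h1 : f 1 = f' 1 := by
    refine sub_eq_zero.1 (eq_zero_of_inner_eq_zero (w := ![e₁, (2⁻¹ : ℝ) • (f 1 + f' 1), e₃, e₄,
      mk 0 1, mk 0 quatI, mk 0 quatJ, mk 0 quatK]) (fun i => ?_) (fun i => ?_))
    · fin_cases i
      exacts [hself _, norm_midpoint_sub_le (hn 1) (hn' 1), hself _, hself _, hself _, hself _,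
        hself _, hself _]
    · fin_cases i
      on_goal 2 => exact inner_midpoint_sub (by rw [hf.1, hf'.1])
      all_goals simp [e₁, e₃, e₄, Quaternion.inner_def, mk_fst, mk_snd, r1, r2, r3, s1]
  have h2 : f 2 = f' 2 := by
    refine sub_eq_zero.1 (eq_zero_of_inner_eq_zero (w := ![e₁, f 1, (2⁻¹ : ℝ) • (f 2 + f' 2), e₄,
      mk 0 1, mk 0 quatI, mk 0 quatJ, mk 0 quatK]) (fun i => ?_) (fun i => ?_))
    · fin_cases i
      exacts [hself _, hn 1, norm_midpoint_sub_le (hn 2) (hn' 2), hself _, hself _, hself _,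
        hself _, hself _]
    · fin_cases i
      on_goal 3 => exact inner_midpoint_sub (by rw [hf.1, hf'.1])
      on_goal 2 =>
        change inner ℝ (f 1) (f 2 - f' 2) = 0
        rw [inner_sub_right, o 1 2, h1, o' 1 2]
        simp
      all_goals simp [e₁, e₄, Quaternion.inner_def, mk_fst, mk_snd, r4, r5, s2]
  have h3 : f 3 = f' 3 := by
    refine sub_eq_zero.1 (eq_zero_of_inner_eq_zero (w := ![e₁, f 1, f 2, (2⁻¹ : ℝ) • (f 3 + f' 3),
      mk 0 1, mk 0 quatI, mk 0 quatJ, mk 0 quatK]) (fun i => ?_) (fun i => ?_))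
    · fin_cases i
      exacts [hself _, hn 1, hn 2, norm_midpoint_sub_le (hn 3) (hn' 3), hself _, hself _,
        hself _, hself _]
    · fin_cases i
      on_goal 4 => exact inner_midpoint_sub (by rw [hf.1, hf'.1])
      on_goal 3 =>
        change inner ℝ (f 2) (f 3 - f' 3) = 0
        rw [inner_sub_right, o 2 3, h2, o' 2 3]
        simp
      on_goal 2 =>
        change inner ℝ (f 1) (f 3 - f' 3) = 0
        rw [inner_sub_right, o 1 3, h1, o' 1 3]
        simp
      all_goals simp [e₁, Quaternion.inner_def, mk_fst, mk_snd, r6, s3]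
  ext1 i
  fin_cases i
  · change f 0 = f' 0
    rw [hcr, hcr', h1, h2, h3]
  exacts [h1, h2, h3]

theorem cross_smul_stdFrame (g : Spin7) :
    (g • stdFrame) 0 = cross ((g • stdFrame) 1) ((g • stdFrame) 2) ((g • stdFrame) 3) := by
  change g • e₁ = cross (g • e₂) (g • e₃) (g • e₄)
  rw [Spin7.cross_smul, cross_stdFrame]

theorem Spin7.norm_smul_sub_le {g : Spin7} (hg : ‖toCLM g - 1‖ ≤ 1 / 3) {x : Cayley}
    (hx : ‖x‖ = 1) : ‖g • x - x‖ ≤ 1 / 3 := by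
  have h := (toCLM g - 1).le_opNorm x
  rw [hx, mul_one] at h
  exact h.trans hg

/-- Near the identity, `spinCoord` determines an element of `Spin(7)`. -/
theorem spin_eq_of_spinCoord_eq {g h : Spin7} (hgh : spinCoord (Spin7.toCLM g) =
    spinCoord (Spin7.toCLM h)) (hg : ‖Spin7.toCLM g - 1‖ ≤ 1 / 3)
    (hh : ‖Spin7.toCLM h - 1‖ ≤ 1 / 3) : g = h := by
  have hstd : g • stdFrame = h • stdFrame :=
    frame_eq_of_frameCoord_eq (orthonormal_smul_stdFrame g) (orthonormal_smul_stdFrame h)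
      (cross_smul_stdFrame g) (cross_smul_stdFrame h) (congrArg Prod.fst hgh)
      (fun i => Spin7.norm_smul_sub_le hg (orthonormal_stdFrame.1 i))
      (fun i => Spin7.norm_smul_sub_le hh (orthonormal_stdFrame.1 i))
  have hs : ∀ i, g • stdFrame i = h • stdFrame i := congrFun hstd
  have c2 := congrFun (congrArg Prod.snd hgh)
  have r1 : (g • mk 0 1).snd.imI = (h • mk 0 1).snd.imI := c2 0
  have r2 : (g • mk 0 1).snd.imJ = (h • mk 0 1).snd.imJ := c2 1
  have r3 : (g • mk 0 1).snd.imK = (h • mk 0 1).snd.imK := c2 2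
  have hn1 : ‖mk 0 1‖ = 1 := by rw [norm_zero_mk, norm_one]
  have hself : ∀ x : Cayley, ‖x - x‖ ≤ 1 / 3 := fun x => by rw [sub_self, norm_zero]; norm_num
  have horth : ∀ i, inner ℝ (g • stdFrame i) (g • mk 0 1 - h • mk 0 1) = 0 := by
    intro i
    rw [inner_sub_right, Spin7.inner_smul_smul, hs, Spin7.inner_smul_smul, sub_self]
  have he : g • mk 0 1 = h • mk 0 1 := by
    refine sub_eq_zero.1 (eq_zero_of_inner_eq_zero (w := ![g • e₁, g • e₂, g • e₃, g • e₄,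
      (2⁻¹ : ℝ) • (g • mk 0 1 + h • mk 0 1), mk 0 quatI, mk 0 quatJ, mk 0 quatK])
      (fun i => ?_) (fun i => ?_))
    · fin_cases i
      exacts [Spin7.norm_smul_sub_le hg norm_e₁, Spin7.norm_smul_sub_le hg norm_e₂,
        Spin7.norm_smul_sub_le hg norm_e₃, Spin7.norm_smul_sub_le hg norm_e₄,
        norm_midpoint_sub_le (Spin7.norm_smul_sub_le hg hn1) (Spin7.norm_smul_sub_le hh hn1),
        hself _, hself _, hself _]
    · fin_cases i
      on_goal 5 => exact inner_midpoint_sub (by rw [Spin7.norm_smul', Spin7.norm_smul'])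
      on_goal 4 => exact horth 3
      on_goal 3 => exact horth 2
      on_goal 2 => exact horth 1
      on_goal 1 => exact horth 0
      all_goals simp [Quaternion.inner_def, mk_fst, mk_snd, r1, r2, r3]
  have hk : h⁻¹ * g ∈ MulAction.stabilizer Spin7 stdFrame := by
    rw [MulAction.mem_stabilizer_iff, mul_smul, hstd, inv_smul_smul]
  rw [← range_spOneHom] at hk
  obtain ⟨q, hq⟩ := hk
  have hq1 : q = 1 := by
    have e1 := spOneHom_smul q 0 1
    rw [hq, mul_smul, he, inv_smul_smul, mul_one] at e1
    exact Subtype.ext (congrArg WithLp.snd e1).symm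
  rw [hq1, map_one] at hq
  exact (inv_mul_eq_one.1 hq.symm).symm

/-! ### Infinitesimal transitivity -/

/-- The infinitesimal action `x ↦ (x u) v` of the bivector of `u` and `v`. -/
def bivector (u v : Cayley) : Cayley →L[ℝ] Cayley :=
  LinearMap.toContinuousLinearMap (rightMul v ∘ₗ rightMul u)

theorem bivector_apply (u v x : Cayley) : bivector u v x = x * u * v := rfl

/-- The bivectors of orthonormal pairs. -/
def unitBivectors : Set (Cayley →L[ℝ] Cayley) :=
  {B | ∃ u v : Cayley, u ∈ imaginary ∧ v ∈ imaginary ∧ ‖u‖ = 1 ∧ ‖v‖ = 1 ∧ inner ℝ u v = 0 ∧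
    B = bivector u v}

theorem bivector_mem_span {u v : Cayley} (hu : u ∈ imaginary) (hv : v ∈ imaginary)
    (huv : inner ℝ u v = 0) : bivector u v ∈ Submodule.span ℝ unitBivectors := by
  rcases eq_or_ne u 0 with rfl | hu0
  · convert! Submodule.zero_mem _
    ext1 x
    simp [bivector_apply]
  rcases eq_or_ne v 0 with rfl | hv0
  · convert! Submodule.zero_mem _
    ext1 x
    simp [bivector_apply]
  have hu1 := norm_ne_zero_iff.2 hu0
  have hv1 := norm_ne_zero_iff.2 hv0
  have h : bivector u v = (‖u‖ * ‖v‖) • bivector (‖u‖⁻¹ • u) (‖v‖⁻¹ • v) := by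
    ext1 x
    simp only [bivector_apply, _root_.smul_apply, mul_smul_comm, smul_mul_assoc,
      smul_smul]
    rw [show ‖u‖ * ‖v‖ * (‖v‖⁻¹ * ‖u‖⁻¹) = 1 by field_simp, one_smul]
  rw [h]
  refine Submodule.smul_mem _ _ (Submodule.subset_span ⟨_, _, imaginary.smul_mem _ hu,
    imaginary.smul_mem _ hv, ?_, ?_, ?_, rfl⟩)
  · rw [norm_smul, norm_inv, norm_norm, inv_mul_cancel₀ hu1]
  · rw [norm_smul, norm_inv, norm_norm, inv_mul_cancel₀ hv1]
  · rw [inner_smul_left, inner_smul_right, huv, mul_zero, mul_zero]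

/-- A solution `D` of the equations `∑ D_c (a c) = h_a`, both sums over `i, j, k`. -/
theorem quaternion_cross_solution (x y z : ℍ[ℝ]) :
    letI D₁ := (2⁻¹ : ℝ) • (y * quatK - z * quatJ)
    letI D₂ := (2⁻¹ : ℝ) • (z * quatI - x * quatK)
    letI D₃ := (2⁻¹ : ℝ) • (x * quatJ - y * quatI)
    D₁ * (quatI * quatI) + D₂ * (quatI * quatJ) + D₃ * (quatI * quatK) = x ∧
    D₁ * (quatJ * quatI) + D₂ * (quatJ * quatJ) + D₃ * (quatJ * quatK) = y ∧
    D₁ * (quatK * quatI) + D₂ * (quatK * quatJ) + D₃ * (quatK * quatK) = z := by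
  refine ⟨?_, ?_, ?_⟩ <;> ext <;> simp <;> ring

set_option maxHeartbeats 1000000 in
/-- The coordinates of the ten bivectors used span: a combination of them maps `(a, b)` to
`(a p, b p) + (-d a, d b) + (q a, q b)` plus a part that exchanges `ℍ` and `ℍ e`, and the
coordinates of this determine `p`, `q - d`, `q + d` and the latter part. -/
theorem span_spinCoord_unitBivectors :
    Submodule.span ℝ (spinCoord '' unitBivectors) = ⊤ := by
  rw [Submodule.span_image, eq_top_iff]
  rintro ⟨⟨y, h⟩, s⟩ -
  have hI := mk_zero_mem_imaginary quatI_re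
  have hJ := mk_zero_mem_imaginary quatJ_re
  have hK := mk_zero_mem_imaginary quatK_re
  have h0 := zero_mk_mem_imaginary
  let p₁ := (-y 0 - y 4) / 2
  let p₂ := (y 2 - y 3) / 2
  let p₃ := (-y 5 - y 1) / 2
  let m₁ := (y 4 - y 0) / 2
  let m₂ := (-y 3 - y 2) / 2
  let m₃ := (y 1 - y 5) / 2
  let n₁ := s 0 - p₁
  let n₂ := s 1 - p₂
  let n₃ := s 2 - p₃
  obtain ⟨d, d₀, d₁, d₂, d₃⟩ : ∃ d : ℍ[ℝ], d.re = 0 ∧ d.imI = (n₁ - m₁) / 2 ∧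
    d.imJ = (n₂ - m₂) / 2 ∧ d.imK = (n₃ - m₃) / 2 := ⟨⟨_, _, _, _⟩, rfl, rfl, rfl, rfl⟩
  obtain ⟨D₁, hD₁⟩ : ∃ D : ℍ[ℝ], D = (2⁻¹ : ℝ) • (h 1 * quatK - h 2 * quatJ) := ⟨_, rfl⟩
  obtain ⟨D₂, hD₂⟩ : ∃ D : ℍ[ℝ], D = (2⁻¹ : ℝ) • (h 2 * quatI - h 0 * quatK) := ⟨_, rfl⟩
  obtain ⟨D₃, hD₃⟩ : ∃ D : ℍ[ℝ], D = (2⁻¹ : ℝ) • (h 0 * quatJ - h 1 * quatI) := ⟨_, rfl⟩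
  refine ⟨p₁ • bivector (mk quatJ 0) (mk quatK 0) + p₂ • bivector (mk quatK 0) (mk quatI 0) +
    p₃ • bivector (mk quatI 0) (mk quatJ 0) + bivector (mk 0 d) (mk 0 1) +
    ((n₁ + m₁) / 2) • bivector (mk 0 quatK) (mk 0 quatJ) +
    ((n₂ + m₂) / 2) • bivector (mk 0 quatI) (mk 0 quatK) +
    ((n₃ + m₃) / 2) • bivector (mk 0 quatJ) (mk 0 quatI) +
    bivector (mk quatI 0) (mk 0 D₁) + bivector (mk quatJ 0) (mk 0 D₂) +
    bivector (mk quatK 0) (mk 0 D₃), ?_, ?_⟩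
  · refine add_mem (add_mem (add_mem (add_mem (add_mem (add_mem (add_mem (add_mem (add_mem
      (Submodule.smul_mem _ _ (bivector_mem_span hJ hK ?_))
      (Submodule.smul_mem _ _ (bivector_mem_span hK hI ?_)))
      (Submodule.smul_mem _ _ (bivector_mem_span hI hJ ?_)))
      (bivector_mem_span (h0 _) (h0 _) ?_))
      (Submodule.smul_mem _ _ (bivector_mem_span (h0 _) (h0 _) ?_)))
      (Submodule.smul_mem _ _ (bivector_mem_span (h0 _) (h0 _) ?_)))
      (Submodule.smul_mem _ _ (bivector_mem_span (h0 _) (h0 _) ?_)))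
      (bivector_mem_span hI (h0 _) ?_))
      (bivector_mem_span hJ (h0 _) ?_))
      (bivector_mem_span hK (h0 _) ?_)
    all_goals simp [Quaternion.inner_def, mk_fst, mk_snd, d₀]
  · refine Prod.ext (Prod.ext ?_ ?_) ?_
    · ext1 i
      fin_cases i <;>
      simp [spinCoord, frameCoord, evalStd, stdFrame, e₁, e₂, e₃, e₄, bivector_apply,
        mk_mul_mk_zero, mk_mul_zero_mk, mk_fst, mk_snd, d₀, d₁, d₂, d₃, p₁, p₂, p₃, m₁, m₂, m₃, n₁, n₂, n₃] <;>
      ring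
    · have key := quaternion_cross_solution (h 0) (h 1) (h 2)
      rw [← hD₁, ← hD₂, ← hD₃] at key
      ext1 i
      fin_cases i
      · refine Eq.trans ?_ key.1
        simp [spinCoord, frameCoord, evalStd, stdFrame, e₂, bivector_apply,
          mk_mul_mk_zero, mk_mul_zero_mk, mk_snd]
      · refine Eq.trans ?_ key.2.1
        simp [spinCoord, frameCoord, evalStd, stdFrame, e₃, bivector_apply,
          mk_mul_mk_zero, mk_mul_zero_mk, mk_snd]
      · refine Eq.trans ?_ key.2.2
        simp [spinCoord, frameCoord, evalStd, stdFrame, e₄, bivector_apply,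
          mk_mul_mk_zero, mk_mul_zero_mk, mk_snd]
    · ext1 i
      fin_cases i <;>
      simp [spinCoord, bivector_apply,
        mk_mul_mk_zero, mk_mul_zero_mk, mk_snd, d₁, d₂, d₃, p₁, p₂, p₃, m₁, m₂, m₃, n₁, n₂, n₃] <;>
      ring

/-! ### Charts at the base points -/

instance : NormedRing (Cayley →L[ℝ] Cayley) := inferInstance

instance : NormedAlgebra ℝ (Cayley →L[ℝ] Cayley) := inferInstance

instance : NormedSpace ℝ (Cayley →L[ℝ] Cayley) := inferInstance

instance : Module ℝ (Cayley →L[ℝ] Cayley) := inferInstance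

instance : IsTopologicalAddGroup (Cayley →L[ℝ] Cayley) := inferInstance

theorem Spin7.exists_toCLM_eq_rotation {B : Cayley →L[ℝ] Cayley} (hB : B ∈ unitBivectors) (θ : ℝ) :
    ∃ g : Spin7, toCLM g = Real.cos θ • 1 + Real.sin θ • B := by
  obtain ⟨u, v, hu, hv, hu1, hv1, huv, rfl⟩ := hB
  have hw : -(Real.cos θ • u) + Real.sin θ • v ∈ imaginary :=
    add_mem (neg_mem (imaginary.smul_mem _ hu)) (imaginary.smul_mem _ hv)
  have hw1 : ‖-(Real.cos θ • u) + Real.sin θ • v‖ = 1 := by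
    rw [← sq_eq_sq₀ (norm_nonneg _) zero_le_one, norm_add_sq_real, norm_neg, norm_smul, norm_smul,
      inner_neg_left, inner_smul_left, inner_smul_right, huv, hu1, hv1]
    simp
  refine ⟨pair hu hw hu1 hw1, ?_⟩
  ext1 x
  have hsq : x * u * u = -x := by
    have h := mul_self_right ⟨u, hu⟩ x
    rw [imForm_apply] at h
    simpa [hu1] using h
  change pair hu hw hu1 hw1 • x = Real.cos θ • x + Real.sin θ • (x * u * v)
  rw [pair_smul, mul_add, mul_neg, mul_smul_comm, mul_smul_comm, hsq, smul_neg, neg_neg]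

/-- The product rule at a point where all the factors are `1`. -/
theorem hasFDerivAt_list_prod_of_eq_one {ι P A : Type*} [NormedAddCommGroup P] [NormedSpace ℝ P]
    [NormedRing A] [NormedAlgebra ℝ A] {G : ι → P → A} {D : ι → P →L[ℝ] A}
    (h1 : ∀ i, G i 0 = 1) (hD : ∀ i, HasFDerivAt (G i) (D i) 0) (l : List ι) :
    (l.map fun i => G i 0).prod = 1 ∧
      HasFDerivAt (fun p => (l.map fun i => G i p).prod) (l.map D).sum 0 := by
  induction l with
  | nil => exact ⟨rfl, hasFDerivAt_const (1 : A) (0 : P)⟩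
  | cons i l ih =>
    refine ⟨by rw [List.map_cons, List.prod_cons, h1, ih.1, mul_one], ?_⟩
    have h := (hD i).mul' ih.2
    simp only [h1] at h
    convert! h using 1
    ext p
    simp [add_comm]

theorem contDiff_list_prod {ι P A : Type*} [NormedAddCommGroup P] [NormedSpace ℝ P]
    [NormedRing A] [NormedAlgebra ℝ A] {G : ι → P → A} (h : ∀ i, ContDiff ℝ ∞ (G i))
    (l : List ι) : ContDiff ℝ ∞ (fun p => (l.map fun i => G i p).prod) := by
  induction l with
  | nil => exact contDiff_const
  | cons i l ih => exact (h i).mul ih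

theorem hasFDerivAt_rotation {ι A : Type*} [Fintype ι] [NormedRing A] [NormedAlgebra ℝ A] (i : ι)
    (B : A) : HasFDerivAt (fun p : ι → ℝ => Real.cos (p i) • (1 : A) + Real.sin (p i) • B)
      ((ContinuousLinearMap.proj (R := ℝ) (φ := fun _ => ℝ) i).smulRight B) 0 := by
  have hp : HasFDerivAt (fun p : ι → ℝ => p i) (ContinuousLinearMap.proj (R := ℝ) i)
    (0 : ι → ℝ) := hasFDerivAt_apply i 0
  convert! (hp.cos.smul_const (1 : A)).add (hp.sin.smul_const B) using 1
  ext p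
  simp

theorem contDiff_rotation {ι A : Type*} [Fintype ι] [NormedRing A] [NormedAlgebra ℝ A] (i : ι)
    (B : A) : ContDiff ℝ ∞ (fun p : ι → ℝ => Real.cos (p i) • (1 : A) + Real.sin (p i) • B) := by
  fun_prop

/-- A product of rotations, with derivative spanning the coordinates. -/
theorem Spin7.exists_parametrization : ∃ (n : Type) (_ : Fintype n) (σ : (n → ℝ) → Spin7)
    (D : (n → ℝ) →L[ℝ] (Cayley →L[ℝ] Cayley)), σ 0 = 1 ∧
    ContDiff ℝ ∞ (fun p => toCLM (σ p)) ∧ HasFDerivAt (fun p => toCLM (σ p)) D 0 ∧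
    Function.Surjective (fun p => spinCoord (D p)) := by
  obtain ⟨t, ht, hspan⟩ := (Submodule.fg_span_iff_fg_span_finset_subset (R := ℝ) unitBivectors).1
    (IsNoetherian.noetherian _)
  choose g hg using fun (i : t) (θ : ℝ) => exists_toCLM_eq_rotation (ht i.2) θ
  let D : t → (t → ℝ) →L[ℝ] (Cayley →L[ℝ] Cayley) := fun i =>
    (ContinuousLinearMap.proj i).smulRight (i : Cayley →L[ℝ] Cayley)
  have hG : ∀ i : t, (fun p : t → ℝ => toCLM (g i (p i))) =
      fun p => Real.cos (p i) • 1 + Real.sin (p i) • (i : Cayley →L[ℝ] Cayley) :=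
    fun i => funext fun p => hg i (p i)
  have h1 : ∀ i, toCLM (g i ((0 : t → ℝ) i)) = 1 := by
    intro i
    rw [hg]
    simp
  have hD : ∀ i : t, HasFDerivAt (fun p : t → ℝ => toCLM (g i (p i))) (D i) 0 := by
    intro i
    rw [hG]
    exact hasFDerivAt_rotation i _
  have hs : ∀ i : t, ContDiff ℝ ∞ (fun p : t → ℝ => toCLM (g i (p i))) := by
    intro i
    rw [hG]
    exact contDiff_rotation i _
  let l : List t := Finset.univ.toList
  have hσ : ∀ p : t → ℝ, toCLM ((l.map fun i => g i (p i)).prod) =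
      (l.map fun i => toCLM (g i (p i))).prod := by
    intro p
    rw [map_list_prod, List.map_map]
    rfl
  have hder := hasFDerivAt_list_prod_of_eq_one (G := fun i (p : t → ℝ) => toCLM (g i (p i)))
    h1 hD l
  refine ⟨t, inferInstance, fun p => (l.map fun i => g i (p i)).prod, (l.map D).sum, ?_, ?_, ?_, ?_⟩
  · apply toCLM_injective
    rw [hσ, map_one]
    exact hder.1
  · simp only [hσ]
    exact contDiff_list_prod hs l
  · simp only [hσ]
    exact hder.2
  · intro y
    have hy : y ∈ Submodule.span ℝ (spinCoord '' unitBivectors) := by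
      rw [span_spinCoord_unitBivectors]
      trivial
    rw [Submodule.span_image, hspan] at hy
    obtain ⟨T, hT, rfl⟩ := hy
    have ht' : (t : Set (Cayley →L[ℝ] Cayley)) = range ((↑) : t → Cayley →L[ℝ] Cayley) :=
      Subtype.range_coe.symm
    rw [ht'] at hT
    obtain ⟨p, rfl⟩ := (Submodule.mem_span_range_iff_exists_fun ℝ).1 hT
    refine ⟨p, congrArg spinCoord ?_⟩
    rw [Finset.sum_map_toList, _root_.sum_apply]
    rfl

/-- `evalStd`, as a continuous linear map. -/
def evalStdL : (Cayley →L[ℝ] Cayley) →L[ℝ] (Fin 4 → Cayley) :=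
  LinearMap.toContinuousLinearMap evalStd

/-- `FrameCoord` has dimension `18`. -/
def frameEquiv : FrameCoord ≃L[ℝ] EuclideanSpace ℝ (Fin 18) :=
  ContinuousLinearEquiv.ofFinrankEq (by
    simp [Module.finrank_prod, Module.finrank_pi_fintype, Quaternion.finrank_eq_four])

/-- `SpinCoord` has dimension `21`. -/
def spinEquiv : SpinCoord ≃L[ℝ] EuclideanSpace ℝ (Fin 21) :=
  ContinuousLinearEquiv.ofFinrankEq (by
    simp [Module.finrank_prod, Module.finrank_pi_fintype, Quaternion.finrank_eq_four])

/-- The linear map restricting to the chart of `V` at the standard frame. -/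
def frameChartL : (Fin 4 → Cayley) →L[ℝ] EuclideanSpace ℝ (Fin 18) :=
  frameEquiv.toContinuousLinearMap ∘L LinearMap.toContinuousLinearMap frameCoord

/-- The linear map restricting to the chart of `Spin(7)` at the identity. -/
def spinChartL : (Cayley →L[ℝ] Cayley) →L[ℝ] EuclideanSpace ℝ (Fin 21) :=
  spinEquiv.toContinuousLinearMap ∘L LinearMap.toContinuousLinearMap spinCoord

/-- The standard frame, moved by an element of `Spin(7)`, as a point of `V`. -/
def stdOrbit (g : Spin7) : CayleyStiefel := ⟨g • stdFrame, isCayleyFrame_smul_stdFrame g⟩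

theorem spinCoord_surjective : Function.Surjective spinCoord := by
  obtain ⟨_, _, _, D, _, _, _, h⟩ := Spin7.exists_parametrization
  exact fun y => (h y).imp' D fun p hp => hp

theorem frameCoord_surjective : Function.Surjective frameCoord := fun y =>
  (spinCoord_surjective (y, 0)).imp' evalStd fun _ hT => congrArg Prod.fst hT

theorem Spin7.exists_chart_one : ∃ c : OpenPartialHomeomorph Spin7 (EuclideanSpace ℝ (Fin 21)),
    1 ∈ c.source ∧ (∀ x ∈ c.source, c x = spinChartL (toCLM x)) ∧
      ContDiffOn ℝ ∞ (fun y => toCLM (c.symm y)) c.target := by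
  obtain ⟨n, _, σ, D, h1, hσ, hD, hsurj⟩ := exists_parametrization
  have h := exists_chart_of_parametrization isEmbedding_toCLM.isInducing hσ spinChartL hD
    (spinEquiv.surjective.comp hsurj) (N := {g | ‖toCLM g - 1‖ ≤ 1 / 3}) ?_ ?_
  · rwa [h1] at h
  · rw [h1]
    have hc : Continuous (fun g : Spin7 => ‖toCLM g - 1‖) :=
      (isEmbedding_toCLM.continuous.sub continuous_const).norm
    refine Filter.mem_of_superset ((isOpen_Iio (a := (1 / 3 : ℝ))).preimage hc |>.mem_nhds ?_) ?_
    · simp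
    · intro g hg
      exact (show ‖toCLM g - 1‖ < 1 / 3 from hg).le
  · intro g hg g' hg' hgg
    exact spin_eq_of_spinCoord_eq (spinEquiv.injective hgg) hg hg'

theorem exists_chart_stdFrame :
    ∃ c : OpenPartialHomeomorph CayleyStiefel (EuclideanSpace ℝ (Fin 18)),
      stdOrbit 1 ∈ c.source ∧ (∀ x ∈ c.source, c x = frameChartL x) ∧
      ContDiffOn ℝ ∞ (fun y => (c.symm y : Fin 4 → Cayley)) c.target := by
  obtain ⟨n, _, σ, D, h1, hσ, hD, hsurj⟩ := Spin7.exists_parametrization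
  have hσ' : ContDiff ℝ ∞ (fun p => (stdOrbit (σ p) : Fin 4 → Cayley)) :=
    evalStdL.contDiff.comp hσ
  have hD' : HasFDerivAt (fun p => (stdOrbit (σ p) : Fin 4 → Cayley)) (evalStdL ∘L D) 0 :=
    evalStdL.hasFDerivAt.comp (0 : n → ℝ) hD
  have h := exists_chart_of_parametrization (j := ((↑) : CayleyStiefel → Fin 4 → Cayley))
    IsInducing.subtypeVal hσ' frameChartL hD' ?_
    (N := {f | ∀ i, ‖(f : Fin 4 → Cayley) i - stdFrame i‖ ≤ 1 / 3}) ?_ ?_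
  · rwa [h1] at h
  · intro y
    obtain ⟨p, hp⟩ := hsurj (frameEquiv.symm y, 0)
    refine ⟨p, ?_⟩
    have hp1 : frameCoord (evalStd (D p)) = frameEquiv.symm y := congrArg Prod.fst hp
    change frameEquiv (frameCoord (evalStd (D p))) = y
    rw [hp1, ContinuousLinearEquiv.apply_symm_apply]
  · rw [h1]
    have hc : Continuous (fun f : CayleyStiefel => fun i => ‖(f : Fin 4 → Cayley) i - stdFrame i‖) :=
      continuous_pi fun i => (((continuous_apply i).comp continuous_subtype_val).sub
        continuous_const).norm
    have ho : IsOpen {w : Fin 4 → ℝ | ∀ i, w i < 1 / 3} := by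
      simp only [ofPred_forall]
      exact isOpen_iInter_of_finite fun i => isOpen_Iio.preimage (continuous_apply i)
    refine Filter.mem_of_superset ((ho.preimage hc).mem_nhds ?_) ?_
    · intro i
      simp [stdOrbit]
    · intro f hf i
      exact le_of_lt (hf i)
  · intro f hf f' hf' hff
    obtain ⟨g, hg⟩ := isCayleyFrame_iff.1 f.2
    obtain ⟨g', hg'⟩ := isCayleyFrame_iff.1 f'.2
    refine Subtype.ext (frame_eq_of_frameCoord_eq f.2.1 f'.2.1 ?_ ?_ (frameEquiv.injective hff)
      hf hf')
    · rw [← hg]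
      exact cross_smul_stdFrame g
    · rw [← hg']
      exact cross_smul_stdFrame g'

/-! ### The manifolds `Spin(7)` and `V` -/

namespace LinearAtlas

variable {X E F ι : Type*} [TopologicalSpace X] [NormedAddCommGroup E]
    [NormedSpace ℝ E] [NormedAddCommGroup F] [NormedSpace ℝ F] {j : X → E}

/-- The presentation obtained from a homeomorphism. -/
def compHomeomorph (A : LinearAtlas (F := F) j ι) {Y : Type*} [TopologicalSpace Y] (e : Y ≃ₜ X) :
    LinearAtlas (F := F) (fun y => j (e y)) ι where
  chart i := e.toOpenPartialHomeomorph.trans (A.chart i)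
  coord := A.coord
  pick y := A.pick (e y)
  mem_pick y := by simpa using A.mem_pick (e y)
  chart_eq i y hy := by
    refine A.chart_eq i (e y) ?_
    simpa using hy
  contDiffOn_symm i := by
    refine ((A.contDiffOn_symm i).mono (s := (A.chart i).target) ?_).congr ?_
    · intro y hy
      simpa using hy
    · intro y _
      simp
  coord_surjective := A.coord_surjective
  isEmbedding := A.isEmbedding.comp e.isEmbedding

/-- If a group acts linearly on `E`, compatibly with homeomorphisms of `X` that move a point `x₀`
to every other one, then a chart at `x₀` gives a presentation of `X`. -/
def ofChart {x₀ : X} (hj : IsEmbedding j) {R : E →L[ℝ] F} (hR : Function.Surjective R)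
    {c : OpenPartialHomeomorph X F} (hx₀ : x₀ ∈ c.source) (hc : ∀ x ∈ c.source, c x = R (j x))
    (hc' : ContDiffOn ℝ ∞ (fun y => j (c.symm y)) c.target)
    (e : ι → X ≃ₜ X) (T : ι → E ≃L[ℝ] E) (hT : ∀ i x, j (e i x) = T i (j x)) (pick : X → ι)
    (hpick : ∀ x, e (pick x) x = x₀) : LinearAtlas (F := F) j ι where
  chart i := (e i).toOpenPartialHomeomorph.trans c
  coord i := R ∘L (T i).toContinuousLinearMap
  pick := pick
  mem_pick x := by simpa [hpick] using hx₀
  chart_eq i x hx := by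
    have hx' : e i x ∈ c.source := by simpa using hx
    change c (e i x) = R (T i (j x))
    rw [hc _ hx', hT]
  contDiffOn_symm i := by
    have h : ContDiffOn ℝ ∞ (fun y => (T i).symm (j (c.symm y))) c.target :=
      (T i).symm.contDiff.comp_contDiffOn hc'
    refine (h.mono (s := c.target) fun y hy => by simpa using hy).congr fun y _ => ?_
    change j ((e i).symm (c.symm y)) = _
    rw [ContinuousLinearEquiv.eq_symm_apply, ← hT, Homeomorph.apply_symm_apply]
  coord_surjective i := hR.comp (T i).surjective
  isEmbedding := hj

end LinearAtlas

namespace Spin7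

/-- Translation by `g⁻¹` on the left and by `h` on the right. -/
def translate (p : Spin7 × Spin7) : Spin7 ≃ₜ Spin7 where
  toFun x := p.1⁻¹ * x * p.2
  invFun x := p.1 * x * p.2⁻¹
  left_inv x := by group
  right_inv x := by group
  continuous_toFun := by
    refine isEmbedding_toCLM.continuous_iff.2 ?_
    have h : toCLM ∘ (fun x : Spin7 => p.1⁻¹ * x * p.2) =
        fun x => toCLM p.1⁻¹ * toCLM x * toCLM p.2 := by
      ext1 x
      simp only [Function.comp_apply, map_mul]
    rw [h]
    exact (continuous_const.mul isEmbedding_toCLM.continuous).mul continuous_const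
  continuous_invFun := by
    refine isEmbedding_toCLM.continuous_iff.2 ?_
    have h : toCLM ∘ (fun x : Spin7 => p.1 * x * p.2⁻¹) =
        fun x => toCLM p.1 * toCLM x * toCLM p.2⁻¹ := by
      ext1 x
      simp only [Function.comp_apply, map_mul]
    rw [h]
    exact (continuous_const.mul isEmbedding_toCLM.continuous).mul continuous_const

theorem toCLM_mul_inv (g : Spin7) : toCLM g * toCLM g⁻¹ = 1 := by
  rw [← map_mul, mul_inv_cancel, map_one]

theorem toCLM_inv_mul (g : Spin7) : toCLM g⁻¹ * toCLM g = 1 := by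
  rw [← map_mul, inv_mul_cancel, map_one]

/-- The linear extension of `translate` to the endomorphisms of `ℝ⁸`. -/
def translateL (p : Spin7 × Spin7) : (Cayley →L[ℝ] Cayley) ≃L[ℝ] (Cayley →L[ℝ] Cayley) :=
  LinearEquiv.toContinuousLinearEquiv
    { toFun T := toCLM p.1⁻¹ * T * toCLM p.2
      invFun T := toCLM p.1 * T * toCLM p.2⁻¹
      map_add' S T := by rw [mul_add, add_mul]
      map_smul' c T := by rw [mul_smul_comm, smul_mul_assoc, RingHom.id_apply]
      left_inv T := by
        calc toCLM p.1 * (toCLM p.1⁻¹ * T * toCLM p.2) * toCLM p.2⁻¹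
            = (toCLM p.1 * toCLM p.1⁻¹) * T * (toCLM p.2 * toCLM p.2⁻¹) := by
              simp only [mul_assoc]
          _ = T := by rw [toCLM_mul_inv, toCLM_mul_inv, one_mul, mul_one]
      right_inv T := by
        calc toCLM p.1⁻¹ * (toCLM p.1 * T * toCLM p.2⁻¹) * toCLM p.2
            = (toCLM p.1⁻¹ * toCLM p.1) * T * (toCLM p.2⁻¹ * toCLM p.2) := by
              simp only [mul_assoc]
          _ = T := by rw [toCLM_inv_mul, toCLM_inv_mul, one_mul, mul_one] }

theorem toCLM_translate (p : Spin7 × Spin7) (x : Spin7) :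
    toCLM (translate p x) = translateL p (toCLM x) := by
  change toCLM (p.1⁻¹ * x * p.2) = toCLM p.1⁻¹ * toCLM x * toCLM p.2
  rw [map_mul, map_mul]

/-- A chart at the identity. -/
def chartOne : OpenPartialHomeomorph Spin7 (EuclideanSpace ℝ (Fin 21)) :=
  exists_chart_one.choose

/-- The presentation of `Spin(7)` as a submanifold of the endomorphisms of `ℝ⁸`. -/
def atlas : LinearAtlas (F := EuclideanSpace ℝ (Fin 21)) toCLM (Spin7 × Spin7) :=
  LinearAtlas.ofChart (c := chartOne) isEmbedding_toCLM (R := spinChartL)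
    (spinEquiv.surjective.comp spinCoord_surjective) exists_chart_one.choose_spec.1
    exists_chart_one.choose_spec.2.1 exists_chart_one.choose_spec.2.2 translate translateL
    toCLM_translate (fun x => (x, 1)) (fun x => by simp [translate])

theorem mem_atlas_chart_source (p : Spin7 × Spin7) (x : Spin7) :
    x ∈ (atlas.chart p).source ↔ p.1⁻¹ * x * p.2 ∈ chartOne.source := by
  change x ∈ ((translate p).toOpenPartialHomeomorph.trans chartOne).source ↔ _
  simp [translate]

theorem one_mem_chartOne_source : 1 ∈ chartOne.source := exists_chart_one.choose_spec.1

theorem atlas_chart_apply {p : Spin7 × Spin7} {x : Spin7} (hx : x ∈ (atlas.chart p).source) :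
    atlas.chart p x = spinEquiv (spinCoord (toCLM (p.1⁻¹ * x * p.2))) := by
  rw [atlas.chart_eq p x hx]
  change spinChartL (translateL p (toCLM x)) = _
  rw [← toCLM_translate]
  rfl

end Spin7

/-- `Spin(7)` acts on `V` by homeomorphisms; this is the action of `g⁻¹`. -/
def frameTranslate (g : Spin7) : CayleyStiefel ≃ₜ CayleyStiefel :=
  have h : ∀ (g : Spin7) (f : CayleyStiefel), IsCayleyFrame (g • (f : Fin 4 → Cayley)) := by
    intro g f
    obtain ⟨g', hg'⟩ := isCayleyFrame_iff.1 f.2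
    exact isCayleyFrame_iff.2 ⟨g * g', by rw [mul_smul, hg']⟩
  have hc : ∀ g : Spin7, Continuous (fun f : CayleyStiefel => g • (f : Fin 4 → Cayley)) :=
    fun g => continuous_pi fun i => (Spin7.toCLM g).continuous.comp
      ((continuous_apply i).comp continuous_subtype_val)
  { toFun f := ⟨g⁻¹ • (f : Fin 4 → Cayley), h _ f⟩
    invFun f := ⟨g • (f : Fin 4 → Cayley), h _ f⟩
    left_inv f := Subtype.ext (smul_inv_smul g _)
    right_inv f := Subtype.ext (inv_smul_smul g _)
    continuous_toFun := (hc _).subtype_mk _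
    continuous_invFun := (hc _).subtype_mk _ }

/-- The linear extension of `frameTranslate`. -/
def frameTranslateL (g : Spin7) : (Fin 4 → Cayley) ≃L[ℝ] (Fin 4 → Cayley) :=
  LinearEquiv.toContinuousLinearEquiv
    { toFun f := g⁻¹ • f
      invFun f := g • f
      map_add' _ _ := funext fun _ => Spin7.smul_add' _ _ _
      map_smul' _ _ := funext fun _ => Spin7.smul_smul' _ _ _
      left_inv f := smul_inv_smul g f
      right_inv f := inv_smul_smul g f }

/-- A chart at the standard frame. -/
def chartStd : OpenPartialHomeomorph CayleyStiefel (EuclideanSpace ℝ (Fin 18)) :=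
  exists_chart_stdFrame.choose

/-- The presentation of `V` as a submanifold of `(ℝ⁸)⁴`. -/
def frameAtlas : LinearAtlas (F := EuclideanSpace ℝ (Fin 18))
    ((↑) : CayleyStiefel → Fin 4 → Cayley) Spin7 :=
  LinearAtlas.ofChart (c := chartStd) IsEmbedding.subtypeVal (R := frameChartL)
    (frameEquiv.surjective.comp frameCoord_surjective) exists_chart_stdFrame.choose_spec.1
    exists_chart_stdFrame.choose_spec.2.1 exists_chart_stdFrame.choose_spec.2.2
    frameTranslate frameTranslateL (fun _ _ => rfl) (fun f => (isCayleyFrame_iff.1 f.2).choose)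
    (fun f => Subtype.ext (by
      change (isCayleyFrame_iff.1 f.2).choose⁻¹ • (f : Fin 4 → Cayley) = (1 : Spin7) • stdFrame
      rw [one_smul, inv_smul_eq_iff]
      exact (isCayleyFrame_iff.1 f.2).choose_spec.symm))

theorem stdOrbit_mem_frameAtlas_chart_source (g : Spin7) :
    stdOrbit g ∈ (frameAtlas.chart g).source := by
  change stdOrbit g ∈ ((frameTranslate g).toOpenPartialHomeomorph.trans chartStd).source
  have h : frameTranslate g (stdOrbit g) = stdOrbit 1 := by
    refine Subtype.ext ?_
    change g⁻¹ • (g • stdFrame) = (1 : Spin7) • stdFrame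
    rw [inv_smul_smul, one_smul]
  have h1 : stdOrbit 1 ∈ chartStd.source := exists_chart_stdFrame.choose_spec.1
  simpa [h] using h1

theorem frameAtlas_chart_apply {g : Spin7} {f : CayleyStiefel}
    (hf : f ∈ (frameAtlas.chart g).source) :
    frameAtlas.chart g f = frameEquiv (frameCoord (g⁻¹ • (f : Fin 4 → Cayley))) :=
  frameAtlas.chart_eq g f hf

namespace Spin7

instance : ChartedSpace (EuclideanSpace ℝ (Fin 21)) Spin7 := atlas.chartedSpace

theorem contMDiff_toCLM : ContMDiff (𝓡 21) 𝓘(ℝ, Cayley →L[ℝ] Cayley) ∞ toCLM :=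
  atlas.contMDiff_incl

theorem toCLM_inv (g : Spin7) : toCLM g⁻¹ = Ring.inverse (toCLM g) := by
  let u : (Cayley →L[ℝ] Cayley)ˣ := ⟨toCLM g, toCLM g⁻¹, toCLM_mul_inv g, toCLM_inv_mul g⟩
  exact (Ring.inverse_unit u).symm

instance lieGroup : LieGroup (𝓡 21) ∞ Spin7 where
  toIsManifold := atlas.isManifold
  contMDiff_mul := by
    refine atlas.contMDiff_of_incl ?_
    simp only [map_mul]
    have h1 : ContMDiff ((𝓡 21).prod (𝓡 21)) 𝓘(ℝ, Cayley →L[ℝ] Cayley) ∞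
        (fun p : Spin7 × Spin7 => toCLM p.1) := contMDiff_toCLM.comp contMDiff_fst
    have h2 : ContMDiff ((𝓡 21).prod (𝓡 21)) 𝓘(ℝ, Cayley →L[ℝ] Cayley) ∞
        (fun p : Spin7 × Spin7 => toCLM p.2) := contMDiff_toCLM.comp contMDiff_snd
    exact h1.clm_comp h2
  contMDiff_inv := by
    refine atlas.contMDiff_of_incl ?_
    simp only [toCLM_inv]
    intro g
    let u : (Cayley →L[ℝ] Cayley)ˣ := ⟨toCLM g, toCLM g⁻¹, toCLM_mul_inv g, toCLM_inv_mul g⟩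
    exact (contDiffAt_ringInverse ℝ u).contMDiffAt.comp g (contMDiff_toCLM g)

theorem contMDiff_smul : ContMDiff ((𝓡 21).prod 𝓘(ℝ, Cayley)) 𝓘(ℝ, Cayley) ∞
    (fun p : Spin7 × Cayley => p.1 • p.2) := by
  have h1 : ContMDiff ((𝓡 21).prod 𝓘(ℝ, Cayley)) 𝓘(ℝ, Cayley →L[ℝ] Cayley) ∞
      (fun p : Spin7 × Cayley => toCLM p.1) := contMDiff_toCLM.comp contMDiff_fst
  exact h1.clm_apply contMDiff_snd

end Spin7

instance : ChartedSpace (EuclideanSpace ℝ (Fin 18)) CayleyStiefel := frameAtlas.chartedSpace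

/-! ### `Sp(1)` as a Lie subgroup -/

section

variable {E E' K M N : Type*} [NormedAddCommGroup E] [NormedSpace ℝ E] [NormedAddCommGroup E']
  [NormedSpace ℝ E'] [NormedAddCommGroup K] [NormedSpace ℝ K] [TopologicalSpace M]
  [ChartedSpace E M] [TopologicalSpace N] [ChartedSpace E' N] {f : M → N}
  {c : OpenPartialHomeomorph M E} {c' : OpenPartialHomeomorph N E'} {x : M}

/-- A map that is linear and injective in some charts is an immersion. -/
theorem isImmersionAtOfComplement_of_charts (hf : Continuous f) (e : (E × K) ≃L[ℝ] E')
    (hc : c ∈ IsManifold.maximalAtlas 𝓘(ℝ, E) ∞ M) (hc' : c' ∈ IsManifold.maximalAtlas 𝓘(ℝ, E') ∞ N)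
    (hx : x ∈ c.source) (hfx : f x ∈ c'.source)
    (h : ∀ y ∈ c.source, f y ∈ c'.source → c' (f y) = e (c y, 0)) :
    Manifold.IsImmersionAtOfComplement K 𝓘(ℝ, E) 𝓘(ℝ, E') ∞ f x := by
  -- shrink the domain of `c`, so that its image is in the domain of `c'`
  have ho : IsOpen (f ⁻¹' c'.source) := c'.open_source.preimage hf
  have hs : (c.restr (f ⁻¹' c'.source)).source = c.source ∩ f ⁻¹' c'.source := c.restr_source' _ ho
  refine Manifold.IsImmersionAtOfComplement.mk_of_charts e (c.restr (f ⁻¹' c'.source)) c'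
    (by rw [hs]; exact ⟨hx, hfx⟩) hfx (restr_mem_maximalAtlas _ hc ho) hc'
    (by rw [hs]; exact inter_subset_right) ?_
  intro v hv
  have hv' : v ∈ (c.restr (f ⁻¹' c'.source)).target := by simpa using hv
  have hy := (c.restr (f ⁻¹' c'.source)).map_target hv'
  rw [hs] at hy
  have h1 := h _ hy.1 hy.2
  change c' (f (c.symm v)) = e (v, 0)
  refine h1.trans ?_
  have h2 : c (c.symm v) = v := (c.restr (f ⁻¹' c'.source)).right_inv hv'
  exact congrArg (fun w => e (w, 0)) h2

/-- A map that is linear and surjective in some charts is a submersion. -/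
theorem isSubmersionAtOfComplement_of_charts (hf : Continuous f) (e : E ≃L[ℝ] (E' × K))
    (hc : c ∈ IsManifold.maximalAtlas 𝓘(ℝ, E) ∞ M) (hc' : c' ∈ IsManifold.maximalAtlas 𝓘(ℝ, E') ∞ N)
    (hx : x ∈ c.source) (hfx : f x ∈ c'.source)
    (h : ∀ y ∈ c.source, f y ∈ c'.source → c' (f y) = (e (c y)).1) :
    Manifold.IsSubmersionAtOfComplement K 𝓘(ℝ, E) 𝓘(ℝ, E') ∞ f x := by
  -- shrink the domain of `c`, so that its image is in the domain of `c'`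
  have ho : IsOpen (f ⁻¹' c'.source) := c'.open_source.preimage hf
  have hs : (c.restr (f ⁻¹' c'.source)).source = c.source ∩ f ⁻¹' c'.source := c.restr_source' _ ho
  refine Manifold.IsSubmersionAtOfComplement.mk_of_charts e (c.restr (f ⁻¹' c'.source)) c'
    (by rw [hs]; exact ⟨hx, hfx⟩) hfx (restr_mem_maximalAtlas _ hc ho) hc'
    (by rw [hs]; exact inter_subset_right) ?_
  intro v hv
  have hv' : v ∈ (c.restr (f ⁻¹' c'.source)).target := by simpa using hv
  have hy := (c.restr (f ⁻¹' c'.source)).map_target hv'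
  rw [hs] at hy
  have h1 := h _ hy.1 hy.2
  change c' (f (c.symm v)) = (e v).1
  refine h1.trans ?_
  have h2 : c (c.symm v) = v := (c.restr (f ⁻¹' c'.source)).right_inv hv'
  exact congrArg (fun w => (e w).1) h2

end

/-- A map to the sphere is smooth at a point if it is so as a map to the ambient space. -/
theorem contMDiffAt_sphere_of_coe {V E' H' M : Type*} [NormedAddCommGroup V]
    [InnerProductSpace ℝ V] {n : ℕ} [Fact (Module.finrank ℝ V = n + 1)] [NormedAddCommGroup E']
    [NormedSpace ℝ E'] [TopologicalSpace H'] {I : ModelWithCorners ℝ E' H'} [TopologicalSpace M]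
    [ChartedSpace H' M] {f : M → Metric.sphere (0 : V) 1} {x : M}
    (hf : ContMDiffAt I 𝓘(ℝ, V) ∞ (fun y => (f y : V)) x) : ContMDiffAt I (𝓡 n) ∞ f x := by
  rw [contMDiffAt_iff_target]
  refine ⟨IsInducing.subtypeVal.continuousAt_iff.2 hf.continuousAt, ?_⟩
  let U := (OrthonormalBasis.fromOrthogonalSpanSingleton (𝕜 := ℝ) n
    (ne_zero_of_mem_unit_sphere (-(f x)))).repr
  have hmem : (f x : V) ∈ {y : V | innerSL ℝ (-(f x : V)) y ≠ (1 : ℝ)} := by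
    have h1 : ‖(f x : V)‖ = 1 := by simp
    simp [h1]
    norm_num
  have hopen : IsOpen {y : V | innerSL ℝ (-(f x : V)) y ≠ (1 : ℝ)} :=
    isOpen_ne.preimage (innerSL ℝ (-(f x : V))).continuous
  have h1 : ContDiffAt ℝ ∞ (stereoToFun (-(f x : V))) (f x : V) :=
    contDiffOn_stereoToFun.contDiffAt (hopen.mem_nhds hmem)
  exact (U.contDiff.contDiffAt.comp _ h1).contMDiffAt.comp (f := fun y => (f y : V)) x hf

/-- The imaginary part of a quaternion. -/
def imL : ℍ[ℝ] →L[ℝ] EuclideanSpace ℝ (Fin 3) :=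
  LinearMap.toContinuousLinearMap
    { toFun q := !₂[q.imI, q.imJ, q.imK]
      map_add' p q := by ext i; fin_cases i <;> rfl
      map_smul' c q := by ext i; fin_cases i <;> simp }

theorem norm_imL_sq (q : ℍ[ℝ]) : ‖imL q‖ ^ 2 = ‖q‖ ^ 2 - q.re ^ 2 := by
  rw [norm_quaternion_sq, EuclideanSpace.norm_sq_eq, Fin.sum_univ_three]
  simp [imL]
  ring

/-- The imaginary quaternion with given coordinates. -/
def ofImL : EuclideanSpace ℝ (Fin 3) →L[ℝ] ℍ[ℝ] :=
  LinearMap.toContinuousLinearMap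
    { toFun v := ⟨0, v 0, v 1, v 2⟩
      map_add' v w := Quaternion.ext _ _ (add_zero 0).symm rfl rfl rfl
      map_smul' c v := by
        rw [RingHom.id_apply]
        exact Quaternion.ext _ _ (mul_zero c).symm rfl rfl rfl }

theorem imL_ofImL (v : EuclideanSpace ℝ (Fin 3)) : imL (ofImL v) = v := by
  ext i
  fin_cases i <;> rfl

theorem imL_one : imL 1 = 0 := by
  ext i
  fin_cases i <;> rfl

theorem re_ofImL (v : EuclideanSpace ℝ (Fin 3)) : (ofImL v).re = 0 := rfl

theorem re_smul_one_add_ofImL (q : ℍ[ℝ]) : q.re • (1 : ℍ[ℝ]) + ofImL (imL q) = q := by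
  have h : ofImL (imL q) = q.im := rfl
  rw [h, ← Algebra.algebraMap_eq_smul_one]
  exact Quaternion.re_add_im q

/-- The quaternion with given imaginary part that lies on the upper hemisphere, if the imaginary
part is in the unit ball. -/
def hemisphere (v : EuclideanSpace ℝ (Fin 3)) : ℍ[ℝ] := √(1 - ‖v‖ ^ 2) • (1 : ℍ[ℝ]) + ofImL v

theorem re_hemisphere (v : EuclideanSpace ℝ (Fin 3)) : (hemisphere v).re = √(1 - ‖v‖ ^ 2) := by
  simp [hemisphere, re_ofImL]

theorem imL_hemisphere (v : EuclideanSpace ℝ (Fin 3)) : imL (hemisphere v) = v := by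
  rw [hemisphere, map_add, map_smul, imL_one, smul_zero, zero_add, imL_ofImL]

theorem hemisphere_ne_zero (v : EuclideanSpace ℝ (Fin 3)) : hemisphere v ≠ 0 := by
  intro h
  have hv := imL_hemisphere v
  have hr := re_hemisphere v
  rw [h, map_zero] at hv
  rw [h, ← hv] at hr
  simp at hr

theorem norm_hemisphere {v : EuclideanSpace ℝ (Fin 3)} (hv : ‖v‖ < 1) : ‖hemisphere v‖ = 1 := by
  have h := norm_imL_sq (hemisphere v)
  rw [imL_hemisphere, re_hemisphere, Real.sq_sqrt (by nlinarith [norm_nonneg v])] at h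
  rw [← sq_eq_sq₀ (norm_nonneg _) zero_le_one]
  linarith

theorem contDiffAt_hemisphere {v : EuclideanSpace ℝ (Fin 3)} (hv : ‖v‖ < 1) :
    ContDiffAt ℝ ∞ hemisphere v := by
  have h : ContDiffAt ℝ ∞ (fun v : EuclideanSpace ℝ (Fin 3) => √(1 - ‖v‖ ^ 2)) v :=
    (contDiffAt_const.sub (contDiff_norm_sq ℝ).contDiffAt).sqrt (by nlinarith [norm_nonneg v])
  exact (h.smul contDiffAt_const).add ofImL.contDiff.contDiffAt

theorem continuous_hemisphere : Continuous hemisphere := by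
  unfold hemisphere
  fun_prop

/-- `hemisphere`, as a map to `Sp(1)`.  The normalisation only matters outside the unit ball, where
it makes the map total. -/
def unitOfIm (v : EuclideanSpace ℝ (Fin 3)) : Sp1 :=
  ⟨‖hemisphere v‖⁻¹ • hemisphere v, by
    rw [mem_sphere_zero_iff_norm, norm_smul, norm_inv, norm_norm,
      inv_mul_cancel₀ (norm_ne_zero_iff.2 (hemisphere_ne_zero v))]⟩

theorem coe_unitOfIm {v : EuclideanSpace ℝ (Fin 3)} (hv : ‖v‖ < 1) :
    (unitOfIm v : ℍ[ℝ]) = hemisphere v := by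
  change ‖hemisphere v‖⁻¹ • hemisphere v = _
  rw [norm_hemisphere hv, inv_one, one_smul]

theorem norm_imL_lt_one {q : Sp1} (hq : 0 < (q : ℍ[ℝ]).re) : ‖imL q‖ < 1 := by
  have h := norm_imL_sq q
  rw [norm_eq_of_mem_sphere] at h
  nlinarith [norm_nonneg (imL q)]

/-- The chart of `Sp(1)` at `p` that takes the imaginary part of `p⁻¹ q`. -/
def spOneChart (p : Sp1) : OpenPartialHomeomorph Sp1 (EuclideanSpace ℝ (Fin 3)) where
  toFun q := imL (p⁻¹ * q : Sp1)
  invFun v := p * unitOfIm v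
  source := {q | 0 < ((p⁻¹ * q : Sp1) : ℍ[ℝ]).re}
  target := Metric.ball 0 1
  map_source' q hq := by
    rw [mem_ball_zero_iff]
    exact norm_imL_lt_one hq
  map_target' v hv := by
    rw [mem_ball_zero_iff] at hv
    rw [mem_ofPred_eq, inv_mul_cancel_left, coe_unitOfIm hv, re_hemisphere]
    exact Real.sqrt_pos.2 (by nlinarith [norm_nonneg v])
  left_inv' q hq := by
    have hq' : 0 < ((p⁻¹ * q : Sp1) : ℍ[ℝ]).re := hq
    have h := norm_imL_sq (p⁻¹ * q : Sp1)
    rw [norm_eq_of_mem_sphere] at h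
    rw [← eq_inv_mul_iff_mul_eq]
    refine Subtype.ext ?_
    rw [coe_unitOfIm (norm_imL_lt_one hq), hemisphere, h,
      show 1 - (1 ^ 2 - ((p⁻¹ * q : Sp1) : ℍ[ℝ]).re ^ 2) = ((p⁻¹ * q : Sp1) : ℍ[ℝ]).re ^ 2 by ring,
      Real.sqrt_sq hq'.le, re_smul_one_add_ofImL]
  right_inv' v hv := by
    rw [mem_ball_zero_iff] at hv
    rw [inv_mul_cancel_left, coe_unitOfIm hv, imL_hemisphere]
  open_source := isOpen_Ioi.preimage (Quaternion.continuous_re.comp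
    (continuous_subtype_val.comp (continuous_const.mul continuous_id)))
  open_target := Metric.isOpen_ball
  continuousOn_toFun := (imL.continuous.comp
    (continuous_subtype_val.comp (continuous_const.mul continuous_id))).continuousOn
  continuousOn_invFun := by
    have h : Continuous unitOfIm := ((continuous_hemisphere.norm.inv₀ fun v =>
      norm_ne_zero_iff.2 (hemisphere_ne_zero v)).smul continuous_hemisphere).subtype_mk _
    exact (continuous_const.mul h).continuousOn

theorem spOneChart_mem_maximalAtlas (p : Sp1) :
    spOneChart p ∈ IsManifold.maximalAtlas (𝓡 3) ∞ Sp1 := by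
  have hcoe : ContMDiff (𝓡 3) 𝓘(ℝ, ℍ[ℝ]) ∞ ((↑) : Sp1 → ℍ[ℝ]) := contMDiff_coe_sphere
  refine (spOneChart p).mem_maximalAtlas_of_contMDiffOn ?_ ?_
  · let L : ℍ[ℝ] →L[ℝ] EuclideanSpace ℝ (Fin 3) :=
      imL ∘L ContinuousLinearMap.mul ℝ ℍ[ℝ] (p⁻¹ : Sp1)
    exact (L.contMDiff.comp hcoe).contMDiffOn
  · intro v hv
    have hv' : ‖v‖ < 1 := mem_ball_zero_iff.1 hv
    refine ContMDiffAt.contMDiffWithinAt (contMDiffAt_sphere_of_coe ?_)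
    have h : ContDiffAt ℝ ∞ (fun v => (p : ℍ[ℝ]) * hemisphere v) v :=
      contDiffAt_const.mul (contDiffAt_hemisphere hv')
    refine h.contMDiffAt.congr_of_eventuallyEq ?_
    filter_upwards [Metric.isOpen_ball.mem_nhds hv] with w hw
    change (p : ℍ[ℝ]) * (unitOfIm w : ℍ[ℝ]) = _
    rw [coe_unitOfIm (mem_ball_zero_iff.1 hw)]

theorem mem_spOneChart_source (p : Sp1) : p ∈ (spOneChart p).source := by
  change 0 < ((p⁻¹ * p : Sp1) : ℍ[ℝ]).re
  rw [inv_mul_cancel]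
  simp

theorem spinCoord_spOneHom (q : Sp1) :
    spinCoord (Spin7.toCLM (spOneHom q)) = (frameCoord stdFrame, WithLp.ofLp (imL q)) := by
  refine Prod.ext ?_ ?_
  · exact congrArg frameCoord (spOneHom_smul_stdFrame q)
  · have h := spOneHom_smul q 0 1
    rw [mul_one] at h
    have h2 : (spinCoord (Spin7.toCLM (spOneHom q))).2 = ![(spOneHom q • mk 0 1).snd.imI,
      (spOneHom q • mk 0 1).snd.imJ, (spOneHom q • mk 0 1).snd.imK] := rfl
    rw [h2, h]
    rfl

/-- The homomorphism `Sp(1) → Spin(7)`, conjugated by `h`. -/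
def spOneConj (h : Spin7) : Sp1 →* Spin7 := (MulAut.conj h).toMonoidHom.comp spOneHom

theorem spOneConj_apply (h : Spin7) (q : Sp1) : spOneConj h q = h * spOneHom q * h⁻¹ := rfl

theorem continuous_spOneHom : Continuous spOneHom := by
  refine Spin7.isEmbedding_toCLM.continuous_iff.2 (continuous_clm_apply.2 fun x => ?_)
  have h : (fun q : Sp1 => Spin7.toCLM (spOneHom q) x) = fun q : Sp1 => mk x.fst ((q : ℍ[ℝ]) * x.snd) :=
    funext fun q => spOneHom_smul q x.fst x.snd
  change Continuous (fun q : Sp1 => Spin7.toCLM (spOneHom q) x)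
  rw [h]
  exact (WithLp.prod_continuous_toLp 2 _ _).comp
    (continuous_const.prodMk (continuous_subtype_val.mul continuous_const))

theorem spOneHom_injective : Function.Injective spOneHom := by
  intro q q' h
  have h1 := spOneHom_smul q 0 1
  rw [h, spOneHom_smul, mul_one, mul_one] at h1
  exact Subtype.ext (congrArg WithLp.snd h1).symm

instance : T2Space Spin7 := Spin7.isEmbedding_toCLM.t2Space

theorem isEmbedding_spOneConj (h : Spin7) : IsEmbedding (spOneConj h) := by
  have he : ⇑(spOneConj h) = Spin7.translate (h⁻¹, h⁻¹) ∘ spOneHom := by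
    ext1 q
    change h * spOneHom q * h⁻¹ = h⁻¹⁻¹ * spOneHom q * h⁻¹
    rw [inv_inv]
  rw [he]
  exact (Spin7.translate _).isEmbedding.comp
    (continuous_spOneHom.isClosedEmbedding spOneHom_injective).isEmbedding

/-- The chart of `Spin(7)`, centred so that subgroups become linear subspaces. -/
def Spin7.shiftedChart (p : Spin7 × Spin7) (a : EuclideanSpace ℝ (Fin 21)) :
    OpenPartialHomeomorph Spin7 (EuclideanSpace ℝ (Fin 21)) :=
  (atlas.chart p).trans (Homeomorph.addRight a).toOpenPartialHomeomorph

theorem Spin7.shiftedChart_mem_maximalAtlas (p : Spin7 × Spin7) (a : EuclideanSpace ℝ (Fin 21)) :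
    shiftedChart p a ∈ IsManifold.maximalAtlas (𝓡 21) ∞ Spin7 := by
  have hmem : atlas.chart p ∈ IsManifold.maximalAtlas (𝓡 21) ∞ Spin7 :=
    atlas.chart_mem_maximalAtlas p
  have hp := contMDiffOn_of_mem_maximalAtlas hmem
  have hp' := contMDiffOn_symm_of_mem_maximalAtlas hmem
  have ha : ∀ a : EuclideanSpace ℝ (Fin 21), ContMDiff (𝓡 21) (𝓡 21) ∞ (fun y => y + a) :=
    fun a => (contDiff_id.add contDiff_const).contMDiff
  refine (shiftedChart p a).mem_maximalAtlas_of_contMDiffOn ?_ ?_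
  · refine ((ha a).comp_contMDiffOn hp).mono ?_
    intro x hx
    simpa [shiftedChart] using hx
  · refine hp'.comp (ha (-a)).contMDiffOn ?_
    intro y hy
    simpa [shiftedChart] using hy

/-- In the charts `q ↦ Im (p⁻¹ q)` of `Sp(1)` and suitable charts of `Spin(7)`, the homomorphism
`Sp(1) → Spin(7)` is the inclusion of the last coordinates. -/
theorem isSmoothEmbedding_spOneConj (h : Spin7) :
    Manifold.IsSmoothEmbedding (𝓡 3) (𝓡 21) ∞ (spOneConj h) := by
  refine ⟨?_, isEmbedding_spOneConj h⟩
  apply Manifold.IsImmersionOfComplement.isImmersion (F := FrameCoord)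
  intro p
  let e : (EuclideanSpace ℝ (Fin 3) × FrameCoord) ≃L[ℝ] EuclideanSpace ℝ (Fin 21) :=
    (((EuclideanSpace.equiv (Fin 3) ℝ).prodCongr (ContinuousLinearEquiv.refl ℝ FrameCoord)).trans
      (ContinuousLinearEquiv.prodComm ℝ _ _)).trans spinEquiv
  let c := Spin7.shiftedChart (spOneConj h p * h, h) (-spinEquiv (frameCoord stdFrame, 0))
  have ha : (spOneConj h p * h)⁻¹ * spOneConj h p * h = 1 := by group
  have hq : ∀ q, (spOneConj h p * h)⁻¹ * spOneConj h q * h = spOneHom (p⁻¹ * q) := by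
    intro q
    rw [spOneConj_apply, spOneConj_apply, map_mul, map_inv]
    group
  have hc : ∀ q, spOneConj h q ∈ c.source → c (spOneConj h q) = e (imL (p⁻¹ * q : Sp1), 0) := by
    intro q hqs
    have hqs' : spOneConj h q ∈ (Spin7.atlas.chart (spOneConj h p * h, h)).source := by
      simpa [c, Spin7.shiftedChart] using hqs
    change Spin7.atlas.chart (spOneConj h p * h, h) (spOneConj h q) +
      -spinEquiv (frameCoord stdFrame, 0) = spinEquiv (0, WithLp.ofLp (imL (p⁻¹ * q : Sp1)))
    rw [Spin7.atlas_chart_apply hqs', hq, spinCoord_spOneHom, ← sub_eq_add_neg, ← map_sub]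
    simp
  have hpc : spOneConj h p ∈ c.source := by
    have : spOneConj h p ∈ (Spin7.atlas.chart (spOneConj h p * h, h)).source := by
      rw [Spin7.mem_atlas_chart_source, ha]
      exact Spin7.one_mem_chartOne_source
    simpa [c, Spin7.shiftedChart] using this
  exact isImmersionAtOfComplement_of_charts (isEmbedding_spOneConj h).continuous e
    (spOneChart_mem_maximalAtlas p) (Spin7.shiftedChart_mem_maximalAtlas _ _)
    (mem_spOneChart_source p) hpc fun q _ hq => hc q hq

/-! ### The orbit map -/

/-- A map that is linear and surjective in some charts is open. -/
theorem map_nhds_of_charts {E E' K M N : Type*} [NormedAddCommGroup E] [NormedSpace ℝ E]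
    [NormedAddCommGroup E'] [NormedSpace ℝ E'] [NormedAddCommGroup K] [NormedSpace ℝ K]
    [TopologicalSpace M] [TopologicalSpace N] {f : M → N} {c : OpenPartialHomeomorph M E}
    {c' : OpenPartialHomeomorph N E'} {x : M} (hf : Continuous f) (e : E ≃L[ℝ] (E' × K))
    (hx : x ∈ c.source) (hfx : f x ∈ c'.source)
    (h : ∀ y ∈ c.source, f y ∈ c'.source → c' (f y) = (e (c y)).1) :
    Filter.map f (𝓝 x) = 𝓝 (f x) := by
  have hs' : ∀ᶠ y in 𝓝 x, f y ∈ c'.source :=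
    hf.continuousAt.eventually_mem (c'.open_source.mem_nhds hfx)
  have h1 : Filter.map (fun y => c' (f y)) (𝓝 x) = 𝓝 (c' (f x)) := by
    have h2 : (fun y => c' (f y)) =ᶠ[𝓝 x] (fun w => (e w).1) ∘ c := by
      filter_upwards [hs', c.open_source.mem_nhds hx] with y hy hy'
      exact h y hy' hy
    rw [Filter.map_congr h2, ← Filter.map_map, c.map_nhds_eq hx, h x hx hfx]
    exact (isOpenMap_fst.comp e.toHomeomorph.isOpenMap).map_nhds_eq
      (continuous_fst.comp e.continuous).continuousAt
  have h3 : (fun y => c'.symm (c' (f y))) =ᶠ[𝓝 x] f := by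
    filter_upwards [hs'] with y hy
    exact c'.left_inv hy
  rw [← Filter.map_congr h3, ← c'.symm_map_nhds_eq hfx, ← h1, Filter.map_map]
  rfl

section OrbitMap

variable (h : Spin7)

theorem continuous_stdOrbit_mul : Continuous (fun g : Spin7 => stdOrbit (g * h)) := by
  refine Continuous.subtype_mk (continuous_pi fun i => ?_) _
  have he : (fun g : Spin7 => ((g * h) • stdFrame) i) =
      fun g => Spin7.toCLM g (h • stdFrame i) :=
    funext fun g => mul_smul g h _
  change Continuous (fun g : Spin7 => ((g * h) • stdFrame) i)
  rw [he]
  exact Spin7.isEmbedding_toCLM.continuous.clm_apply continuous_const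

/-- The first `18` coordinates of `Spin(7)`. -/
def splitEquiv : EuclideanSpace ℝ (Fin 21) ≃L[ℝ] EuclideanSpace ℝ (Fin 18) × (Fin 3 → ℝ) :=
  spinEquiv.symm.trans (frameEquiv.prodCongr (ContinuousLinearEquiv.refl ℝ (Fin 3 → ℝ)))

/-- In the charts, the orbit map is the projection to the first `18` coordinates. -/
theorem frameAtlas_chart_stdOrbit {x y : Spin7}
    (hy : y ∈ (Spin7.atlas.chart (x * h, h)).source)
    (hy' : stdOrbit (y * h) ∈ (frameAtlas.chart (x * h)).source) :
    frameAtlas.chart (x * h) (stdOrbit (y * h)) =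
      (splitEquiv (Spin7.atlas.chart (x * h, h) y)).1 := by
  rw [frameAtlas_chart_apply hy', Spin7.atlas_chart_apply hy]
  change _ = frameEquiv (spinEquiv.symm (spinEquiv _)).1
  rw [ContinuousLinearEquiv.symm_apply_apply]
  change _ = frameEquiv (frameCoord (((x * h)⁻¹ * y * h) • stdFrame))
  rw [mul_assoc, mul_smul]
  rfl

theorem mem_atlas_chart_source_self (x : Spin7) :
    x ∈ (Spin7.atlas.chart (x * h, h)).source := by
  rw [Spin7.mem_atlas_chart_source]
  have : (x * h)⁻¹ * x * h = 1 := by group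
  rw [this]
  exact Spin7.one_mem_chartOne_source

theorem isOpenMap_stdOrbit_mul : IsOpenMap (fun g : Spin7 => stdOrbit (g * h)) :=
  isOpenMap_iff_nhds_le.2 fun x => (map_nhds_of_charts (continuous_stdOrbit_mul h) splitEquiv
    (mem_atlas_chart_source_self h x) (stdOrbit_mem_frameAtlas_chart_source (x * h))
    fun _ hy hy' => frameAtlas_chart_stdOrbit h hy hy').ge

/-- The homeomorphism `Spin(7) / Spin(7)_f → V`, for `f` the standard frame moved by `h`. -/
def orbitHomeomorph : (Spin7 ⧸ MulAction.stabilizer Spin7 (h • stdFrame)) ≃ₜ CayleyStiefel :=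
  have hmk : ∀ g : Spin7, MulAction.ofQuotientStabilizer Spin7 (h • stdFrame) g =
      (stdOrbit (g * h) : Fin 4 → Cayley) := fun g => (mul_smul g h stdFrame).symm
  have hF : ∀ q : Spin7 ⧸ MulAction.stabilizer Spin7 (h • stdFrame),
      IsCayleyFrame (MulAction.ofQuotientStabilizer Spin7 (h • stdFrame) q) := by
    intro q
    obtain ⟨g, rfl⟩ := QuotientGroup.mk_surjective q
    rw [hmk]
    exact (stdOrbit (g * h)).2
  let F : (Spin7 ⧸ MulAction.stabilizer Spin7 (h • stdFrame)) → CayleyStiefel := fun q =>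
    ⟨MulAction.ofQuotientStabilizer Spin7 (h • stdFrame) q, hF q⟩
  have hcomp : F ∘ QuotientGroup.mk = fun g => stdOrbit (g * h) :=
    funext fun g => Subtype.ext (hmk g)
  have hbij : Function.Bijective F := by
    refine ⟨fun q q' hq => MulAction.injective_ofQuotientStabilizer Spin7 _
      (congrArg Subtype.val hq), fun f => ?_⟩
    obtain ⟨g, hg⟩ := isCayleyFrame_iff.1 f.2
    refine ⟨((g * h⁻¹ : Spin7) : Spin7 ⧸ MulAction.stabilizer Spin7 (h • stdFrame)), ?_⟩
    refine (congrFun hcomp (g * h⁻¹)).trans (Subtype.ext ?_)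
    change (g * h⁻¹ * h) • stdFrame = f
    rw [inv_mul_cancel_right, hg]
  (Equiv.ofBijective F hbij).toHomeomorphOfContinuousOpen
    ((QuotientGroup.isQuotientMap_mk _).continuous_iff.2 (by
      change Continuous (F ∘ QuotientGroup.mk)
      rw [hcomp]
      exact continuous_stdOrbit_mul h))
    (by
      intro U hU
      have hi : F '' U = (fun g => stdOrbit (g * h)) '' (QuotientGroup.mk ⁻¹' U) := by
        rw [← hcomp, image_comp, image_preimage_eq _ QuotientGroup.mk_surjective]
      change IsOpen (F '' U)
      rw [hi]
      exact isOpenMap_stdOrbit_mul h _ (hU.preimage QuotientGroup.continuous_mk))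

theorem orbitHomeomorph_mk (g : Spin7) :
    orbitHomeomorph h (g : Spin7 ⧸ MulAction.stabilizer Spin7 (h • stdFrame)) =
      stdOrbit (g * h) :=
  Subtype.ext (mul_smul g h stdFrame).symm

/-- The manifold structure of the quotient, transported from `V`. -/
def quotientAtlas := frameAtlas.compHomeomorph (orbitHomeomorph h)

theorem isSubmersion_quotient_mk : letI := (quotientAtlas h).chartedSpace
    Manifold.IsSubmersion (𝓡 21) (𝓡 18) ∞
      (fun g : Spin7 => (g : Spin7 ⧸ MulAction.stabilizer Spin7 (h • stdFrame))) := by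
  let := (quotientAtlas h).chartedSpace
  apply Manifold.IsSubmersionOfComplement.isSubmersion (F := Fin 3 → ℝ)
  intro x
  have hs : ∀ y : Spin7, (y : Spin7 ⧸ MulAction.stabilizer Spin7 (h • stdFrame)) ∈
      ((quotientAtlas h).chart (x * h)).source ↔
      stdOrbit (y * h) ∈ (frameAtlas.chart (x * h)).source := by
    intro y
    simp [quotientAtlas, LinearAtlas.compHomeomorph, orbitHomeomorph_mk]
  refine isSubmersionAtOfComplement_of_charts (f := fun g : Spin7 =>
    (g : Spin7 ⧸ MulAction.stabilizer Spin7 (h • stdFrame)))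
    QuotientGroup.continuous_mk splitEquiv
    (Spin7.atlas.chart_mem_maximalAtlas (x * h, h))
    ((quotientAtlas h).chart_mem_maximalAtlas (x * h)) (mem_atlas_chart_source_self h x)
    ((hs x).2 (stdOrbit_mem_frameAtlas_chart_source (x * h))) ?_
  intro y hy hy'
  refine Eq.trans ?_ (frameAtlas_chart_stdOrbit h hy ((hs y).1 hy'))
  exact congrArg (frameAtlas.chart (x * h)) (orbitHomeomorph_mk h y)

/-- The diffeomorphism `Spin(7) / Spin(7)_f → V`. -/
theorem exists_diffeomorph : letI := (quotientAtlas h).chartedSpace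
    ∃ Φ : (Spin7 ⧸ MulAction.stabilizer Spin7 (h • stdFrame)) ≃ₘ^∞⟮𝓡 18, 𝓡 18⟯ CayleyStiefel,
      ∀ g : Spin7, (Φ (g : Spin7 ⧸ MulAction.stabilizer Spin7 (h • stdFrame)) : Fin 4 → Cayley) =
        g • (h • stdFrame) := by
  let := (quotientAtlas h).chartedSpace
  refine ⟨⟨(orbitHomeomorph h).toEquiv, ?_, ?_⟩, fun g => rfl⟩
  · exact frameAtlas.contMDiff_of_incl (quotientAtlas h).contMDiff_incl
  · refine (quotientAtlas h).contMDiff_of_incl ?_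
    refine frameAtlas.contMDiff_incl.congr fun f => ?_
    exact congrArg Subtype.val ((orbitHomeomorph h).apply_symm_apply f)

theorem range_spOneConj :
    (spOneConj h).range = MulAction.stabilizer Spin7 (h • stdFrame) := by
  rw [MulAction.stabilizer_smul_eq_stabilizer_map_conj, ← range_spOneHom, spOneConj,
    MonoidHom.range_comp]

end OrbitMap

end

theorem proposition3p2 :
    Nonempty CayleyStiefel ∧
    -- `Spin(7)` is a Lie group of dimension 21 and `V` is a manifold of dimension 18
    ∃ (_ : ChartedSpace (EuclideanSpace ℝ (Fin 21)) Spin7)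
      (_ : ChartedSpace (EuclideanSpace ℝ (Fin 18)) CayleyStiefel),
      LieGroup (𝓡 21) ∞ Spin7 ∧
      IsManifold (𝓡 18) ∞ CayleyStiefel ∧
      -- `V` is an embedded submanifold of `(ℝ⁸)⁴`
      Manifold.IsSmoothEmbedding (𝓡 18) 𝓘(ℝ, Fin 4 → Cayley) ∞
        (fun f : CayleyStiefel => (f : Fin 4 → Cayley)) ∧
      -- the action of `Spin(7)` on `ℝ⁸` is smooth
      ContMDiff ((𝓡 21).prod 𝓘(ℝ, Cayley)) 𝓘(ℝ, Cayley) ∞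
        (fun p : Spin7 × Cayley => p.1 • p.2) ∧
      ∀ f : Fin 4 → Cayley, IsCayleyFrame f →
        -- `Spin(7)` acts on `V`, and transitively
        MulAction.orbit Spin7 f = {f' | IsCayleyFrame f'} ∧
        -- the isotropy group is a Lie subgroup isomorphic to `Sp(1)`
        (∃ φ : Sp1 →* Spin7, Manifold.IsSmoothEmbedding (𝓡 3) (𝓡 21) ∞ φ ∧
          φ.range = MulAction.stabilizer Spin7 f) ∧
        -- the orbit map induces a diffeomorphism from the quotient manifold onto `V`
        ∃ _ : ChartedSpace (EuclideanSpace ℝ (Fin 18)) (Spin7 ⧸ MulAction.stabilizer Spin7 f),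
          IsManifold (𝓡 18) ∞ (Spin7 ⧸ MulAction.stabilizer Spin7 f) ∧
          Manifold.IsSubmersion (𝓡 21) (𝓡 18) ∞
            (fun g : Spin7 => (g : Spin7 ⧸ MulAction.stabilizer Spin7 f)) ∧
          ∃ Φ : (Spin7 ⧸ MulAction.stabilizer Spin7 f) ≃ₘ^∞⟮𝓡 18, 𝓡 18⟯ CayleyStiefel,
            ∀ g : Spin7, (Φ (g : Spin7 ⧸ MulAction.stabilizer Spin7 f) : Fin 4 → Cayley) = g • f := by
  refine ⟨⟨stdOrbit 1⟩, Spin7.atlas.chartedSpace, frameAtlas.chartedSpace, Spin7.lieGroup,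
    frameAtlas.isManifold, frameAtlas.isSmoothEmbedding, Spin7.contMDiff_smul, ?_⟩
  intro f hf
  obtain ⟨h, rfl⟩ := isCayleyFrame_iff.1 hf
  refine ⟨?_, ⟨spOneConj h, isSmoothEmbedding_spOneConj h, range_spOneConj h⟩,
    (quotientAtlas h).chartedSpace, (quotientAtlas h).isManifold, isSubmersion_quotient_mk h,
    exists_diffeomorph h⟩
  ext f'
  rw [MulAction.orbit_smul, Set.mem_ofPred_eq, isCayleyFrame_iff]
  rfl
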